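/- **Notions.** Coproducts are indexed by small sets; $\mathcal V$, $\mathcal W$ are locally small categories with coproducts. A *$\mathcal V$-graph* $X$ is a set $X_0$ with objects $X(a,b)\in\mathcal V$ for $a,b\in X_0$; a morphism is a function on objects with morphisms $X(a,b)\to Y(fa,fb)$. This gives the category $\mathcal G\mathcal V$. A *multitensor* (lax monoidal structure) $E$ on $\mathcal V$ consists of functors $E_n:\mathcal V^n\to\mathcal V$ ($n\ge 0$; $E_n(Z_1,\dots,Z_n)$ is also written $E_i Z_i$), and natural maps $u:Z\to E_1Z$ and $\sigma:E_iE_jZ_{ij}\to E_{ij}Z_{ij}$, satisfying the unit and associativity laws. A morphism of multitensors $\varepsilon:E\to F$ on $\mathcal V$ is a family of natural transformations $E_n\to F_n$ compatible with $u$ and $\sigma$. A *lax monoidal functor* $(H,\psi):(\mathcal V,E)\to(\mathcal W,F)$ is a functor $H:\mathcal V\to\mathcal W$ with natural maps $\psi:F_iHX_i\to HE_iX_i$ compatible with $u$ and $\sigma$. $E$ is *distributive* if each $E_n$ preserves coproducts in each variable. For $E$ distributive, $\Gamma E$ is the monad on $\mathcal G\mathcal V$ which is the identity on object sets, with $$\Gamma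 E(X)(a,b)=\coprod_{a=x_0,\dots,x_n=b}E_i\,X(x_{i-1},x_i)$$ (the coproduct over all $n\ge0$ and all sequences of objects from $a$ to $b$), and with unit and multiplication induced by $u$ and $\sigma$. A morphism $\varepsilon:E\to F$ induces a monad morphism $\Gamma\varepsilon:\Gamma E\to\Gamma F$. For $(H,\psi)$ between distributive lax monoidal categories, $\Gamma\psi:\Gamma F\circ\mathcal GH\Rightarrow\mathcal GH\circ\Gamma E$ is the identity on objects and on homs is the composite $$\coprod F_iHX(x_{i-1},x_i)\xrightarrow{\;\coprod\psi\;}\coprod HE_iX(x_{i-1},x_i)\longrightarrow H\coprod E_iX(x_{i-1},x_i).$$ For a class $\mathcal I$ of maps of a category, a map is a *trivial $\mathcal I$-fibration* if it has the right lifting property with respect to every map of $\mathcal I$; a natural transformation is one if all its components are. For a class $\mathcal I$ of maps of $\mathcal W$, $\mathcal I^+$ is the class of maps of $\mathcal G\mathcal W$ consisting of $\emptyset\to0$, where $0$ is the graph with one object and initial hom, and of $(i):(S)\to(B)$ for $i\in\mathcal I$, where $(S)$ has two objects $0,1$, with $(S)(0,1)=S$ and all other homs initial. $\mathcal W$ is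 *extensive* if $\prod_j\mathcal W/X_j\to\mathcal W/\coprod_jX_j$ is an equivalence for every family $(X_j)$, and $B\in\mathcal W$ is *connected* if $\mathcal W(B,-)$ preserves coproducts. For a coproduct preserving monad $T$ on a category with finite products that distribute over coproducts, $T^\times$ is the distributive multitensor $(Z_1,\dots,Z_n)\mapsto TZ_1\times\dots\times TZ_n$. Let $\mathcal T_{\le0}$ be the identity monad on $\mathbf{Set}$ and $\mathcal T_{\le n+1}=\Gamma(\mathcal T_{\le n}^\times)$, a monad on $\mathcal G^{n+1}\mathbf{Set}$; let $\mathcal T_{\le\infty}$ be the monad on the category of globular sets whose algebras are the strict $\omega$-categories. Identifying graphs enriched in globular sets with globular sets, one has $\Gamma(\mathcal T_{\le\infty}^\times)=\mathcal T_{\le\infty}$; put $\infty+1=\infty$. Let $\mathcal I_{\le0}=\{\emptyset\to1,\;1+1\to1\}$, $\mathcal I_{\le n+1}=(\mathcal I_{\le n})^+$, and let $\mathcal I_{\le\infty}$ be the set of inclusions $\partial k\hookrightarrow k$ ($k\ge0$) of the $k$-globe with its unique $k$-cell removed into the $k$-globe. A *$\mathcal T_{\le n+1}$-operad over $\mathbf{Set}$*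 is a monad morphism $\alpha:A\to\mathcal T_{\le n+1}$ that is a cartesian natural transformation and whose components are the identity on objects ($0$-cells), up to relabelling. A *$\mathcal T_{\le n}^\times$-multitensor* is a morphism of multitensors $\varepsilon:E\to\mathcal T_{\le n}^\times$ all of whose naturality squares are pullbacks. They *correspond* if $E$ is distributive and there is an isomorphism of monads $\Gamma E\cong A$ that identifies $\alpha$ with $\Gamma\varepsilon$. The operad $\alpha$ is *contractible* if it is a trivial $\mathcal I_{\le n+1}$-fibration, and the multitensor $\varepsilon$ is *contractible* if it is a trivial $\mathcal I_{\le n}$-fibration. **Proposition.** Let $(H,\psi):(\mathcal V,E)\to(\mathcal W,F)$ be a lax monoidal functor between distributive lax monoidal categories and $\mathcal I$ a class of maps in $\mathcal W$. Suppose that $\mathcal W$ is extensive, that $H$ preserves coproducts and that the codomains of the maps in $\mathcal I$ are connected. Then $\psi$ is a trivial $\mathcal I$-fibration if and only if $\Gamma\psi$ is a trivial $\mathcal I^+$-fibration. **Corollary.** Let $0\le n\le\infty$, let $\alpha:A\to\mathcal T_{\le n+1}$ be a $\mathcal T_{\le n+1}$-operad over $\mathbf{Set}$ and let $\varepsilon:E\to\mathcal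 T_{\le n}^\times$ be the corresponding $\mathcal T_{\le n}^\times$-multitensor. Then $\alpha$ is contractible if and only if $\varepsilon$ is contractible. -/

import Mathlib

open CategoryTheory CategoryTheory.Limits

universe v u u'

/-- The family `c` of morphisms with codomain `Z` is a coproduct cocone. -/
def IsCoprod {V : Type u} [Category.{v} V] {J : Type v} {A : J → V} {Z : V}
    (c : ∀ j, A j ⟶ Z) : Prop :=
  Nonempty (IsColimit (Cofan.mk Z c))

namespace IsCoprod

variable {V : Type u} [Category.{v} V] {J : Type v} {A : J → V} {Z : V} {c : ∀ j, A j ⟶ Z}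

lemma exists_desc (h : IsCoprod c) {W : V} (f : ∀ j, A j ⟶ W) : ∃ g : Z ⟶ W, ∀ j, c j ≫ g = f j :=
  ⟨Cofan.IsColimit.desc h.some f, fun j => Cofan.IsColimit.fac h.some f j⟩

lemma hom_ext (h : IsCoprod c) {W : V} {f g : Z ⟶ W} (e : ∀ j, c j ≫ f = c j ≫ g) : f = g :=
  Cofan.IsColimit.hom_ext h.some _ _ e

/-- The morphism out of a coproduct induced by a family. -/
noncomputable def desc (h : IsCoprod c) {W : V} (f : ∀ j, A j ⟶ W) : Z ⟶ W :=
  (h.exists_desc f).choose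

lemma fac (h : IsCoprod c) {W : V} (f : ∀ j, A j ⟶ W) (j : J) : c j ≫ h.desc f = f j :=
  (h.exists_desc f).choose_spec j

lemma of_existsUnique (H : ∀ (W : V) (f : ∀ j, A j ⟶ W), ∃ g : Z ⟶ W, ∀ j, c j ≫ g = f j)
    (H' : ∀ (W : V) (f g : Z ⟶ W), (∀ j, c j ≫ f = c j ≫ g) → f = g) : IsCoprod c :=
  ⟨Cofan.IsColimit.mk _ (fun s => (H _ s.inj).choose) (fun s => (H _ s.inj).choose_spec)
    (fun s _ hm => H' _ _ _ fun j => (hm j).trans ((H _ s.inj).choose_spec j).symm)⟩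

lemma sigma [HasCoproducts.{v} V] (A : J → V) : IsCoprod (fun j => Sigma.ι A j) :=
  ⟨coproductIsCoproduct A⟩

/-- Two coproducts of the same family are isomorphic. -/
lemma exists_iso (h : IsCoprod c) {Z' : V} {c' : ∀ j, A j ⟶ Z'} (h' : IsCoprod c') :
    ∃ e : Z ≅ Z', ∀ j, c j ≫ e.hom = c' j :=
  ⟨⟨h.desc c', h'.desc c, h.hom_ext fun j => by rw [← Category.assoc, h.fac, h'.fac, Category.comp_id],
    h'.hom_ext fun j => by rw [← Category.assoc, h'.fac, h.fac, Category.comp_id]⟩, h.fac c'⟩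

lemma comp_iso (h : IsCoprod c) {Z' : V} (e : Z ⟶ Z') [IsIso e] : IsCoprod (fun j => c j ≫ e) :=
  of_existsUnique (fun W f => ⟨inv e ≫ h.desc f, fun j => by simp [h.fac]⟩)
    (fun W f g H => by
      rw [← cancel_epi e]
      exact h.hom_ext fun j => by simpa using H j)

end IsCoprod

/-- A functor preserving (small) coproducts sends coproduct cocones to coproduct cocones. -/
lemma IsCoprod.map {V : Type u} [Category.{v} V] {W : Type u'} [Category.{v} W] {J : Type v}
    {A : J → V} {Z : V} {c : ∀ j, A j ⟶ Z} (h : IsCoprod c) (F : V ⥤ W)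
    [PreservesColimitsOfShape (Discrete J) F] : IsCoprod (fun j => F.map (c j)) :=
  ⟨isColimitCofanMkObjOfIsColimit F _ c h.some⟩

/-- A graph enriched in `V`: a set of objects and a family of objects of `V`. -/
structure VGraph (V : Type u) [Category.{v} V] : Type (max u (v + 1)) where
  Obj : Type v
  hom : Obj → Obj → V

namespace VGraph

section

variable {V : Type u} [Category.{v} V]

/-- A morphism of `V`-graphs. -/
structure Hom (X Y : VGraph V) : Type v where
  obj : X.Obj → Y.Obj
  map : ∀ a b, X.hom a b ⟶ Y.hom (obj a) (obj b)

/-- The category `𝒢V` of `V`-graphs. -/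
instance : Category.{v} (VGraph V) where
  Hom := Hom
  id X := ⟨id, fun _ _ => 𝟙 _⟩
  comp f g := ⟨g.obj ∘ f.obj, fun a b => f.map a b ≫ g.map _ _⟩
  id_comp f := by cases f; simp
  comp_id f := by cases f; simp
  assoc f g h := by simp [Function.comp_assoc]

@[simp] lemma id_obj (X : VGraph V) : Hom.obj (𝟙 X) = id := rfl
@[simp] lemma id_map (X : VGraph V) (a b : X.Obj) : Hom.map (𝟙 X) a b = 𝟙 _ := rfl
@[simp] lemma comp_obj {X Y Z : VGraph V} (f : X ⟶ Y) (g : Y ⟶ Z) :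
    Hom.obj (f ≫ g) = g.obj ∘ f.obj := rfl
@[simp] lemma comp_map {X Y Z : VGraph V} (f : X ⟶ Y) (g : Y ⟶ Z) (a b : X.Obj) :
    Hom.map (f ≫ g) a b = f.map a b ≫ g.map _ _ := rfl

/-- The transport morphism between homs with equal end points. -/
def cast (X : VGraph V) {a b a' b' : X.Obj} (ha : a = a') (hb : b = b') :
    X.hom a b ⟶ X.hom a' b' := eqToHom (by rw [ha, hb])

@[simp] lemma cast_rfl (X : VGraph V) {a b : X.Obj} (ha : a = a) (hb : b = b) :
    X.cast ha hb = 𝟙 _ := rfl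

lemma hom_ext {X Y : VGraph V} {f g : X ⟶ Y} (h : ∀ a, f.obj a = g.obj a)
    (h' : ∀ a b, f.map a b ≫ Y.cast (h a) (h b) = g.map a b) : f = g := by
  obtain ⟨f₀, f₁⟩ := f
  obtain ⟨g₀, g₁⟩ := g
  obtain rfl : f₀ = g₀ := funext h
  have : f₁ = g₁ := by
    funext a b
    simpa using h' a b
  rw [this]

lemma hom_ext' {X Y : VGraph V} {f₀ : X.Obj → Y.Obj}
    {f g : ∀ a b, X.hom a b ⟶ Y.hom (f₀ a) (f₀ b)}
    (h : ∀ a b, f a b = g a b) : (⟨f₀, f⟩ : X ⟶ Y) = ⟨f₀, g⟩ := by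
  rw [show f = g from funext fun a => funext fun b => h a b]

lemma map_congr {X Y : VGraph V} {f g : X ⟶ Y} (h : f = g) (a b : X.Obj) :
    f.map a b ≫ Y.cast (by rw [h]) (by rw [h]) = g.map a b := by
  subst h; simp

lemma cast_map {X Y : VGraph V} (f : X ⟶ Y) {a b a' b' : X.Obj} (ha : a = a') (hb : b = b') :
    X.cast ha hb ≫ f.map a' b' = f.map a b ≫ Y.cast (by rw [ha]) (by rw [hb]) := by
  subst ha hb; simp

@[simp] lemma cast_trans (X : VGraph V) {a b a' b' a'' b'' : X.Obj} (ha : a = a') (hb : b = b')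
    (ha' : a' = a'') (hb' : b' = b'') :
    X.cast ha hb ≫ X.cast ha' hb' = X.cast (ha.trans ha') (hb.trans hb') := by
  subst ha hb ha' hb'; simp

instance (X : VGraph V) {a b a' b' : X.Obj} (ha : a = a') (hb : b = b') :
    IsIso (X.cast ha hb) := by unfold cast; infer_instance

end

variable {V : Type u} [Category.{v} V] {W : Type u'} [Category.{v} W]

/-- The functor `𝒢H : 𝒢V ⥤ 𝒢W` which applies `H` to homs. -/
def mapFunctor (H : V ⥤ W) : VGraph V ⥤ VGraph W where
  obj X := ⟨X.Obj, fun a b => H.obj (X.hom a b)⟩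
  map f := ⟨f.obj, fun a b => H.map (f.map a b)⟩
  map_id X := hom_ext' fun a b => by simp
  map_comp f g := hom_ext' fun a b => by simp

end VGraph

/-! ### Sequences of sequences -/

/-- The position `(i, j)` of the `l`-th entry of a concatenation of `k` sequences of lengths
`n 0, …, n (k - 1)`: it is the `j`-th entry of the `i`-th sequence. -/
abbrev split {k : ℕ} {n : Fin k → ℕ} (l : Fin (∑ i, n i)) : (i : Fin k) × Fin (n i) :=
  finSigmaFinEquiv.symm l

/-- The position of the `j`-th entry of the `i`-th sequence in the concatenation. -/
abbrev join {k : ℕ} {n : Fin k → ℕ} (i : Fin k) (j : Fin (n i)) : Fin (∑ i, n i) :=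
  finSigmaFinEquiv ⟨i, j⟩

/-- The concatenation of a sequence of sequences. -/
abbrev flat {S : Type*} {k : ℕ} {n : Fin k → ℕ} (Z : ∀ i, Fin (n i) → S) : Fin (∑ i, n i) → S :=
  fun l => Z (split l).1 (split l).2

lemma split_join {k : ℕ} {n : Fin k → ℕ} (i : Fin k) (j : Fin (n i)) : split (join i j) = ⟨i, j⟩ :=
  Equiv.symm_apply_apply _ _

lemma join_split {k : ℕ} {n : Fin k → ℕ} (l : Fin (∑ i, n i)) :
    join (split l).1 (split l).2 = l :=
  Equiv.apply_symm_apply _ _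

/-- The position at which the `i`-th sequence starts in the concatenation. -/
def startPos {k : ℕ} (n : Fin k → ℕ) (i : ℕ) : ℕ :=
  ∑ i' : Fin k, if i'.val < i then n i' else 0

lemma startPos_succ {k : ℕ} (n : Fin k → ℕ) (i : Fin k) :
    startPos n (i.val + 1) = startPos n i.val + n i := by
  unfold startPos
  have : n i = ∑ i' : Fin k, if i' = i then n i' else 0 := by simp
  rw [this, ← Finset.sum_add_distrib]
  refine Finset.sum_congr rfl fun x _ => ?_
  by_cases h : x = i
  · subst h; simp
  · have : x.val ≠ i.val := fun h' => h (Fin.ext h')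
    by_cases h2 : x.val < i.val
    · simp [h2, h, Nat.lt_succ_of_lt h2]
    · have : ¬ x.val < i.val + 1 := by omega
      simp [h2, h, this]

lemma startPos_mono {k : ℕ} (n : Fin k → ℕ) {i i' : ℕ} (h : i ≤ i') :
    startPos n i ≤ startPos n i' := by
  unfold startPos
  refine Finset.sum_le_sum fun x _ => ?_
  by_cases h1 : x.val < i
  · simp [h1, lt_of_lt_of_le h1 h]
  · simp [h1]

lemma startPos_last {k : ℕ} (n : Fin k → ℕ) : startPos n k = ∑ i, n i := by
  simp [startPos]

lemma join_val {k : ℕ} {n : Fin k → ℕ} (i : Fin k) (j : Fin (n i)) :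
    (join i j).val = startPos n i.val + j.val := by
  rw [join, finSigmaFinEquiv_apply]
  congr 1
  unfold startPos
  rw [← Finset.sum_filter]
  refine Finset.sum_bij (fun x _ => Fin.castLE i.2.le x) ?_ ?_ ?_ ?_
  · intro x _
    simp only [Finset.mem_filter, Finset.mem_univ, true_and]
    exact x.2
  · intro a _ b _ h
    simpa [Fin.ext_iff] using h
  · intro b hb
    simp only [Finset.mem_filter, Finset.mem_univ, true_and] at hb
    exact ⟨⟨b.val, hb⟩, Finset.mem_univ _, rfl⟩
  · intros; rfl

lemma join_lt_join {k : ℕ} {n : Fin k → ℕ} {i i' : Fin k} {j : Fin (n i)} {j' : Fin (n i')}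
    (h : i < i' ∨ (i = i' ∧ j.val < j'.val)) : join i j < join i' j' := by
  rw [Fin.lt_def, join_val, join_val]
  rcases h with h | ⟨rfl, h⟩
  · have h1 := startPos_succ n i
    have h2 := startPos_mono n (show i.val + 1 ≤ i'.val from h)
    have := j.2
    omega
  · omega

lemma lt_iff_split {k : ℕ} {n : Fin k → ℕ} {l l' : Fin (∑ i, n i)} (h : l < l') :
    (split l).1 < (split l').1 ∨ ((split l).1 = (split l').1 ∧ (split l).2.val < (split l').2.val) := by
  by_contra hc
  push Not at hc
  obtain ⟨h1, h2⟩ := hc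
  have : l' ≤ l := by
    rw [← join_split l, ← join_split l']
    rcases h1.lt_or_eq with h1 | h1
    · exact (join_lt_join (Or.inl h1)).le
    · rcases (h2 h1.symm).lt_or_eq with h3 | h3
      · exact (join_lt_join (Or.inr ⟨h1, h3⟩)).le
      · rw [Fin.le_def, join_val, join_val, h3]
        exact Nat.add_le_add_right (startPos_mono n h1.le) _
  exact absurd h (not_lt.mpr this)

lemma strictMono_val {n m : ℕ} (h : n = m) (f : Fin n → Fin m) (hf : StrictMono f) (i : Fin n) :
    f i = Fin.cast h i := by
  subst h
  let e := hf.orderIsoOfSurjective f (Finite.surjective_of_injective hf.injective)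
  have := Fin.coe_orderIso_apply e i
  exact Fin.ext this

lemma sum_one_len (n : ℕ) : n = ∑ _i : Fin 1, n := by simp

lemma sum_len_one (n : ℕ) : n = ∑ _i : Fin n, 1 := by simp

lemma flat_one {S : Type*} {n : ℕ} (Z : Fin n → S) (i : Fin n) :
    Z i = flat (k := 1) (n := fun _ => n) (fun _ => Z) (Fin.cast (sum_one_len n) i) := by
  rw [← strictMono_val (sum_one_len n) (fun j => join (k := 1) (n := fun _ => n) 0 j)
    (fun a b h => join_lt_join (Or.inr ⟨rfl, h⟩)) i, flat, split_join]

lemma flat_ones {S : Type*} {n : ℕ} (Z : Fin n → S) (i : Fin n) :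
    Z i = flat (k := n) (n := fun _ => 1) (fun i _ => Z i) (Fin.cast (sum_len_one n) i) := by
  rw [← strictMono_val (sum_len_one n) (fun j => join (k := n) (n := fun _ => 1) j 0)
    (fun a b h => join_lt_join (Or.inl h)) i, flat, split_join]

lemma sum_split {k : ℕ} {n : Fin k → ℕ} (p : ∀ i, Fin (n i) → ℕ) :
    ∑ l : Fin (∑ i, n i), p (split l).1 (split l).2 = ∑ i, ∑ j, p i j := by
  rw [Equiv.sum_comp finSigmaFinEquiv.symm (fun x : (i : Fin k) × Fin (n i) => p x.1 x.2),
    Fintype.sum_sigma]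

lemma join_join_lt {k : ℕ} {n : Fin k → ℕ} {p : ∀ i, Fin (n i) → ℕ} {x y : (i : Fin k) × Fin (n i)}
    {s : Fin (p x.1 x.2)} {t : Fin (p y.1 y.2)}
    (h : x.1 < y.1 ∨ (x.1 = y.1 ∧ x.2.val < y.2.val) ∨ (x = y ∧ s.val < t.val)) :
    join (n := fun i => ∑ j, p i j) x.1 (join (n := p _) x.2 s) <
      join (n := fun i => ∑ j, p i j) y.1 (join (n := p _) y.2 t) := by
  obtain ⟨i, j⟩ := x
  obtain ⟨i', j'⟩ := y
  apply join_lt_join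
  rcases h with h | ⟨h, h'⟩ | ⟨h, h'⟩
  · exact Or.inl h
  · obtain rfl : i = i' := h
    exact Or.inr ⟨rfl, join_lt_join (Or.inl h')⟩
  · obtain ⟨rfl, h⟩ := Sigma.mk.inj h
    obtain rfl := eq_of_heq h
    exact Or.inr ⟨rfl, join_lt_join (Or.inr ⟨rfl, h'⟩)⟩

lemma split_split {k : ℕ} {n : Fin k → ℕ} (p : ∀ i, Fin (n i) → ℕ)
    (l : Fin (∑ l : Fin (∑ i, n i), p (split l).1 (split l).2)) :
    split (Fin.cast (sum_split p) l) =
      ⟨(split (split l).1).1, join (n := p _) (split (split l).1).2 (split l).2⟩ := by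
  rw [← strictMono_val (sum_split p) (fun l => join (n := fun i => ∑ j, p i j)
    (split (split l).1).1 (join (n := p _) (split (split l).1).2 (split l).2)), split_join]
  intro a b h
  apply join_join_lt
  rcases lt_iff_split h with h | ⟨h, h'⟩
  · exact (lt_iff_split h).imp_right Or.inl
  · exact Or.inr (Or.inr ⟨by rw [h], h'⟩)

lemma flat_flat {S : Type*} {k : ℕ} {n : Fin k → ℕ} {p : ∀ i, Fin (n i) → ℕ}
    (Z : ∀ i j, Fin (p i j) → S) (l : Fin (∑ l : Fin (∑ i, n i), p (split l).1 (split l).2)) :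
    flat (n := fun l => p (split l).1 (split l).2) (fun l => Z (split l).1 (split l).2) l =
      flat (fun i => flat (Z i)) (Fin.cast (sum_split p) l) := by
  rw [flat, flat, split_split, flat, split_join]

/-! ### Multitensors -/

section

variable {V : Type u} [Category.{v} V]

/-- For a family of functors of `n` variables, `n : ℕ`, the identification of the values at two
equal finite sequences. -/
def seqCast (F : ∀ n : ℕ, (Fin n → V) ⥤ V) {n m : ℕ} {Z : Fin n → V} {W : Fin m → V}
    (h : n = m) (h' : ∀ i, Z i = W (Fin.cast h i)) : (F n).obj Z ⟶ (F m).obj W :=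
  eqToHom (by subst h; exact congrArg _ (funext h'))

lemma seqCast_rfl (F : ∀ n : ℕ, (Fin n → V) ⥤ V) {n : ℕ} {Z : Fin n → V}
    (h : n = n) (h' : ∀ i, Z i = Z (Fin.cast h i)) : seqCast F h h' = 𝟙 _ := rfl

@[simp] lemma seqCast_trans (F : ∀ n : ℕ, (Fin n → V) ⥤ V) {n m l : ℕ} {Z : Fin n → V}
    {W : Fin m → V} {U : Fin l → V} (h : n = m) (h' : ∀ i, Z i = W (Fin.cast h i))
    (g : m = l) (g' : ∀ i, W i = U (Fin.cast g i)) :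
    seqCast F h h' ≫ seqCast F g g' =
      seqCast F (h.trans g) (fun i => (h' i).trans (g' _)) := by
  simp [seqCast]

instance (F : ∀ n : ℕ, (Fin n → V) ⥤ V) {n m : ℕ} {Z : Fin n → V} {W : Fin m → V}
    (h : n = m) (h' : ∀ i, Z i = W (Fin.cast h i)) : IsIso (seqCast F h h') := by
  unfold seqCast; infer_instance

/-- A multitensor on `V`, i.e. the structure of a lax monoidal category on `V`: tensor products
`E_{1 ≤ i ≤ n} Z_i` for all `n`, with unit `u_Z : Z ⟶ E_1 Z` and substitution
`σ : E_i E_j Z_{ij} ⟶ E_{ij} Z_{ij}`. The identifications `seqCast` are the equalities of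
iterated concatenations of sequences. -/
structure Multitensor (V : Type u) [Category.{v} V] where
  ten : ∀ n : ℕ, (Fin n → V) ⥤ V
  unit (Z : V) : Z ⟶ (ten 1).obj (fun _ => Z)
  sub {k : ℕ} {n : Fin k → ℕ} (Z : ∀ i, Fin (n i) → V) :
    (ten k).obj (fun i => (ten (n i)).obj (Z i)) ⟶ (ten (∑ i, n i)).obj (flat Z)
  unit_naturality {Z Z' : V} (f : Z ⟶ Z') : f ≫ unit Z' = unit Z ≫ (ten 1).map (fun _ => f)
  sub_naturality {k : ℕ} {n : Fin k → ℕ} {Z Z' : ∀ i, Fin (n i) → V} (f : ∀ i, Z i ⟶ Z' i) :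
    (ten k).map (fun i => (ten (n i)).map (f i)) ≫ sub Z' =
      sub Z ≫ (ten (∑ i, n i)).map (fun l => f (split l).1 (split l).2)
  unit_sub {n : ℕ} (Z : Fin n → V) :
    unit ((ten n).obj Z) ≫ sub (k := 1) (n := fun _ => n) (fun _ => Z) =
      seqCast ten (sum_one_len n) (flat_one Z)
  map_unit_sub {n : ℕ} (Z : Fin n → V) :
    (ten n).map (fun i => unit (Z i)) ≫ sub (n := fun _ => 1) (fun i _ => Z i) =
      seqCast ten (sum_len_one n) (flat_ones Z)
  sub_sub {k : ℕ} {n : Fin k → ℕ} {p : ∀ i, Fin (n i) → ℕ} (Z : ∀ i j, Fin (p i j) → V) :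
    sub (fun i j => (ten (p i j)).obj (Z i j)) ≫
        sub (n := fun l => p (split l).1 (split l).2) (fun l => Z (split l).1 (split l).2) ≫
        seqCast ten (sum_split p) (flat_flat Z) =
      (ten k).map (fun i => sub (Z i)) ≫ sub (fun i => flat (Z i))

namespace Multitensor

/-- A multitensor is distributive when its tensor products preserve coproducts in each variable:
a family of morphisms of sequences `c j : A j ⟶ Z`, which is a coproduct cocone in the `i`-th
variable and invertible in all other variables, is sent to a coproduct cocone. -/
def IsDistributive (E : Multitensor V) : Prop :=
  ∀ (n : ℕ) (i : Fin n) (J : Type v) (A : J → Fin n → V) (Z : Fin n → V) (c : ∀ j, A j ⟶ Z),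
    (∀ j i', i' ≠ i → IsIso (c j i')) → IsCoprod (fun j => c j i) →
      IsCoprod (fun j => (E.ten n).map (c j))

/-- A morphism of multitensors on `V`. -/
structure Hom (E F : Multitensor V) where
  app (n : ℕ) : E.ten n ⟶ F.ten n
  unit_app (Z : V) : E.unit Z ≫ (app 1).app _ = F.unit Z
  sub_app {k : ℕ} {n : Fin k → ℕ} (Z : ∀ i, Fin (n i) → V) :
    E.sub Z ≫ (app _).app (flat Z) =
      (E.ten k).map (fun i => (app (n i)).app (Z i)) ≫ (app k).app _ ≫ F.sub Z

/-- `ε : E ⟶ F` exhibits `E` as an `F`-multitensor: all naturality squares are pullbacks. -/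
def Hom.IsCartesian {E F : Multitensor V} (ε : Hom E F) : Prop :=
  ∀ n, NatTrans.Equifibered (ε.app n)

end Multitensor

/-- A lax monoidal functor between lax monoidal categories. -/
structure LaxMonFunctor {V : Type u} [Category.{v} V] {W : Type u'} [Category.{v} W]
    (E : Multitensor V) (F : Multitensor W) where
  functor : V ⥤ W
  coh {n : ℕ} (X : Fin n → V) :
    (F.ten n).obj (fun i => functor.obj (X i)) ⟶ functor.obj ((E.ten n).obj X)
  coh_naturality {n : ℕ} {X Y : Fin n → V} (f : X ⟶ Y) :
    (F.ten n).map (fun i => functor.map (f i)) ≫ coh Y = coh X ≫ functor.map ((E.ten n).map f)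
  unit_coh (X : V) : F.unit (functor.obj X) ≫ coh (fun _ => X) = functor.map (E.unit X)
  sub_coh {k : ℕ} {n : Fin k → ℕ} (X : ∀ i, Fin (n i) → V) :
    F.sub (fun i j => functor.obj (X i j)) ≫ coh (flat X) =
      (F.ten k).map (fun i => coh (X i)) ≫ coh (fun i => (E.ten (n i)).obj (X i)) ≫
        functor.map (E.sub X)

end

/-! ### Functors preserving coproducts in each variable -/

section

variable {V : Type u} [Category.{v} V]

/-- The functor `(Z_1, …, Z_k) ↦ (A, Z_1, …, Z_k)`. -/
def consFunctor (k : ℕ) (A : V) : (Fin k → V) ⥤ (Fin (k + 1) → V) where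
  obj Z := fun i => Fin.cases A Z i
  map f := fun i => Fin.cases (𝟙 A) f i
  map_id Z := by
    funext i
    refine Fin.cases ?_ (fun i => ?_) i <;> rfl
  map_comp f g := by
    funext i
    refine Fin.cases ?_ (fun i => ?_) i
    · exact (Category.comp_id _).symm
    · rfl

lemma isIso_seq {n : ℕ} {A Z : Fin n → V} (f : A ⟶ Z) (h : ∀ i, IsIso (f i)) : IsIso f :=
  ⟨⟨fun i => inv (f i), by funext i; simp, by funext i; simp⟩⟩

lemma isCoprod_multi (k : ℕ) (G : (Fin k → V) ⥤ V)
    (hG : ∀ (i : Fin k) (J : Type v) (A : J → Fin k → V) (Z : Fin k → V) (c : ∀ j, A j ⟶ Z),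
      (∀ j i', i' ≠ i → IsIso (c j i')) → IsCoprod (fun j => c j i) →
        IsCoprod (fun j => G.map (c j)))
    (J : Fin k → Type v) (A : ∀ i, J i → V) (Z : Fin k → V) (c : ∀ i j, A i j ⟶ Z i)
    (hc : ∀ i, IsCoprod (c i)) :
    IsCoprod (fun j : ∀ i, J i => G.map (X := fun i => A i (j i)) (Y := Z) fun i => c i (j i)) := by
  induction k with
  | zero =>
    have : ∀ j : ∀ i, J i, IsIso (G.map (X := fun i => A i (j i)) (Y := Z) fun i => c i (j i)) :=
      fun j => by
        have := isIso_seq (A := fun i => A i (j i)) (Z := Z) (fun i => c i (j i)) (fun i => i.elim0)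
        infer_instance
    let j₀ : ∀ i, J i := fun i => i.elim0
    refine IsCoprod.of_existsUnique (fun W f => ⟨inv (G.map (X := fun i => A i (j₀ i)) (Y := Z)
      fun i => c i (j₀ i)) ≫ f j₀, fun j => ?_⟩) (fun W f g H => ?_)
    · obtain rfl : j = j₀ := funext fun i => i.elim0
      simp
    · have := H j₀
      rwa [cancel_epi] at this
  | succ k ih =>
    let m (j₀ : J 0) : (consFunctor k (A 0 j₀)).obj (fun i => Z i.succ) ⟶ Z :=
      fun i => Fin.cases (c 0 j₀) (fun _ => 𝟙 _) i
    have h1 : IsCoprod (fun j₀ => G.map (m j₀)) := by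
      refine hG 0 (J 0) _ Z m (fun j i hi => ?_) (hc 0)
      obtain ⟨i, rfl⟩ := Fin.exists_succ_eq.mpr hi
      exact inferInstanceAs (IsIso (𝟙 (Z i.succ)))
    have h2 (j₀ : J 0) := ih (consFunctor k (A 0 j₀) ⋙ G) (fun i J' A' Z' c' h h' => by
        refine hG i.succ J' _ _ (fun j => (consFunctor k (A 0 j₀)).map (c' j)) ?_ h'
        intro j i'
        refine Fin.cases (fun _ => ?_) (fun i' hi => ?_) i'
        · exact inferInstanceAs (IsIso (𝟙 (A 0 j₀)))
        · exact h j i' (fun e => hi (by rw [e])))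
      (fun i => J i.succ) (fun i => A i.succ) (fun i => Z i.succ) (fun i => c i.succ)
      (fun i => hc i.succ)
    let t (j : ∀ i, J i) : (consFunctor k (A 0 (j 0))).obj (fun i => A i.succ (j i.succ)) ⟶
        fun i => A i (j i) := fun i => Fin.cases (𝟙 _) (fun _ => 𝟙 _) i
    have ht (j : ∀ i, J i) : (consFunctor k (A 0 (j 0))).map (fun i => c i.succ (j i.succ)) ≫
        m (j 0) = t j ≫ fun i => c i (j i) := by
      funext i
      refine Fin.cases ?_ (fun i => ?_) i
      · rfl
      · exact (Category.comp_id _).trans (Category.id_comp _).symm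
    have hti (j : ∀ i, J i) : IsIso (t j) := isIso_seq _ (fun i => by
      refine Fin.cases ?_ (fun i => ?_) i
      · exact inferInstanceAs (IsIso (𝟙 _))
      · exact inferInstanceAs (IsIso (𝟙 _)))
    refine IsCoprod.of_existsUnique (fun W f => ?_) (fun W f g H => ?_)
    · refine ⟨h1.desc fun j₀ => (h2 j₀).desc fun j' =>
        G.map (t (Fin.cons j₀ j')) ≫ f (Fin.cons j₀ j'), fun j => ?_⟩
      obtain ⟨j₀, j', rfl⟩ : ∃ (j₀ : J 0) (j' : ∀ i : Fin k, J i.succ), Fin.cons j₀ j' = j :=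
        ⟨_, _, Fin.cons_self_tail j⟩
      rw [← cancel_epi (G.map (t (Fin.cons j₀ j'))), ← Category.assoc, ← G.map_comp, ← ht,
        G.map_comp, Category.assoc, h1.fac]
      exact (h2 j₀).fac _ j'
    · refine h1.hom_ext fun j₀ => (h2 j₀).hom_ext fun j' => ?_
      let j : ∀ i, J i := Fin.cons j₀ j'
      have e := ht j
      have := congrArg (fun x => G.map (t j) ≫ x) (H j)
      simp only [← Category.assoc, ← G.map_comp, ← e] at this
      simp only [G.map_comp, Category.assoc] at this
      exact this

end

/-! ### Sequences of objects of a graph -/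

/-- A sequence `(x_0, …, x_n)` of elements of `S`, of length `n : ℕ`. -/
structure ObjSeq (S : Type v) : Type v where
  len : ℕ
  pt : Fin (len + 1) → S

namespace ObjSeq

variable {S : Type v} {S' : Type v}

lemma ext' {x y : ObjSeq S} (h : x.len = y.len)
    (h' : ∀ l : Fin x.len, x.pt l.castSucc = y.pt (Fin.cast h l).castSucc)
    (h'' : x.pt (Fin.last _) = y.pt (Fin.last _)) : x = y := by
  obtain ⟨n, x⟩ := x
  obtain ⟨m, y⟩ := y
  obtain rfl : n = m := h
  have : x = y := by
    funext l
    refine Fin.lastCases h'' (fun l => h' l) l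
  rw [this]

/-- The sequence `(a, b)`. -/
def single (a b : S) : ObjSeq S := ⟨1, fun i => if i.val = 0 then a else b⟩

/-- The image of a sequence under a function. -/
def map (f : S → S') (x : ObjSeq S) : ObjSeq S' := ⟨x.len, f ∘ x.pt⟩

/-- The sequence obtained from a sequence `x` and sequences `y i` from `x_i` to `x_{i+1}` by
running through all the `y i` successively, common end points being identified. -/
def concat (x : ObjSeq S) (y : Fin x.len → ObjSeq S) : ObjSeq S where
  len := ∑ i, (y i).len
  pt l := if h : l.val < ∑ i, (y i).len then
      flat (fun i (j : Fin (y i).len) => (y i).pt j.castSucc) ⟨l.val, h⟩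
    else x.pt (Fin.last _)

lemma concat_castSucc (x : ObjSeq S) (y : Fin x.len → ObjSeq S) (l : Fin (∑ i, (y i).len)) :
    (concat x y).pt l.castSucc = flat (fun i (j : Fin (y i).len) => (y i).pt j.castSucc) l := by
  have := l.2
  simp [concat]

lemma concat_last (x : ObjSeq S) (y : Fin x.len → ObjSeq S) :
    (concat x y).pt (Fin.last _) = x.pt (Fin.last _) := by
  simp [concat]

/-- The sequence `y i` goes from `x_i` to `x_{i+1}`. -/
def Fits (x : ObjSeq S) (y : Fin x.len → ObjSeq S) : Prop :=
  ∀ i, (y i).pt 0 = x.pt i.castSucc ∧ (y i).pt (Fin.last _) = x.pt i.succ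

lemma concat_start {x : ObjSeq S} {y : Fin x.len → ObjSeq S} (h : Fits x y) (d i : ℕ)
    (hd : i + d = x.len) (l : Fin ((∑ i, (y i).len) + 1))
    (hl : l.val = startPos (fun i => (y i).len) i) :
    (concat x y).pt l = x.pt ⟨i, by omega⟩ := by
  induction d generalizing i l with
  | zero =>
    obtain rfl : i = x.len := by omega
    rw [startPos_last] at hl
    obtain rfl : l = Fin.last _ := Fin.ext hl
    exact concat_last x y
  | succ d ih =>
    let i' : Fin x.len := ⟨i, by omega⟩
    have h1 := startPos_succ (fun i => (y i).len) i'
    by_cases h0 : (y i').len = 0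
    · rw [ih (i + 1) (by omega) l (by rw [hl]; simp only [i'] at h1 h0; omega)]
      refine (h i').2.symm.trans (Eq.trans ?_ (h i').1)
      congr 1
      exact Fin.ext (by simp [h0])
    · have h2 : l = (join (n := fun i => (y i).len) i' ⟨0, by omega⟩).castSucc :=
        Fin.ext (by rw [hl, Fin.val_castSucc, join_val]; rfl)
      rw [h2, concat_castSucc, flat, split_join]
      exact (h i').1

lemma concat_zero {x : ObjSeq S} {y : Fin x.len → ObjSeq S} (h : Fits x y) :
    (concat x y).pt 0 = x.pt 0 :=
  concat_start h x.len 0 (by omega) 0 (by simp [startPos])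

lemma concat_succ {x : ObjSeq S} {y : Fin x.len → ObjSeq S} (h : Fits x y)
    (l : Fin (∑ i, (y i).len)) :
    (concat x y).pt l.succ = flat (fun i (j : Fin (y i).len) => (y i).pt j.succ) l := by
  obtain ⟨i, j, rfl⟩ : ∃ i j, join i j = l := ⟨_, _, join_split l⟩
  rw [flat, split_join]
  have h1 := startPos_succ (fun i => (y i).len) i
  by_cases hj : j.val + 1 < (y i).len
  · have h2 : (join i j).succ = (join (n := fun i => (y i).len) i ⟨j.val + 1, hj⟩).castSucc :=
      Fin.ext (by rw [Fin.val_succ, Fin.val_castSucc, join_val, join_val]; rfl)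
    rw [h2, concat_castSucc, flat, split_join]
    rfl
  · have := j.2
    rw [concat_start h (x.len - (i.val + 1)) (i.val + 1) (by omega) _
      (by rw [Fin.val_succ, join_val]; omega)]
    refine (h i).2.symm.trans ?_
    congr 1
    exact Fin.ext (by simp; omega)

lemma concat_map (f : S → S') (x : ObjSeq S) (y : Fin x.len → ObjSeq S) :
    (concat x y).map f = concat (x.map f) (fun i => (y i).map f) := by
  refine ext' rfl (fun l => ?_) ?_
  · exact (congrArg f (concat_castSucc x y l)).trans
      (concat_castSucc (x.map f) (fun i => (y i).map f) l).symm
  · exact (congrArg f (concat_last x y)).trans (concat_last (x.map f) _).symm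

lemma concat_single (a b : S) (x : ObjSeq S) (h : x.pt (Fin.last _) = b) :
    x = concat (single a b) (fun _ => x) := by
  refine ext' (sum_one_len _) (fun l => ?_) ?_
  · exact (flat_one (fun j => x.pt j.castSucc) l).trans
      (concat_castSucc (single a b) (fun _ => x) _).symm
  · rw [concat_last, h]
    rfl

lemma concat_singles (x : ObjSeq S) :
    x = concat x (fun i => single (x.pt i.castSucc) (x.pt i.succ)) := by
  refine ext' (sum_len_one _) (fun l => ?_) (concat_last _ _).symm
  refine (flat_ones (fun j => x.pt j.castSucc) l).trans ?_
  refine Eq.trans ?_ (concat_castSucc x _ _).symm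
  simp [flat, single]
  rfl

lemma concat_concat (x : ObjSeq S) (y : Fin x.len → ObjSeq S)
    (z : ∀ i, Fin (y i).len → ObjSeq S) :
    concat (concat x y) (fun l => z (split l).1 (split l).2) =
      concat x (fun i => concat (y i) (z i)) := by
  refine ext' (sum_split fun i j => (z i j).len) (fun l => ?_) ?_
  · refine (concat_castSucc (concat x y) _ l).trans ?_
    refine (flat_flat (fun i j (s : Fin (z i j).len) => (z i j).pt s.castSucc) l).trans ?_
    refine Eq.trans ?_ (concat_castSucc x (fun i => concat (y i) (z i)) _).symm
    exact (concat_castSucc (y _) (z _) _).symm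
  · rw [concat_last, concat_last, concat_last]

end ObjSeq

/-- The sequences `(x_0, …, x_n)` of elements of `S` with `x_0 = a` and `x_n = b`. -/
def SeqFrom {S : Type v} (a b : S) : Type v :=
  {x : ObjSeq S // x.pt 0 = a ∧ x.pt (Fin.last _) = b}

namespace SeqFrom

variable {S : Type v} {S' : Type v} {a b : S}

def single (a b : S) : SeqFrom a b := ⟨ObjSeq.single a b, rfl, rfl⟩

def map (f : S → S') (x : SeqFrom a b) : SeqFrom (f a) (f b) :=
  ⟨x.1.map f, congrArg f x.2.1, congrArg f x.2.2⟩

def cast {a' b' : S} (ha : a = a') (hb : b = b') (x : SeqFrom a b) : SeqFrom a' b' :=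
  ⟨x.1, x.2.1.trans ha, x.2.2.trans hb⟩

lemma fits (x : ObjSeq S) (y : ∀ i : Fin x.len, SeqFrom (x.pt i.castSucc) (x.pt i.succ)) :
    x.Fits (fun i => (y i).1) := fun i => (y i).2

def concat (x : SeqFrom a b)
    (y : ∀ i : Fin x.1.len, SeqFrom (x.1.pt i.castSucc) (x.1.pt i.succ)) : SeqFrom a b :=
  ⟨x.1.concat (fun i => (y i).1), (ObjSeq.concat_zero (fits x.1 y)).trans x.2.1,
    (ObjSeq.concat_last _ _).trans x.2.2⟩

end SeqFrom

/-! ### The monad of a distributive multitensor -/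

section

variable {V : Type u} [Category.{v} V]

lemma seqCast_map (F : ∀ n : ℕ, (Fin n → V) ⥤ V) {n m : ℕ} {Z Z' : Fin n → V} {W W' : Fin m → V}
    (h : n = m) (h' : ∀ i, Z i = W (Fin.cast h i)) (h'' : ∀ i, Z' i = W' (Fin.cast h i))
    (g : Z ⟶ Z') (g' : W ⟶ W')
    (e : ∀ i, g i ≫ eqToHom (h'' i) = eqToHom (h' i) ≫ g' (Fin.cast h i)) :
    (F n).map g ≫ seqCast F h h'' = seqCast F h h' ≫ (F m).map g' := by
  subst h
  obtain rfl : Z = W := funext h'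
  obtain rfl : Z' = W' := funext h''
  obtain rfl : g = g' := funext fun i => by simpa using e i
  rw [seqCast_rfl, seqCast_rfl, Category.comp_id, Category.id_comp]

lemma Multitensor.map_seqCast_sub (E : Multitensor V) {k : ℕ} {n : Fin k → ℕ}
    {Z Z' : ∀ i, Fin (n i) → V} (h : ∀ i j, Z i j = Z' i j) :
    (E.ten k).map (fun i => seqCast E.ten (Z := Z i) (W := Z' i) rfl (h i)) ≫ E.sub Z' =
      E.sub Z ≫ seqCast E.ten rfl (fun _ => h _ _) := by
  obtain rfl : Z = Z' := funext fun i => funext (h i)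
  refine Eq.trans (congrArg (· ≫ _) ((E.ten k).map_id _)) ?_
  rw [Category.id_comp]
  exact (Category.comp_id _).symm

lemma Multitensor.IsDistributive.multi {E : Multitensor V} (hE : E.IsDistributive) {k : ℕ} {J : Fin k → Type v} {A : ∀ i, J i → V} {Z : Fin k → V}
    {c : ∀ i j, A i j ⟶ Z i} (hc : ∀ i, IsCoprod (c i)) :
    IsCoprod (fun j : ∀ i, J i => (E.ten k).map (X := fun i => A i (j i)) (Y := Z)
      fun i => c i (j i)) :=
  isCoprod_multi k (E.ten k) (hE k) J A Z c hc

namespace VGraph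

/-- The sequence `X(x_0, x_1), …, X(x_{n-1}, x_n)` of homs of a graph. -/
def homs (X : VGraph V) (x : ObjSeq X.Obj) : Fin x.len → V :=
  fun i => X.hom (x.pt i.castSucc) (x.pt i.succ)

def homsMap {X Y : VGraph V} (f : X ⟶ Y) (x : ObjSeq X.Obj) : X.homs x ⟶ Y.homs (x.map f.obj) :=
  fun i => f.map (x.pt i.castSucc) (x.pt i.succ)

lemma homs_single (X : VGraph V) (a b : X.Obj) (i : Fin 1) :
    X.hom a b = X.homs (ObjSeq.single a b) i := by
  obtain rfl := Subsingleton.elim i 0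
  rfl

lemma homs_concat (X : VGraph V) {x : ObjSeq X.Obj} {y : Fin x.len → ObjSeq X.Obj}
    (h : x.Fits y) (l : Fin (∑ i, (y i).len)) :
    flat (fun i => X.homs (y i)) l = X.homs (x.concat y) l := by
  exact (congrArg₂ X.hom (x.concat_castSucc y l) (ObjSeq.concat_succ h l)).symm

end VGraph

namespace Multitensor

variable [HasCoproducts.{v} V] (E : Multitensor V)

/-- The `V`-graph `ΓE(X)` with `ΓE(X)(a, b) = ∐_{a = x_0, …, x_n = b} E_i X(x_{i-1}, x_i)`. -/
noncomputable abbrev gammaObj (X : VGraph V) : VGraph V where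
  Obj := X.Obj
  hom a b := ∐ fun x : SeqFrom a b => (E.ten x.1.len).obj (X.homs x.1)

/-- The coproduct inclusions. -/
noncomputable def incl (X : VGraph V) {a b : X.Obj} (x : SeqFrom a b) :
    (E.ten x.1.len).obj (X.homs x.1) ⟶ (E.gammaObj X).hom a b :=
  Sigma.ι (fun x : SeqFrom a b => (E.ten x.1.len).obj (X.homs x.1)) x

lemma isCoprod_incl (X : VGraph V) (a b : X.Obj) :
    IsCoprod (fun x : SeqFrom a b => E.incl X x) :=
  IsCoprod.sigma _

variable {E} in
lemma gammaObj_hom_ext {X : VGraph V} {a b : X.Obj} {W : V} {f g : (E.gammaObj X).hom a b ⟶ W}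
    (h : ∀ x : SeqFrom a b, E.incl X x ≫ f = E.incl X x ≫ g) : f = g :=
  (E.isCoprod_incl X a b).hom_ext h

/-- The coproduct inclusion of the summand of `x`, when the sequence of homs is given as `Z`. -/
noncomputable def seqIncl (X : VGraph V) {n : ℕ} (Z : Fin n → V) {a b : X.Obj} (x : SeqFrom a b)
    (h : n = x.1.len) (h' : ∀ i, Z i = X.homs x.1 (Fin.cast h i)) :
    (E.ten n).obj Z ⟶ (E.gammaObj X).hom a b :=
  seqCast E.ten h h' ≫ E.incl X x

lemma seqIncl_self (X : VGraph V) {a b : X.Obj} (x : SeqFrom a b) :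
    E.seqIncl X (X.homs x.1) x rfl (fun _ => rfl) = E.incl X x :=
  Category.id_comp _

lemma seqCast_seqIncl (X : VGraph V) {n m : ℕ} {Z : Fin n → V} {Z' : Fin m → V} (g : n = m)
    (g' : ∀ i, Z i = Z' (Fin.cast g i)) {a b a' b' : X.Obj} (ha : a = a') (hb : b = b')
    (x : SeqFrom a b) (x' : SeqFrom a' b') (e : x.1 = x'.1)
    (h : n = x.1.len) (h' : ∀ i, Z i = X.homs x.1 (Fin.cast h i)) (k : m = x'.1.len)
    (k' : ∀ i, Z' i = X.homs x'.1 (Fin.cast k i)) :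
    seqCast E.ten g g' ≫ E.seqIncl X Z' x' k k' =
      E.seqIncl X Z x h h' ≫ (E.gammaObj X).cast ha hb := by
  subst g ha hb
  obtain rfl : x = x' := Subtype.ext e
  obtain rfl : Z = Z' := funext g'
  exact (Category.id_comp _).trans (Category.comp_id _).symm

/-- The functor `ΓE` on morphisms. -/
noncomputable def gammaMor {X Y : VGraph V} (f : X ⟶ Y) : E.gammaObj X ⟶ E.gammaObj Y :=
  ⟨f.obj, fun a b => Sigma.desc fun x : SeqFrom a b =>
    (E.ten x.1.len).map (VGraph.homsMap f x.1) ≫ E.incl Y (x.map f.obj)⟩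

lemma incl_map {X Y : VGraph V} (f : X ⟶ Y) {a b : X.Obj} (x : SeqFrom a b) :
    E.incl X x ≫ (E.gammaMor f).map a b =
      (E.ten x.1.len).map (VGraph.homsMap f x.1) ≫ E.incl Y (x.map f.obj) :=
  Sigma.ι_desc _ _

lemma map_seqIncl {X Y : VGraph V} (f : X ⟶ Y) {n : ℕ} {Z Z' : Fin n → V} (g : Z ⟶ Z')
    {a b : X.Obj} (x : SeqFrom a b) (y : SeqFrom (f.obj a) (f.obj b)) (e : y.1 = x.1.map f.obj)
    (h : n = x.1.len) (h' : ∀ i, Z i = X.homs x.1 (Fin.cast h i)) (k : n = y.1.len)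
    (k' : ∀ i, Z' i = Y.homs y.1 (Fin.cast k i))
    (k'' : ∀ i, Z' i = Y.homs (x.1.map f.obj) (Fin.cast h i))
    (hg : ∀ i, g i ≫ eqToHom (k'' i) =
      eqToHom (h' i) ≫ VGraph.homsMap f x.1 (Fin.cast h i)) :
    (E.ten n).map g ≫ E.seqIncl Y Z' y k k' =
      E.seqIncl X Z x h h' ≫ (E.gammaMor f).map a b := by
  subst h
  obtain rfl : y = x.map f.obj := Subtype.ext e
  obtain rfl : Z = X.homs x.1 := funext h'
  obtain rfl : Z' = Y.homs (x.1.map f.obj) := funext k''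
  obtain rfl : g = VGraph.homsMap f x.1 :=
    funext fun i => (Category.comp_id _).symm.trans ((hg i).trans (Category.id_comp _))
  rw [seqIncl_self, incl_map]
  exact congrArg (_ ≫ ·) (E.seqIncl_self Y (x.map f.obj))

/-- The functor `ΓE`. -/
noncomputable def gammaFunctor (E : Multitensor V) : VGraph V ⥤ VGraph V where
  obj := E.gammaObj
  map f := E.gammaMor f
  map_id X := by
    refine VGraph.hom_ext (fun _ => rfl) fun a b => (Category.comp_id _).trans ?_
    refine gammaObj_hom_ext (E := E) (X := X) (a := a) (b := b) fun x => ?_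
    exact (E.incl_map _ _).trans ((congrArg (· ≫ E.incl X x) ((E.ten _).map_id _)).trans
      ((Category.id_comp _).trans (Category.comp_id _).symm))
  map_comp {X Y Z} f g := by
    refine VGraph.hom_ext (fun _ => rfl) fun a b => (Category.comp_id _).trans ?_
    refine gammaObj_hom_ext (E := E) (X := X) (a := a) (b := b) fun x => ?_
    have h1 := E.incl_map (f ≫ g) x
    have h2 := E.incl_map f x
    have h3 := E.incl_map g (x.map f.obj)
    have h4 := (E.ten _).map_comp (VGraph.homsMap f x.1) (VGraph.homsMap g _)
    refine h1.trans ?_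
    refine Eq.trans ?_ (Category.assoc _ _ _)
    refine Eq.trans ?_ (congrArg (· ≫ _) h2.symm)
    refine Eq.trans ?_ (Category.assoc _ _ _).symm
    refine Eq.trans ?_ (congrArg (_ ≫ ·) h3.symm)
    refine Eq.trans ?_ (Category.assoc _ _ _)
    exact congrArg (· ≫ _) h4

/-- The unit of `ΓE`. -/
noncomputable def gammaUnit (E : Multitensor V) : 𝟭 (VGraph V) ⟶ E.gammaFunctor where
  app X := ⟨id, fun a b => E.unit (X.hom a b) ≫
    E.seqIncl X (fun _ => X.hom a b) (SeqFrom.single a b) rfl (X.homs_single a b)⟩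
  naturality X Y f := by
    refine VGraph.hom_ext (fun _ => rfl) fun a b => (Category.comp_id _).trans ?_
    refine (Category.assoc _ _ _).symm.trans ?_
    refine (congrArg (· ≫ _) (E.unit_naturality (f.map a b))).trans ?_
    refine (Category.assoc _ _ _).trans (Eq.trans ?_ (Category.assoc _ _ _).symm)
    refine congrArg (E.unit _ ≫ ·) ?_
    refine E.map_seqIncl f _ _ _ (congrArg (ObjSeq.mk 1) (funext fun i =>
      (apply_ite f.obj _ _ _).symm)) _ _ _ _ (fun i => ?_) fun i => ?_
    · obtain rfl := Subsingleton.elim i 0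
      rfl
    · obtain rfl := Subsingleton.elim i 0
      exact (Category.comp_id _).trans (Category.id_comp _).symm

/-- The multiplication of `ΓE`: on the summand of a doubly nested sequence of objects it is the
substitution of `E` followed by the inclusion of the summand of the concatenated sequence. -/
noncomputable def gammaMultMap (E : Multitensor V) (hE : E.IsDistributive) (X : VGraph V) :
    E.gammaObj (E.gammaObj X) ⟶ E.gammaObj X :=
  ⟨id, fun a b => Sigma.desc fun x : SeqFrom a b =>
    (hE.multi fun i : Fin x.1.len =>
      E.isCoprod_incl X (x.1.pt i.castSucc) (x.1.pt i.succ)).desc fun y =>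
        E.sub (fun i => X.homs (y i).1) ≫
          E.seqIncl X _ (x.concat y) rfl (X.homs_concat (SeqFrom.fits x.1 y))⟩

/-- The morphism `E_i k` for inclusions `k` of summands. -/
noncomputable def inclSeq (E : Multitensor V) (X : VGraph V) (x : ObjSeq X.Obj)
    (y : ∀ i : Fin x.len, SeqFrom (x.pt i.castSucc) (x.pt i.succ)) :
    (E.ten x.len).obj (fun i => (E.ten (y i).1.len).obj (X.homs (y i).1)) ⟶
      (E.ten x.len).obj ((E.gammaObj X).homs x) :=
  (E.ten x.len).map (Y := (E.gammaObj X).homs x) fun i => E.incl X (y i)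

lemma isCoprod_inclSeq (E : Multitensor V) (hE : E.IsDistributive) (X : VGraph V)
    (x : ObjSeq X.Obj) : IsCoprod (E.inclSeq X x) :=
  hE.multi fun i : Fin x.len => E.isCoprod_incl X (x.pt i.castSucc) (x.pt i.succ)

lemma inclSeq_mult (E : Multitensor V) (hE : E.IsDistributive) (X : VGraph V) {a b : X.Obj}
    (x : SeqFrom a b) (y : ∀ i : Fin x.1.len, SeqFrom (x.1.pt i.castSucc) (x.1.pt i.succ)) :
    E.inclSeq X x.1 y ≫ E.incl (E.gammaObj X) x ≫ (E.gammaMultMap hE X).map a b =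
      E.sub (fun i => X.homs (y i).1) ≫
        E.seqIncl X _ (x.concat y) rfl (X.homs_concat (SeqFrom.fits x.1 y)) :=
  (congrArg (E.inclSeq X x.1 y ≫ ·) (Sigma.ι_desc _ x)).trans
    (IsCoprod.fac (E.isCoprod_inclSeq hE X x.1) _ y)

end Multitensor

end

section

variable {V : Type u} [Category.{v} V] [HasCoproducts.{v} V]

namespace Multitensor

variable (E : Multitensor V)

lemma incl_cast (X : VGraph V) {a b a' b' : X.Obj} (ha : a = a') (hb : b = b')
    (x : SeqFrom a b) :
    E.incl X x ≫ (E.gammaObj X).cast ha hb = E.incl X (x.cast ha hb) := by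
  subst ha hb
  exact Category.comp_id _

variable {E} in
lemma gammaObj_hom_ext_two (hE : E.IsDistributive) {X : VGraph V} {a b : X.Obj} {W : V}
    {f g : (E.gammaObj (E.gammaObj X)).hom a b ⟶ W}
    (h : ∀ (x : SeqFrom a b) (y : ∀ i : Fin x.1.len, SeqFrom (x.1.pt i.castSucc) (x.1.pt i.succ)),
      E.inclSeq X x.1 y ≫ E.incl (E.gammaObj X) x ≫ f =
        E.inclSeq X x.1 y ≫ E.incl (E.gammaObj X) x ≫ g) : f = g :=
  gammaObj_hom_ext fun x => (E.isCoprod_inclSeq hE X x.1).hom_ext fun y => h x y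

lemma inclSeq_map {X Y : VGraph V} (f : X ⟶ Y) (x : ObjSeq X.Obj)
    (y : ∀ i : Fin x.len, SeqFrom (x.pt i.castSucc) (x.pt i.succ)) :
    E.inclSeq X x y ≫ (E.ten x.len).map (VGraph.homsMap (E.gammaMor f) x) =
      (E.ten x.len).map (fun i => (E.ten (y i).1.len).map (VGraph.homsMap f (y i).1)) ≫
        E.inclSeq Y (x.map f.obj) (fun i => (y i).map f.obj) := by
  refine ((E.ten _).map_comp _ _).symm.trans (Eq.trans ?_ ((E.ten _).map_comp _ _))
  exact congrArg (E.ten _).map (funext fun i => E.incl_map f (y i))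

lemma map_mult (hE : E.IsDistributive) (X : VGraph V) {a b : X.Obj} (x : SeqFrom a b)
    (y : ∀ i : Fin x.1.len, SeqFrom (x.1.pt i.castSucc) (x.1.pt i.succ))
    (Z : Fin x.1.len → V) (h : ∀ i, Z i = (E.gammaObj X).homs x.1 i)
    (g : ∀ i, (E.ten (y i).1.len).obj (X.homs (y i).1) ⟶ Z i)
    (hg : ∀ i, g i ≫ eqToHom (h i) = E.incl X (y i)) :
    (E.ten x.1.len).map g ≫ E.seqIncl (E.gammaObj X) Z x rfl h ≫ (E.gammaMultMap hE X).map a b =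
      E.sub (fun i => X.homs (y i).1) ≫
        E.seqIncl X _ (x.concat y) rfl (X.homs_concat (SeqFrom.fits x.1 y)) := by
  obtain rfl : Z = (E.gammaObj X).homs x.1 := funext h
  obtain rfl : g = fun i => E.incl X (y i) := funext fun i => (Category.comp_id _).symm.trans (hg i)
  rw [seqIncl_self]
  exact E.inclSeq_mult hE X x y

lemma map_seqIncl_mult (hE : E.IsDistributive) (X : VGraph V) {a b : X.Obj} (x : SeqFrom a b)
    (y : ∀ i : Fin x.1.len, SeqFrom (x.1.pt i.castSucc) (x.1.pt i.succ))
    (Z : ∀ i, Fin (y i).1.len → V) (h : ∀ i j, Z i j = X.homs (y i).1 j) :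
    (E.ten x.1.len).map (Y := (E.gammaObj X).homs x.1)
        (fun i => E.seqIncl X (Z i) (y i) rfl (h i)) ≫
        E.incl (E.gammaObj X) x ≫ (E.gammaMultMap hE X).map a b =
      E.sub Z ≫ E.seqIncl X _ (x.concat y) rfl (fun l => (h _ _).trans
        (X.homs_concat (SeqFrom.fits x.1 y) l)) := by
  obtain rfl : Z = fun i => X.homs (y i).1 := funext fun i => funext (h i)
  rw [← E.inclSeq_mult hE X x y]
  refine congrArg (· ≫ _) ?_
  exact congrArg (E.ten _).map (funext fun i => E.seqIncl_self X (y i))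

/-- The multiplication of `ΓE`. -/
noncomputable def gammaMult (hE : E.IsDistributive) :
    E.gammaFunctor ⋙ E.gammaFunctor ⟶ E.gammaFunctor where
  app := E.gammaMultMap hE
  naturality X Y f := by
    refine VGraph.hom_ext (fun _ => rfl) fun a b => (Category.comp_id _).trans ?_
    refine gammaObj_hom_ext_two hE (X := X) (a := a) (b := b) fun x y => ?_
    change E.inclSeq X x.1 y ≫ E.incl (E.gammaObj X) x ≫
        (E.gammaMor (E.gammaMor f)).map a b ≫ (E.gammaMultMap hE Y).map _ _ =
      E.inclSeq X x.1 y ≫ E.incl (E.gammaObj X) x ≫ (E.gammaMultMap hE X).map a b ≫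
        (E.gammaMor f).map a b
    have h1 := congrArg (E.inclSeq X x.1 y ≫ · ≫ (E.gammaMultMap hE Y).map _ _)
      (E.incl_map (E.gammaMor f) x)
    have h2 := congrArg (· ≫ E.incl (E.gammaObj Y) (x.map f.obj) ≫
      (E.gammaMultMap hE Y).map _ _) (E.inclSeq_map f x.1 y)
    have h3 := congrArg (· ≫ (E.gammaMor f).map a b) (E.inclSeq_mult hE X x y)
    have h4 := congrArg ((E.ten x.1.len).map (fun i => (E.ten (y i).1.len).map
      (VGraph.homsMap f (y i).1)) ≫ ·)
      (E.inclSeq_mult hE Y (x.map f.obj) (fun i => (y i).map f.obj))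
    have h5 := congrArg (· ≫ E.seqIncl Y _ ((x.map f.obj).concat fun i => (y i).map f.obj) rfl
      (Y.homs_concat (SeqFrom.fits (x.1.map f.obj) fun i => (y i).map f.obj)))
      (E.sub_naturality (fun i => VGraph.homsMap f (y i).1))
    have h6 := E.map_seqIncl f (Z := flat fun i => X.homs (y i).1)
      (Z' := flat fun i => Y.homs ((y i).map f.obj).1) (fun l => VGraph.homsMap f (y (split l).1).1 (split l).2)
      (x.concat y) ((x.map f.obj).concat fun i => (y i).map f.obj)
      (ObjSeq.concat_map f.obj x.1 _).symm rfl
      (X.homs_concat (SeqFrom.fits x.1 y)) rfl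
      (Y.homs_concat (SeqFrom.fits (x.1.map f.obj) fun i => (y i).map f.obj))
      (fun l => congrArg₂ (fun s t => Y.hom (f.obj s) (f.obj t))
        (ObjSeq.concat_castSucc x.1 _ l).symm (ObjSeq.concat_succ (SeqFrom.fits x.1 y) l).symm)
      (fun l => (VGraph.cast_map f (ObjSeq.concat_castSucc x.1 _ l).symm
        (ObjSeq.concat_succ (SeqFrom.fits x.1 y) l).symm).symm)
    have h7 := congrArg (E.sub (fun i => X.homs (y i).1) ≫ ·) h6
    refine (congrArg (_ ≫ ·) (Category.assoc _ _ _).symm).trans (h1.trans ?_)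
    refine (congrArg (_ ≫ ·) (Category.assoc _ _ _)).trans ?_
    refine (Category.assoc _ _ _).symm.trans (h2.trans ?_)
    refine (Category.assoc _ _ _).trans (h4.trans ?_)
    refine (Category.assoc _ _ _).symm.trans (h5.trans ?_)
    refine (Category.assoc _ _ _).trans (h7.trans ?_)
    refine (Category.assoc _ _ _).symm.trans (h3.symm.trans ?_)
    exact (Category.assoc _ _ _).trans (congrArg (_ ≫ ·) (Category.assoc _ _ _))

/-- The monad `ΓE` on `V`-graphs of a distributive multitensor `E` on `V`. -/
noncomputable def gamma (hE : E.IsDistributive) : Monad (VGraph V) where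
  toFunctor := E.gammaFunctor
  η := E.gammaUnit
  μ := E.gammaMult hE
  left_unit X := by
    refine VGraph.hom_ext (fun _ => rfl) fun a b => (Category.comp_id _).trans ?_
    refine gammaObj_hom_ext (E := E) (X := X) (a := a) (b := b) fun y => ?_
    refine Eq.trans ?_ (Category.comp_id _).symm
    let s : SeqFrom (S := X.Obj) a b := SeqFrom.single a b
    have hs (i : Fin 1) : a = s.1.pt i.castSucc ∧ b = s.1.pt i.succ := by
      obtain rfl := Subsingleton.elim i 0
      exact ⟨rfl, rfl⟩
    let y' : ∀ i : Fin s.1.len, SeqFrom (s.1.pt i.castSucc) (s.1.pt i.succ) :=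
      fun i => y.cast (hs i).1 (hs i).2
    have h1 := E.unit_naturality (E.incl X y)
    have h2 := E.map_mult hE X s y' (fun _ => (E.gammaObj X).hom a b)
      ((E.gammaObj X).homs_single a b) (fun _ => E.incl X y)
      (fun i => E.incl_cast X (hs i).1 (hs i).2 y)
    have h3 := E.unit_sub (X.homs y.1)
    have h4 := E.seqCast_seqIncl X (sum_one_len y.1.len) (flat_one (X.homs y.1)) rfl rfl y
      (s.concat y') (ObjSeq.concat_single a b y.1 y.2.2) rfl (fun _ => rfl) rfl
      (X.homs_concat (SeqFrom.fits s.1 y'))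
    replace h4 := h4.trans ((Category.comp_id _).trans (E.seqIncl_self X y))
    have h1' := congrArg (· ≫ E.seqIncl (E.gammaObj X) (fun _ => (E.gammaObj X).hom a b) s rfl
      ((E.gammaObj X).homs_single a b) ≫ (E.gammaMultMap hE X).map a b) h1
    have h2' := congrArg (E.unit ((E.ten y.1.len).obj (X.homs y.1)) ≫ ·) h2
    have h3' := congrArg (· ≫ E.seqIncl X _ (s.concat y') rfl
      (X.homs_concat (SeqFrom.fits s.1 y'))) h3
    refine (congrArg (E.incl X y ≫ ·) (Category.assoc _ _ _)).trans ?_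
    refine (Category.assoc _ _ _).symm.trans (h1'.trans ?_)
    refine (Category.assoc _ _ _).trans (h2'.trans ?_)
    exact (Category.assoc _ _ _).symm.trans (h3'.trans h4)
  right_unit X := by
    refine VGraph.hom_ext (fun _ => rfl) fun a b => (Category.comp_id _).trans ?_
    refine gammaObj_hom_ext (E := E) (X := X) (a := a) (b := b) fun x => ?_
    refine Eq.trans ?_ (Category.comp_id _).symm
    let y : ∀ i : Fin x.1.len, SeqFrom (x.1.pt i.castSucc) (x.1.pt i.succ) :=
      fun i => SeqFrom.single _ _
    have h1 := congrArg (· ≫ (E.gammaMultMap hE X).map a b) (E.incl_map (E.gammaUnit.app X) x)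
    have h2 := (E.ten x.1.len).map_comp (fun i => E.unit (X.homs x.1 i))
      (show _ ⟶ (E.gammaObj X).homs x.1 from
        fun i => E.seqIncl X (fun _ => X.homs x.1 i) (y i) rfl (X.homs_single _ _))
    have h2' := congrArg (· ≫ E.incl (E.gammaObj X) x ≫ (E.gammaMultMap hE X).map a b) h2
    have h3 := congrArg ((E.ten x.1.len).map (fun i => E.unit (X.homs x.1 i)) ≫ ·)
      (E.map_seqIncl_mult hE X x y (fun i _ => X.homs x.1 i) (fun i => X.homs_single _ _))
    have h4 := congrArg (· ≫ E.seqIncl X _ (x.concat y) rfl (fun l =>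
      (X.homs_single _ _ _).trans (X.homs_concat (SeqFrom.fits x.1 y) l)))
      (E.map_unit_sub (X.homs x.1))
    have h5 := E.seqCast_seqIncl X (sum_len_one x.1.len) (flat_ones (X.homs x.1)) rfl rfl x
      (x.concat y) (ObjSeq.concat_singles x.1) rfl (fun _ => rfl) rfl (fun l =>
      (X.homs_single _ _ _).trans (X.homs_concat (SeqFrom.fits x.1 y) l))
    replace h5 := h5.trans ((Category.comp_id _).trans (E.seqIncl_self X x))
    refine (Category.assoc _ _ _).symm.trans (h1.trans ?_)
    refine (Category.assoc _ _ _).trans (h2'.trans ?_)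
    refine (Category.assoc _ _ _).trans (h3.trans ?_)
    exact (Category.assoc _ _ _).symm.trans (h4.trans h5)
  assoc X := by
    refine VGraph.hom_ext (fun _ => rfl) fun a b => (Category.comp_id _).trans ?_
    refine gammaObj_hom_ext_two hE (X := E.gammaObj X) (a := a) (b := b) fun x y => ?_
    refine (hE.multi fun i => E.isCoprod_inclSeq hE X (y i).1).hom_ext fun z => ?_
    have hz (l : Fin (∑ i, (y i).1.len)) :
        (y (split l).1).1.pt (split l).2.castSucc = (x.concat y).1.pt l.castSucc ∧
        (y (split l).1).1.pt (split l).2.succ = (x.concat y).1.pt l.succ :=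
      ⟨(ObjSeq.concat_castSucc x.1 _ l).symm, (ObjSeq.concat_succ (SeqFrom.fits x.1 y) l).symm⟩
    let z' : ∀ l : Fin (x.concat y).1.len,
        SeqFrom (S := X.Obj) ((x.concat y).1.pt l.castSucc) ((x.concat y).1.pt l.succ) :=
      fun l => (z (split l).1 (split l).2).cast (hz l).1 (hz l).2
    let w : ∀ i : Fin x.1.len, SeqFrom (S := X.Obj) (x.1.pt i.castSucc) (x.1.pt i.succ) :=
      fun i => SeqFrom.concat (S := X.Obj) (y i) (z i)
    have l1 := congrArg ((E.ten x.1.len).map (fun i => E.inclSeq X (y i).1 (z i)) ≫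
      E.inclSeq (E.gammaObj X) x.1 y ≫ · ≫ (E.gammaMultMap hE X).map a b)
      (E.incl_map (E.gammaMultMap hE X) x)
    have l2 : (E.ten x.1.len).map (fun i => E.inclSeq X (y i).1 (z i)) ≫
        E.inclSeq (E.gammaObj X) x.1 y ≫
        (E.ten x.1.len).map (VGraph.homsMap (E.gammaMultMap hE X) x.1) =
      (E.ten x.1.len).map (fun i => E.sub (fun j => X.homs (z i j).1)) ≫
        (E.ten x.1.len).map (Y := (E.gammaObj X).homs x.1) (fun i => E.seqIncl X _ (w i) rfl
          (X.homs_concat (SeqFrom.fits (y i).1 (z i)))) := by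
      refine (congrArg (_ ≫ ·) ((E.ten _).map_comp _ _).symm).trans ?_
      refine ((E.ten _).map_comp _ _).symm.trans (Eq.trans ?_ ((E.ten _).map_comp _ _))
      exact congrArg (E.ten _).map (funext fun i => E.inclSeq_mult hE X (y i) (z i))
    have l2' := congrArg (· ≫ E.incl (E.gammaObj X) x ≫ (E.gammaMultMap hE X).map a b) l2
    have l3 := congrArg ((E.ten x.1.len).map (fun i => E.sub (fun j => X.homs (z i j).1)) ≫ ·)
      (E.map_seqIncl_mult hE X x w _ (fun i => X.homs_concat (SeqFrom.fits (y i).1 (z i))))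
    have r1 := congrArg ((E.ten x.1.len).map (fun i => E.inclSeq X (y i).1 (z i)) ≫ · ≫
      (E.gammaMultMap hE X).map a b) (E.inclSeq_mult hE (E.gammaObj X) x y)
    have r2 := congrArg (· ≫ E.seqIncl (E.gammaObj X) _ (x.concat y) rfl
      ((E.gammaObj X).homs_concat (SeqFrom.fits x.1 y)) ≫ (E.gammaMultMap hE X).map a b)
      (E.sub_naturality (fun i j => E.incl X (z i j)))
    have r3 := (E.map_mult hE X (x.concat y) z' _
      ((E.gammaObj X).homs_concat (SeqFrom.fits x.1 y))
      (fun l => E.incl X (z (split l).1 (split l).2))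
      (fun l => E.incl_cast X (hz l).1 (hz l).2 _))
    have m1 := congrArg (· ≫ E.seqIncl X _ (x.concat w) rfl (fun l =>
      (X.homs_concat (SeqFrom.fits (y _).1 (z _)) _).trans
        (X.homs_concat (SeqFrom.fits x.1 w) l))) (E.sub_sub (fun i j => X.homs (z i j).1))
    let S₁ := E.sub (fun i j => (E.ten (z i j).1.len).obj (X.homs (z i j).1))
    let S₂ := E.sub (k := ∑ i, (y i).1.len) (n := fun l => (z (split l).1 (split l).2).1.len)
      (fun l => X.homs (z (split l).1 (split l).2).1)
    have m2 := congrArg (fun t => S₁ ≫ S₂ ≫ t) (E.seqCast_seqIncl X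
      (sum_split fun i j => (z i j).1.len) (flat_flat fun i j => X.homs (z i j).1) rfl rfl
      ((x.concat y).concat z') (x.concat w)
      (ObjSeq.concat_concat x.1 (fun i => (y i).1) (fun i j => (z i j).1)) rfl
      (X.homs_concat (SeqFrom.fits _ z')) rfl (fun l =>
      (X.homs_concat (SeqFrom.fits (y _).1 (z _)) _).trans
        (X.homs_concat (SeqFrom.fits x.1 w) l)))
    have left := (congrArg (_ ≫ ·) (congrArg (_ ≫ ·) (Category.assoc _ _ _).symm)).trans (l1.trans
      ((congrArg (_ ≫ ·) (congrArg (_ ≫ ·) (Category.assoc _ _ _))).trans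
      ((congrArg (_ ≫ ·) (Category.assoc _ _ _).symm).trans
      ((Category.assoc _ _ _).symm.trans (l2'.trans
      ((Category.assoc _ _ _).trans (l3.trans (Category.assoc _ _ _).symm)))))))
    have right := (congrArg (_ ≫ ·) ((congrArg (_ ≫ ·) (Category.assoc _ _ _).symm).trans
      (Category.assoc _ _ _).symm)).trans (r1.trans
      ((congrArg (_ ≫ ·) (Category.assoc _ _ _)).trans ((Category.assoc _ _ _).symm.trans
      (r2.trans ((Category.assoc _ _ _).trans (congrArg (S₁ ≫ ·) r3))))))
    have middle := m1.symm.trans ((Category.assoc _ _ _).trans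
      ((congrArg (S₁ ≫ ·) (Category.assoc _ _ _)).trans
      (m2.trans (congrArg (fun t => S₁ ≫ S₂ ≫ t) (Category.comp_id _)))))
    exact left.trans (middle.trans right.symm)

end Multitensor

end

section

variable {V : Type u} [Category.{v} V] [HasCoproducts.{v} V]

/-- The natural transformation `Γε : ΓE ⟶ ΓF` of a morphism of multitensors `ε : E ⟶ F`. -/
noncomputable def Multitensor.Hom.gammaMap {E F : Multitensor V} (ε : Multitensor.Hom E F) :
    E.gammaFunctor ⟶ F.gammaFunctor where
  app X := ⟨id, fun a b => Sigma.desc fun x : SeqFrom a b =>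
    (ε.app x.1.len).app (X.homs x.1) ≫ F.incl X x⟩
  naturality X Y f := by
    refine VGraph.hom_ext (fun _ => rfl) fun a b => (Category.comp_id _).trans ?_
    refine Multitensor.gammaObj_hom_ext (E := E) (X := X) (a := a) (b := b) fun x => ?_
    refine (Category.assoc _ _ _).symm.trans ?_
    refine (congrArg (· ≫ _) (E.incl_map f x)).trans ((Category.assoc _ _ _).trans ?_)
    have h (Z : VGraph V) {a b : Z.Obj} (x : SeqFrom a b) :
        E.incl Z x ≫ (Sigma.desc fun x : SeqFrom a b =>
          (ε.app x.1.len).app (Z.homs x.1) ≫ F.incl Z x) =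
        (ε.app x.1.len).app (Z.homs x.1) ≫ F.incl Z x := Sigma.ι_desc _ x
    refine (congrArg ((E.ten x.1.len).map (VGraph.homsMap f x.1) ≫ ·)
      (h Y (x.map f.obj))).trans ?_
    refine Eq.trans ?_ (Category.assoc _ _ _)
    refine Eq.trans ?_ (congrArg (· ≫ _) (h X x).symm)
    refine Eq.trans ?_ (Category.assoc _ _ _).symm
    refine Eq.trans ?_ (congrArg (_ ≫ ·) (F.incl_map f x).symm)
    refine (Category.assoc _ _ _).symm.trans (Eq.trans ?_ (Category.assoc _ _ _))
    exact congrArg (· ≫ F.incl Y (x.map f.obj))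
      ((ε.app x.1.len).naturality (VGraph.homsMap f x.1))

variable {W : Type u'} [Category.{v} W] [HasCoproducts.{v} W]

/-- The natural transformation `Γψ` of a lax monoidal functor `(H, ψ) : (V, E) ⟶ (W, F)`: its
components are identities on objects and on homs they are the composites
`∐ F_i H X(x_{i-1}, x_i) ⟶ ∐ H E_i X(x_{i-1}, x_i) ⟶ H ∐ E_i X(x_{i-1}, x_i)`. -/
noncomputable def LaxMonFunctor.gammaMap {E : Multitensor V} {F : Multitensor W}
    (H : LaxMonFunctor E F) : VGraph.mapFunctor H.functor ⋙ F.gammaFunctor ⟶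
      E.gammaFunctor ⋙ VGraph.mapFunctor H.functor where
  app X := ⟨id, fun a b =>
    (Limits.Sigma.map fun x : SeqFrom (S := X.Obj) a b => H.coh (X.homs x.1)) ≫
      sigmaComparison H.functor fun x : SeqFrom (S := X.Obj) a b =>
        (E.ten x.1.len).obj (X.homs x.1)⟩
  naturality X Y f := by
    refine VGraph.hom_ext (fun _ => rfl) fun a b => (Category.comp_id _).trans ?_
    refine Multitensor.gammaObj_hom_ext (E := F)
      (X := (VGraph.mapFunctor H.functor).obj X) (a := a) (b := b) fun x => ?_
    have key (Z : VGraph V) {a b : Z.Obj} (y : SeqFrom a b) :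
        F.incl ((VGraph.mapFunctor H.functor).obj Z) y ≫
          (Limits.Sigma.map fun x : SeqFrom (S := Z.Obj) a b => H.coh (Z.homs x.1)) ≫
            sigmaComparison H.functor (fun x : SeqFrom (S := Z.Obj) a b =>
              (E.ten x.1.len).obj (Z.homs x.1)) = H.coh (Z.homs y.1) ≫ H.functor.map (E.incl Z y) := by
      have h1 := Sigma.ι_map (fun x : SeqFrom (S := Z.Obj) a b => H.coh (Z.homs x.1)) y
      have h2 := ι_comp_sigmaComparison H.functor (fun x : SeqFrom (S := Z.Obj) a b =>
        (E.ten x.1.len).obj (Z.homs x.1)) y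
      refine (Category.assoc _ _ _).symm.trans ((congrArg (· ≫ _) h1).trans ?_)
      exact (Category.assoc _ _ _).trans (congrArg (_ ≫ ·) h2)
    refine (Category.assoc _ _ _).symm.trans ?_
    refine (congrArg (· ≫ _) (F.incl_map ((VGraph.mapFunctor H.functor).map f) x)).trans
      ((Category.assoc _ _ _).trans ?_)
    refine (congrArg (_ ≫ ·) (key Y (x.map f.obj))).trans ?_
    refine Eq.trans ?_ (Category.assoc _ _ _)
    refine Eq.trans ?_ (congrArg (· ≫ H.functor.map _) (key X x).symm)
    refine (Category.assoc _ _ _).symm.trans ?_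
    refine (congrArg (· ≫ _) (H.coh_naturality (VGraph.homsMap f x.1))).trans ?_
    refine (Category.assoc _ _ _).trans (Eq.trans ?_ (Category.assoc _ _ _).symm)
    refine congrArg (H.coh (X.homs x.1) ≫ ·) ?_
    refine (H.functor.map_comp _ _).symm.trans (Eq.trans ?_ (H.functor.map_comp _ _))
    exact congrArg H.functor.map (E.incl_map f x).symm

end

/-! ### The multitensor `T^×` -/

section

variable {V : Type u} [Category.{v} V] [HasFiniteProducts V]

/-- The functor `(Z_1, …, Z_n) ↦ T Z_1 × ⋯ × T Z_n`. -/
noncomputable def timesFunctor (T : V ⥤ V) (n : ℕ) : (Fin n → V) ⥤ V where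
  obj Z := ∏ᶜ fun i => T.obj (Z i)
  map f := Limits.Pi.map fun i => T.map (f i)
  map_id Z := by
    refine Limits.Pi.hom_ext _ _ fun i => ?_
    simp
  map_comp f g := by
    refine Limits.Pi.hom_ext _ _ fun i => ?_
    simp

/-- The projections of `T Z_1 × ⋯ × T Z_n`. -/
noncomputable def timesProj (T : V ⥤ V) {n : ℕ} (Z : Fin n → V) (i : Fin n) :
    (timesFunctor T n).obj Z ⟶ T.obj (Z i) :=
  Pi.π (fun i => T.obj (Z i)) i

/-- The morphism to `T Z_1 × ⋯ × T Z_n` with the given components. -/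
noncomputable def timesLift (T : V ⥤ V) {n : ℕ} (Z : Fin n → V) {A : V}
    (f : ∀ i, A ⟶ T.obj (Z i)) : A ⟶ (timesFunctor T n).obj Z :=
  Pi.lift f

variable (T : V ⥤ V)

lemma times_hom_ext {n : ℕ} {Z : Fin n → V} {A : V} {f g : A ⟶ (timesFunctor T n).obj Z}
    (h : ∀ i, f ≫ timesProj T Z i = g ≫ timesProj T Z i) : f = g :=
  Limits.Pi.hom_ext _ _ h

lemma timesLift_proj {n : ℕ} (Z : Fin n → V) {A : V} (f : ∀ i, A ⟶ T.obj (Z i)) (i : Fin n) :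
    timesLift T Z f ≫ timesProj T Z i = f i :=
  limit.lift_π _ _

lemma timesMap_proj {n : ℕ} {Z Z' : Fin n → V} (f : Z ⟶ Z') (i : Fin n) :
    (timesFunctor T n).map f ≫ timesProj T Z' i = timesProj T Z i ≫ T.map (f i) :=
  Pi.map_π (fun i => T.map (f i)) i

lemma seqCast_proj {n m : ℕ} {Z : Fin n → V} {W : Fin m → V}
    (h : n = m) (h' : ∀ i, Z i = W (Fin.cast h i)) (i : Fin m) (j : Fin n)
    (e : j = Fin.cast h.symm i) (e' : Z j = W i) :
    seqCast (timesFunctor T) h h' ≫ timesProj T W i = timesProj T Z j ≫ T.map (eqToHom e') := by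
  subst h e
  obtain rfl : Z = W := funext h'
  refine Eq.trans ?_ (congrArg (_ ≫ ·) (T.map_id _).symm)
  exact (Category.id_comp _).trans (Category.comp_id _).symm

variable (T : Monad V)

/-- The projection of `∏ T (∏ T Z_{ij})` to `T Z_{ij}`. -/
noncomputable def timesProjTwo {k : ℕ} {n : Fin k → ℕ} (Z : ∀ i, Fin (n i) → V)
    (x : (i : Fin k) × Fin (n i)) :
    (timesFunctor T.toFunctor k).obj (fun i => (timesFunctor T.toFunctor (n i)).obj (Z i)) ⟶
      T.obj (Z x.1 x.2) :=
  timesProj T.toFunctor _ x.1 ≫ T.map (timesProj T.toFunctor (Z x.1) x.2) ≫ T.μ.app (Z x.1 x.2)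

lemma timesProjTwo_congr {k : ℕ} {n : Fin k → ℕ} (Z : ∀ i, Fin (n i) → V)
    {x y : (i : Fin k) × Fin (n i)} (h : x = y) (e : Z x.1 x.2 = Z y.1 y.2) :
    timesProjTwo T Z x ≫ T.map (eqToHom e) = timesProjTwo T Z y := by
  subst h
  rw [eqToHom_refl, T.map_id, Category.comp_id]

/-- The substitution of `T^×`. -/
noncomputable def timesSub {k : ℕ} {n : Fin k → ℕ} (Z : ∀ i, Fin (n i) → V) :
    (timesFunctor T.toFunctor k).obj (fun i => (timesFunctor T.toFunctor (n i)).obj (Z i)) ⟶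
      (timesFunctor T.toFunctor (∑ i, n i)).obj (flat Z) :=
  timesLift T.toFunctor (flat Z) fun l => timesProjTwo T Z (split l)

lemma timesSub_proj {k : ℕ} {n : Fin k → ℕ} (Z : ∀ i, Fin (n i) → V) (l : Fin (∑ i, n i)) :
    timesSub T Z ≫ timesProj T.toFunctor (flat Z) l = timesProjTwo T Z (split l) :=
  timesLift_proj _ _ _ l

lemma timesSub_proj_two {k : ℕ} {n : Fin k → ℕ} (Z : ∀ i, Fin (n i) → V) {A : V}
    (f : A ⟶ _) (l : Fin (∑ i, n i)) (x : (i : Fin k) × Fin (n i)) (h : x = split l) (e) :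
    (f ≫ timesSub T Z) ≫ timesProj T.toFunctor (flat Z) l =
      f ≫ timesProjTwo T Z x ≫ T.map (eqToHom e) := by
  rw [Category.assoc, timesSub_proj, timesProjTwo_congr T Z h e]

lemma split_cast_one {n : ℕ} (i : Fin n) :
    (⟨0, i⟩ : (_ : Fin 1) × Fin n) = split (Fin.cast (sum_one_len n) i) := by
  rw [← strictMono_val (sum_one_len n) (fun j => join (k := 1) (n := fun _ => n) 0 j)
    (fun a b h => join_lt_join (Or.inr ⟨rfl, h⟩)) i, split_join]

lemma split_cast_ones {n : ℕ} (i : Fin n) :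
    (⟨i, 0⟩ : (_ : Fin n) × Fin 1) = split (Fin.cast (sum_len_one n) i) := by
  rw [← strictMono_val (sum_len_one n) (fun j => join (k := n) (n := fun _ => 1) j 0)
    (fun a b h => join_lt_join (Or.inl h)) i, split_join]

/-- The multitensor `T^×` of a monad `T` on a category with finite products, with tensor products
`(Z_1, …, Z_n) ↦ T Z_1 × ⋯ × T Z_n`. -/
noncomputable def times : Multitensor V where
  ten := timesFunctor T.toFunctor
  unit Z := timesLift T.toFunctor (fun _ => Z) fun _ => T.η.app Z
  sub := timesSub T
  unit_naturality {Z Z'} f := times_hom_ext _ fun i => by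
    rw [Category.assoc, Category.assoc, timesLift_proj, timesMap_proj, ← Category.assoc,
      timesLift_proj]
    exact T.η.naturality f
  sub_naturality {k n Z Z'} f := times_hom_ext _ fun l => by
    rw [Category.assoc, Category.assoc, timesSub_proj, timesMap_proj, ← Category.assoc,
      timesSub_proj, timesProjTwo, timesProjTwo, ← Category.assoc, timesMap_proj,
      Category.assoc, Category.assoc, Category.assoc]
    congr 1
    rw [← Category.assoc, ← T.map_comp, timesMap_proj, T.map_comp, Category.assoc]
    congr 1
    exact T.μ.naturality _
  unit_sub {n} Z := times_hom_ext _ fun l => by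
    have e := split_cast_one (Fin.cast (sum_one_len n).symm l)
    rw [seqCast_proj T.toFunctor (sum_one_len n) _ l _ rfl (flat_one Z _),
      timesSub_proj_two T _ _ l _ e (flat_one Z _), timesProjTwo]
    simp only [← Category.assoc]
    rw [timesLift_proj]
    congr 1
    have := T.η.naturality (timesProj T.toFunctor Z (Fin.cast (sum_one_len n).symm l))
    have h2 := T.left_unit (Z (Fin.cast (sum_one_len n).symm l))
    refine (congrArg (· ≫ T.μ.app _) this.symm).trans ?_
    exact (Category.assoc _ _ _).trans ((congrArg (_ ≫ ·) h2).trans (Category.comp_id _))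
  map_unit_sub {n} Z := times_hom_ext _ fun l => by
    have e := split_cast_ones (Fin.cast (sum_len_one n).symm l)
    rw [seqCast_proj T.toFunctor (sum_len_one n) _ l _ rfl (flat_ones Z _),
      timesSub_proj_two T _ _ l _ e (flat_ones Z _), timesProjTwo]
    simp only [← Category.assoc]
    rw [timesMap_proj]
    congr 1
    rw [Category.assoc, Category.assoc, ← T.map_comp_assoc, timesLift_proj]
    exact (congrArg (_ ≫ ·) (T.right_unit _)).trans (Category.comp_id _)
  sub_sub {k n p} Z := times_hom_ext _ fun l => by
    obtain ⟨l, rfl⟩ : ∃ l', Fin.cast (sum_split p) l' = l := ⟨Fin.cast (sum_split p).symm l, rfl⟩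
    have e := split_split p l
    have e' := (split_join (n := p (split (split l).1).1) (split (split l).1).2 (split l).2).symm
    have eL := flat_flat Z l
    have eR : flat (fun i => flat (Z i)) (Fin.cast (sum_split p) l) =
        flat (Z (split (split l).1).1) (join (split (split l).1).2 (split l).2) := by
      rw [flat, e]
    have eM : Z (split (split l).1).1 (split (split l).1).2 (split l).2 =
        flat (Z (split (split l).1).1) (join (split (split l).1).2 (split l).2) := by
      rw [← eR, ← eL]
    rw [timesSub_proj_two T (fun i => flat (Z i)) _ (Fin.cast (sum_split p) l) _ e.symm eR.symm]
    rw [Category.assoc, Category.assoc, seqCast_proj T.toFunctor (sum_split p) _ _ l rfl eL]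
    have h1 := T.μ.naturality (timesProj T.toFunctor
      (Z (split (split l).1).1 (split (split l).1).2) (split l).2)
    have h2 := T.assoc (Z (split (split l).1).1 (split (split l).1).2 (split l).2)
    have h3 := T.μ.naturality (eqToHom eM)
    have hL : timesSub T (fun i j => (timesFunctor T.toFunctor (p i j)).obj (Z i j)) ≫
        timesSub T (n := fun l => p (split l).1 (split l).2) (fun l => Z (split l).1 (split l).2) ≫
          timesProj T.toFunctor _ l = timesProj T.toFunctor _ (split (split l).1).1 ≫
        T.map (timesProj T.toFunctor _ (split (split l).1).2) ≫
        T.map (T.map (timesProj T.toFunctor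
          (Z (split (split l).1).1 (split (split l).1).2) (split l).2)) ≫
        T.map (T.μ.app _) ≫ T.μ.app _ := by
      rw [timesSub_proj, timesProjTwo]
      refine (Category.assoc _ _ _).symm.trans ((congrArg (· ≫ _) (timesSub_proj _ _ _)).trans ?_)
      rw [timesProjTwo]
      refine (Category.assoc _ _ _).trans (congrArg (_ ≫ ·) ?_)
      refine (Category.assoc _ _ _).trans (congrArg (_ ≫ ·) ?_)
      refine (Category.assoc _ _ _).symm.trans ((congrArg (· ≫ _) h1.symm).trans ?_)
      exact (Category.assoc _ _ _).trans (congrArg (_ ≫ ·) h2.symm)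
    have hR : (timesFunctor T.toFunctor k).map (fun i => timesSub T (Z i)) ≫
        timesProjTwo T (fun i => flat (Z i))
          ⟨(split (split l).1).1, join (split (split l).1).2 (split l).2⟩ =
        timesProj T.toFunctor _ (split (split l).1).1 ≫
        T.map (timesProj T.toFunctor _ (split (split l).1).2) ≫
        T.map (T.map (timesProj T.toFunctor
          (Z (split (split l).1).1 (split (split l).1).2) (split l).2)) ≫
        T.map (T.μ.app _) ≫ T.μ.app _ ≫ T.map (eqToHom eM) := by
      rw [timesProjTwo, ← Category.assoc, timesMap_proj, Category.assoc]
      refine congrArg (_ ≫ ·) ?_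
      rw [← T.map_comp_assoc, timesSub_proj, ← timesProjTwo_congr T _ e' eM, timesProjTwo]
      simp only [Functor.map_comp, Category.assoc]
      exact congrArg (fun t => _ ≫ _ ≫ _ ≫ t) h3
    have hL' := congrArg (· ≫ T.map (eqToHom eL)) hL
    have hR' := congrArg (· ≫ T.map (eqToHom eR.symm)) hR
    simp only [Category.assoc] at hL' hR'
    refine hL'.trans (Eq.trans ?_ hR'.symm)
    rw [← T.map_comp, eqToHom_trans]

end

/-! ### Coproducts and products of graphs -/

section

variable {V : Type u} [Category.{v} V]

lemma IsCoprod.isIso {J : Type v} {A : J → V} {Z Z' : V} {c : ∀ j, A j ⟶ Z} (h : IsCoprod c)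
    (f : Z ⟶ Z') (h' : IsCoprod fun j => c j ≫ f) : IsIso f := by
  obtain ⟨e, he⟩ := h.exists_iso h'
  rw [← h.hom_ext he]
  infer_instance

lemma IsCoprod.of_iso {J : Type v} {A A' : J → V} {Z Z' : V} {c : ∀ j, A j ⟶ Z}
    {c' : ∀ j, A' j ⟶ Z'} (h : IsCoprod c) (e : ∀ j, A j ⟶ A' j) [∀ j, IsIso (e j)]
    (f : Z ⟶ Z') [IsIso f] (w : ∀ j, c j ≫ f = e j ≫ c' j) : IsCoprod c' :=
  of_existsUnique (fun W g => ⟨inv f ≫ h.desc fun j => e j ≫ g j, fun j => by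
      rw [← cancel_epi (e j), ← Category.assoc, ← w, Category.assoc, IsIso.hom_inv_id_assoc,
        h.fac]⟩)
    (fun W g g' H => by
      rw [← cancel_epi f]
      exact h.hom_ext fun j => by
        rw [← Category.assoc, ← Category.assoc, w, Category.assoc, Category.assoc, H])

lemma IsCoprod.isInitial {J : Type v} {A : J → V} {Z : V} {c : ∀ j, A j ⟶ Z} (h : IsCoprod c)
    (hA : ∀ j, Nonempty (IsInitial (A j))) : Nonempty (IsInitial Z) :=
  ⟨IsInitial.ofUniqueHom (fun W => h.desc fun j => (hA j).some.to W)
    (fun _ _ => h.hom_ext fun j => (hA j).some.hom_ext _ _)⟩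

lemma IsCoprod.of_isInitial {A : PEmpty.{v + 1} → V} {Z : V} (c : ∀ j, A j ⟶ Z)
    (h : Nonempty (IsInitial Z)) : IsCoprod c :=
  of_existsUnique (fun W _ => ⟨h.some.to W, fun j => j.elim⟩) (fun _ _ _ _ => h.some.hom_ext _ _)

/-- A functor which preserves coproducts in one variable (the other ones being fixed) sends a
sequence with an initial entry to an initial object. -/
lemma isInitial_seq {n : ℕ} (F : (Fin n → V) ⥤ V)
    (hF : ∀ (i : Fin n) (J : Type v) (A : J → Fin n → V) (Z : Fin n → V) (c : ∀ j, A j ⟶ Z),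
      (∀ j i', i' ≠ i → IsIso (c j i')) → IsCoprod (fun j => c j i) →
        IsCoprod (fun j => F.map (c j)))
    (Z : Fin n → V) (i : Fin n) (h : Nonempty (IsInitial (Z i))) :
    Nonempty (IsInitial (F.obj Z)) :=
  (hF i PEmpty (fun _ => Z) Z (fun j => j.elim) (fun j => j.elim)
    (IsCoprod.of_isInitial _ h)).isInitial (fun j => j.elim)

/-- A functor preserves coproducts. -/
def PreservesCoprods {W : Type u'} [Category.{v} W] (F : V ⥤ W) : Prop :=
  ∀ (J : Type v) (A : J → V) (Z : V) (c : ∀ j, A j ⟶ Z), IsCoprod c → IsCoprod fun j => F.map (c j)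

/-- Finite products preserve coproducts in each variable. -/
def IsDistCat (V : Type u) [Category.{v} V] [HasFiniteProducts V] : Prop :=
  ∀ (n : ℕ) (i : Fin n) (J : Type v) (A : J → Fin n → V) (Z : Fin n → V) (c : ∀ j, A j ⟶ Z),
    (∀ j i', i' ≠ i → IsIso (c j i')) → IsCoprod (fun j => c j i) →
      IsCoprod (fun j => (timesFunctor (𝟭 V) n).map (c j))

lemma times_isDistributive [HasFiniteProducts V] (hV : IsDistCat V) (T : Monad V)
    (hT : PreservesCoprods T.toFunctor) : (times T).IsDistributive :=
  fun n i J _ _ c h h' => hV n i J _ _ (fun j i => T.map (c j i))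
    (fun j i' hi => by have := h j i' hi; infer_instance) (hT J _ _ _ h')

namespace VGraph

/-- The family `c` exhibits the objects of `Z` as a disjoint union, such that the homs of `Z`
are the homs of its parts, respectively initial. -/
structure Decomp {J : Type v} {A : J → VGraph V} {Z : VGraph V} (c : ∀ j, A j ⟶ Z) : Prop where
  bij : Function.Bijective fun x : (j : J) × (A j).Obj => (c x.1).obj x.2
  iso : ∀ j a b, IsIso ((c j).map a b)
  init : ∀ j j' a b, j ≠ j' → Nonempty (IsInitial (Z.hom ((c j).obj a) ((c j').obj b)))

variable {J : Type v} {A : J → VGraph V} {Z : VGraph V} {c : ∀ j, A j ⟶ Z}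

lemma Decomp.inj (h : Decomp c) {j j' : J} {a : (A j).Obj} {a' : (A j').Obj}
    (e : (c j).obj a = (c j').obj a') : (⟨j, a⟩ : (j : J) × (A j).Obj) = ⟨j', a'⟩ :=
  h.bij.1 e

lemma Decomp.isCoprod (h : Decomp c) : IsCoprod c := by
  refine IsCoprod.of_existsUnique (fun W f => ?_) (fun W f g H => ?_)
  · obtain ⟨g₀, hg₀⟩ : ∃ g₀ : Z.Obj → W.Obj, ∀ j a, g₀ ((c j).obj a) = (f j).obj a :=
      ⟨fun z => (f _).obj ((Equiv.ofBijective _ h.bij).symm z).2, fun j a => by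
        have := (Equiv.ofBijective _ h.bij).symm_apply_apply ⟨j, a⟩
        exact congrArg (fun x : (j : J) × (A j).Obj => (f x.1).obj x.2) this⟩
    have key (z z' : Z.Obj) : ∃ m : Z.hom z z' ⟶ W.hom (g₀ z) (g₀ z'),
        ∀ j a b (ha : (c j).obj a = z) (hb : (c j).obj b = z'),
          (c j).map a b ≫ Z.cast ha hb ≫ m =
            (f j).map a b ≫ W.cast (by rw [← ha, hg₀]) (by rw [← hb, hg₀]) := by
      obtain ⟨⟨j, a⟩, rfl⟩ := h.bij.2 z
      obtain ⟨⟨j', b⟩, rfl⟩ := h.bij.2 z'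
      by_cases hj : j = j'
      · subst hj
        have := h.iso j a b
        refine ⟨inv ((c j).map a b) ≫ (f j).map a b ≫ W.cast (hg₀ j a).symm (hg₀ j b).symm,
          fun j' a' b' ha hb => ?_⟩
        obtain ⟨rfl, ha'⟩ := Sigma.mk.inj (h.inj ha)
        obtain rfl := eq_of_heq ha'
        obtain rfl := eq_of_heq (Sigma.mk.inj (h.inj hb)).2
        rw [cast_rfl, Category.id_comp, IsIso.hom_inv_id_assoc]
      · refine ⟨(h.init j j' a b hj).some.to _, fun j'' a' b' ha hb => ?_⟩
        exact absurd ((Sigma.mk.inj (h.inj ha)).1.symm.trans (Sigma.mk.inj (h.inj hb)).1) hj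
    choose m hm using key
    refine ⟨⟨g₀, m⟩, fun j => hom_ext (hg₀ j) fun a b => ?_⟩
    have := hm _ _ j a b rfl rfl
    rw [cast_rfl, Category.id_comp] at this
    refine (congrArg (· ≫ _) this).trans ?_
    rw [Category.assoc, cast_trans, cast_rfl, Category.comp_id]
  · have h0 : f.obj = g.obj := by
      funext z
      obtain ⟨⟨j, a⟩, rfl⟩ := h.bij.2 z
      exact congrFun (congrArg Hom.obj (H j)) a
    refine hom_ext (fun z => congrFun h0 z) fun z z' => ?_
    obtain ⟨⟨j, a⟩, rfl⟩ := h.bij.2 z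
    obtain ⟨⟨j', b⟩, rfl⟩ := h.bij.2 z'
    by_cases hj : j = j'
    · subst hj
      have := h.iso j a b
      rw [← cancel_epi ((c j).map a b)]
      exact (Category.assoc _ _ _).symm.trans (map_congr (H j) a b)
    · exact (h.init j j' a b hj).some.hom_ext _ _

instance isIso_map {X Y : VGraph V} (f : X ⟶ Y) [IsIso f] (a b : X.Obj) : IsIso (f.map a b) := by
  have h1 := map_congr (IsIso.hom_inv_id f) a b
  have h2 (a b : Y.Obj) := map_congr (IsIso.inv_hom_id f) a b
  have h0 (a : X.Obj) : (inv f).obj (f.obj a) = a := congrFun (congrArg Hom.obj (IsIso.hom_inv_id f)) a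
  refine ⟨(inv f).map _ _ ≫ X.cast (h0 a) (h0 b), (Category.assoc _ _ _).symm.trans h1, ?_⟩
  rw [Category.assoc, cast_map, ← Category.assoc]
  exact h2 _ _

lemma bijective_obj {X Y : VGraph V} (f : X ⟶ Y) [IsIso f] : Function.Bijective f.obj :=
  Function.bijective_iff_has_inverse.mpr ⟨(inv f).obj,
    congrFun (congrArg Hom.obj (IsIso.hom_inv_id f)), congrFun (congrArg Hom.obj (IsIso.inv_hom_id f))⟩

lemma Decomp.comp_iso (h : Decomp c) {Z' : VGraph V} (e : Z ⟶ Z') [IsIso e] :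
    Decomp fun j => c j ≫ e where
  bij := (bijective_obj e).comp h.bij
  iso j a b := by
    have := h.iso j a b
    rw [comp_map]
    infer_instance
  init j j' a b hj := ⟨(h.init j j' a b hj).some.ofIso (asIso (e.map _ _))⟩

open Classical in
lemma exists_decomp [HasInitial V] (A : J → VGraph V) :
    ∃ (Z : VGraph V) (c : ∀ j, A j ⟶ Z), Decomp c := by
  let Z : VGraph V := ⟨(j : J) × (A j).Obj, fun x y =>
    if h : x.1 = y.1 then (A y.1).hom (h ▸ x.2) y.2 else ⊥_ V⟩
  have hZ (j : J) (a b : (A j).Obj) : (A j).hom a b = Z.hom ⟨j, a⟩ ⟨j, b⟩ :=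
    Eq.symm (dif_pos (c := j = j) rfl)
  let c (j : J) : A j ⟶ Z := ⟨fun a => ⟨j, a⟩, fun a b => eqToHom (hZ j a b)⟩
  refine ⟨Z, c, Function.bijective_id, fun j a b => inferInstanceAs (IsIso (eqToHom (hZ j a b))),
    fun j j' a b hj => ?_⟩
  have : Z.hom ((c j).obj a) ((c j').obj b) = ⊥_ V := dif_neg hj
  rw [this]
  exact ⟨initialIsInitial⟩

lemma isCoprod_iff_decomp [HasInitial V] : IsCoprod c ↔ Decomp c := by
  refine ⟨fun h => ?_, Decomp.isCoprod⟩
  obtain ⟨Z', c', h'⟩ := exists_decomp A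
  obtain ⟨e, he⟩ := h'.isCoprod.exists_iso h
  rw [show c = fun j => c' j ≫ e.hom from funext fun j => (he j).symm]
  exact h'.comp_iso e.hom

instance [HasInitial V] : HasCoproducts.{v} (VGraph V) := fun J =>
  ⟨fun F => by
    obtain ⟨Z, c, h⟩ := exists_decomp fun j => F.obj ⟨j⟩
    have : HasColimit (Discrete.functor (F.obj ∘ Discrete.mk)) := ⟨⟨⟨_, h.isCoprod.some⟩⟩⟩
    exact hasColimit_of_iso Discrete.natIsoFunctor⟩

section

variable [HasFiniteProducts V] {n : ℕ}

/-- The product of graphs. -/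
noncomputable def prod (F : Fin n → VGraph V) : VGraph V :=
  ⟨∀ i, (F i).Obj, fun a b => (timesFunctor (𝟭 V) n).obj fun i => (F i).hom (a i) (b i)⟩

noncomputable def prodProj (F : Fin n → VGraph V) (i : Fin n) : prod F ⟶ F i :=
  ⟨fun a => a i, fun a b => timesProj (𝟭 V) (fun i => (F i).hom (a i) (b i)) i⟩

lemma prod_hom_ext {F : Fin n → VGraph V} {X : VGraph V} {f g : X ⟶ prod F}
    (h : ∀ i, f ≫ prodProj F i = g ≫ prodProj F i) : f = g := by
  have h0 (a) : f.obj a = g.obj a := funext fun i => congrFun (congrArg Hom.obj (h i)) a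
  refine hom_ext h0 fun a b => times_hom_ext (𝟭 V) fun i => ?_
  refine Eq.trans ?_ (map_congr (h i) a b)
  refine (Category.assoc _ _ _).trans (Eq.trans ?_ (Category.assoc _ _ _).symm)
  exact congrArg (_ ≫ ·) (cast_map (prodProj F i) (h0 a) (h0 b))

noncomputable def prodIsLimit (F : Fin n → VGraph V) : IsLimit (Fan.mk (prod F) (prodProj F)) :=
  Fan.IsLimit.mk _ (fun s => ⟨fun a i => (s.proj i).obj a,
      fun a b => timesLift (𝟭 V) _ fun i => (s.proj i).map a b⟩)
    (fun _ i => hom_ext (fun _ => rfl) fun _ _ => (Category.comp_id _).trans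
      (timesLift_proj (𝟭 V) _ _ i))
    (fun _ _ hm => prod_hom_ext fun i => (hm i).trans (Eq.symm (hom_ext (fun _ => rfl)
      fun _ _ => (Category.comp_id _).trans (timesLift_proj (𝟭 V) _ _ i))))

instance : HasFiniteProducts (VGraph V) := ⟨fun n => ⟨fun F => by
  have : HasLimit (Discrete.functor (F.obj ∘ Discrete.mk)) := ⟨⟨⟨_, prodIsLimit fun j => F.obj ⟨j⟩⟩⟩⟩
  exact hasLimit_of_iso Discrete.natIsoFunctor.symm⟩⟩

/-- The product of morphisms of graphs. -/
noncomputable def prodMap {F G : Fin n → VGraph V} (f : F ⟶ G) : prod F ⟶ prod G :=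
  ⟨fun a i => (f i).obj (a i), fun a b =>
    (timesFunctor (𝟭 V) n).map (X := fun i => (F i).hom (a i) (b i)) fun i => (f i).map (a i) (b i)⟩

lemma isDistCat [HasInitial V] (hV : IsDistCat V) : IsDistCat (VGraph V) := by
  intro n i J A Z c hc hi
  rw [isCoprod_iff_decomp] at hi
  have hiso (j : J) (i' : Fin n) (a b) : IsIso ((c j i').map a b) := by
    by_cases h : i' = i
    · subst h; exact hi.iso j a b
    · have := hc j i' h; infer_instance
  have hinj (j : J) (i' : Fin n) : Function.Injective (c j i').obj := by
    by_cases h : i' = i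
    · subst h
      exact fun a b e => eq_of_heq (Sigma.mk.inj (hi.inj e)).2
    · have := hc j i' h
      exact (bijective_obj (c j i')).1
  have key : Decomp fun j => prodMap (c j) := by
    refine ⟨⟨fun x y e => ?_, fun z => ?_⟩, fun j a b => ?_, fun j j' a b hj => ?_⟩
    · obtain ⟨j, a⟩ := x
      obtain ⟨j', b⟩ := y
      obtain rfl : j = j' := (Sigma.mk.inj (hi.inj (congrFun e i))).1
      rw [show a = b from funext fun i' => hinj j i' (congrFun e i')]
    · obtain ⟨⟨j, a⟩, ha⟩ := hi.bij.2 (z i)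
      have (i' : Fin n) : ∃ a, (c j i').obj a = z i' := by
        by_cases h : i' = i
        · subst h; exact ⟨a, ha⟩
        · have := hc j i' h
          exact (bijective_obj (c j i')).2 _
      choose a ha using this
      exact ⟨⟨j, a⟩, funext ha⟩
    · have := isIso_seq (A := fun i => (A j i).hom (a i) (b i))
        (Z := fun i => (Z i).hom ((c j i).obj (a i)) ((c j i).obj (b i)))
        (fun i' => (c j i').map (a i') (b i')) fun i' => hiso j i' _ _
      exact Functor.map_isIso (timesFunctor (𝟭 V) n) (X := fun i => (A j i).hom (a i) (b i))
        (Y := fun i => (Z i).hom ((c j i).obj (a i)) ((c j i).obj (b i)))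
        fun i' => (c j i').map (a i') (b i')
    · exact isInitial_seq _ (hV n) _ i (hi.init j j' (a i) (b i) hj)
  let e (F : Fin n → VGraph V) : prod F ≅ (timesFunctor (𝟭 (VGraph V)) n).obj F :=
    (prodIsLimit F).conePointUniqueUpToIso (limit.isLimit (Discrete.functor F))
  have he (F : Fin n → VGraph V) (i : Fin n) :
      (e F).hom ≫ timesProj (𝟭 (VGraph V)) F i = prodProj F i :=
    (prodIsLimit F).conePointUniqueUpToIso_hom_comp (limit.isLimit (Discrete.functor F)) ⟨i⟩
  refine key.isCoprod.of_iso (fun j => (e (A j)).hom) (e Z).hom fun j => ?_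
  refine times_hom_ext _ fun i' => ?_
  rw [Category.assoc, Category.assoc, timesMap_proj, he, ← Category.assoc, he]
  exact hom_ext (fun _ => rfl) fun a b => (Category.comp_id _).trans
    (timesMap_proj (𝟭 V) (Z := fun i => (A j i).hom (a i) (b i)) (fun i => (c j i).map (a i) (b i)) i')

end

lemma gamma_preserves [HasCoproducts.{v} V] [HasInitial V] (E : Multitensor V)
    (hE : E.IsDistributive) : PreservesCoprods E.gammaFunctor := by
  intro J A Z c hc
  rw [isCoprod_iff_decomp] at hc ⊢
  have hinj (j : J) : Function.Injective (c j).obj :=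
    fun a b e => eq_of_heq (Sigma.mk.inj (hc.inj e)).2
  have comp : ∃ p : Z.Obj → J, ∀ j a, p ((c j).obj a) = j :=
    ⟨fun z => ((Equiv.ofBijective _ hc.bij).symm z).1, fun j a =>
      congrArg Sigma.fst ((Equiv.ofBijective _ hc.bij).symm_apply_apply ⟨j, a⟩)⟩
  obtain ⟨p, hp⟩ := comp
  have dich (x : ObjSeq Z.Obj) : (∀ l, p (x.pt l) = p (x.pt 0)) ∨
      Nonempty (IsInitial ((E.ten x.len).obj (Z.homs x))) := by
    by_cases h : ∀ i : Fin x.len, p (x.pt i.castSucc) = p (x.pt i.succ)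
    · refine Or.inl fun l => Fin.induction rfl (fun i hi => (h i).symm.trans hi) l
    · push Not at h
      obtain ⟨i, hi⟩ := h
      refine Or.inr (isInitial_seq _ (hE _) _ i ?_)
      unfold homs
      obtain ⟨⟨j, a⟩, ha⟩ := hc.bij.2 (x.pt i.castSucc)
      obtain ⟨⟨j', b⟩, hb⟩ := hc.bij.2 (x.pt i.succ)
      rw [← ha, ← hb] at hi ⊢
      exact hc.init j j' a b (by rwa [hp, hp] at hi)
  refine ⟨hc.bij, fun j (a b : (A j).Obj) => ?_, fun j j' a b hj => ?_⟩
  · change IsIso ((E.gammaMor (c j)).map a b)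
    refine (E.isCoprod_incl (A j) a b).isIso _ ?_
    have hiso (x : SeqFrom a b) : IsIso ((E.ten x.1.len).map (homsMap (c j) x.1)) := by
      have := isIso_seq (homsMap (c j) x.1) fun i => hc.iso j _ _
      exact Functor.map_isIso (E.ten x.1.len) (homsMap (c j) x.1)
    have hmap (x y : SeqFrom a b) (e : x.map (c j).obj = y.map (c j).obj) : x = y := by
      obtain ⟨⟨n, x⟩, hx⟩ := x
      obtain ⟨⟨m, y⟩, hy⟩ := y
      obtain ⟨rfl, h⟩ := ObjSeq.mk.inj (Subtype.mk.inj e)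
      have : x = y := funext fun l => hinj j (congrFun (eq_of_heq h) l)
      subst this
      rfl
    have dich' (y : SeqFrom ((c j).obj a) ((c j).obj b)) : (∃ x : SeqFrom a b, x.map (c j).obj = y) ∨
        Nonempty (IsInitial ((E.ten y.1.len).obj (Z.homs y.1))) := by
      refine (dich y.1).imp_left fun h => ?_
      have (l : Fin (y.1.len + 1)) : ∃ a', (c j).obj a' = y.1.pt l := by
        obtain ⟨⟨j', a'⟩, ha'⟩ := hc.bij.2 (y.1.pt l)
        have := h l
        rw [y.2.1, hp, ← ha'] at this
        obtain rfl := (hp j' a').symm.trans this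
        exact ⟨a', ha'⟩
      choose q hq using this
      refine ⟨⟨⟨y.1.len, q⟩, hinj j ((hq _).trans y.2.1), hinj j ((hq _).trans y.2.2)⟩, ?_⟩
      exact Subtype.ext (congrArg (ObjSeq.mk _) (funext hq))
    refine IsCoprod.of_existsUnique (fun W f => ?_) (fun W f g H => ?_)
    · have key (y : SeqFrom ((c j).obj a) ((c j).obj b)) :
          ∃ m : (E.ten y.1.len).obj (Z.homs y.1) ⟶ W, ∀ (x : SeqFrom a b)
            (e : x.map (c j).obj = y), (E.ten x.1.len).map (homsMap (c j) x.1) ≫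
              eqToHom (congrArg (fun y : SeqFrom _ _ => (E.ten y.1.len).obj (Z.homs y.1)) e) ≫ m =
                f x := by
        by_cases h : ∃ x : SeqFrom a b, x.map (c j).obj = y
        · obtain ⟨x, rfl⟩ := h
          obtain ⟨i, hi, _⟩ := hiso x
          refine ⟨i ≫ f x, fun x' e => ?_⟩
          obtain rfl := hmap _ _ e
          refine (congrArg (_ ≫ ·) (Category.id_comp _)).trans ?_
          exact (Category.assoc _ _ _).symm.trans ((congrArg (· ≫ _) hi).trans (Category.id_comp _))
        · exact ⟨((dich' y).resolve_left h).some.to W, fun x e => absurd ⟨x, e⟩ h⟩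
      choose m hm using key
      refine ⟨(E.isCoprod_incl Z _ _).desc m, fun x => ?_⟩
      refine (congrArg (· ≫ _) (E.incl_map (c j) x)).trans ((Category.assoc _ _ _).trans ?_)
      refine (congrArg ((E.ten x.1.len).map (homsMap (c j) x.1) ≫ ·)
        ((E.isCoprod_incl Z _ _).fac m (x.map (c j).obj))).trans ?_
      exact (congrArg (_ ≫ ·) (Category.id_comp _).symm).trans (hm _ x rfl)
    · refine (E.isCoprod_incl Z _ _).hom_ext fun y => ?_
      rcases dich' y with ⟨x, rfl⟩ | h
      · have := hiso x
        refine (cancel_epi ((E.ten x.1.len).map (homsMap (c j) x.1))).mp ?_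
        have h1 (f : (E.gammaObj Z).hom ((c j).obj a) ((c j).obj b) ⟶ W) :=
          (congrArg (· ≫ f) (E.incl_map (c j) x)).trans (Category.assoc _ _ _)
        exact (h1 f).symm.trans ((H x).trans (h1 g))
      · exact h.some.hom_ext _ _
  · refine (E.isCoprod_incl Z _ _).isInitial fun x => ((dich x.1).resolve_left fun h => hj ?_)
    have := h (Fin.last _)
    rw [x.2.1, x.2.2] at this
    exact ((hp j' b).symm.trans (this.trans (hp j a))).symm

end VGraph

end

/-! ### The strict `n`-category monads -/

section

lemma isCoprod_type_of_bijective {J : Type v} {A : J → Type v} {Z : Type v} {c : ∀ j, A j ⟶ Z}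
    (h : Function.Bijective fun x : (j : J) × A j => c x.1 x.2) : IsCoprod c := by
  refine IsCoprod.of_existsUnique (fun W f => ⟨↾fun z => f _ ((Equiv.ofBijective _ h).symm z).2,
    fun j => ?_⟩) (fun W f g H => ?_)
  · ext a
    exact congrArg (fun x : (j : J) × A j => f x.1 x.2)
      ((Equiv.ofBijective _ h).symm_apply_apply ⟨j, a⟩)
  · ext z
    obtain ⟨⟨j, a⟩, rfl⟩ := h.2 z
    exact ConcreteCategory.congr_hom (H j) a

lemma isCoprod_type_iff {J : Type v} {A : J → Type v} {Z : Type v} {c : ∀ j, A j ⟶ Z} :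
    IsCoprod c ↔ Function.Bijective fun x : (j : J) × A j => c x.1 x.2 := by
  refine ⟨fun h => ?_, isCoprod_type_of_bijective⟩
  have h' : IsCoprod (Z := (j : J) × A j) fun j => ↾fun a : A j => (⟨j, a⟩ : (j : J) × A j) :=
    isCoprod_type_of_bijective Function.bijective_id
  obtain ⟨e, he⟩ := h'.exists_iso h
  have := (isIso_iff_bijective e.hom).mp inferInstance
  convert this using 2 with x
  rw [← he]
  rfl

lemma isDistCat_type : IsDistCat (Type v) := by
  intro n i J A Z c hc hi
  rw [isCoprod_type_iff] at hi
  have hinj (j : J) (i' : Fin n) : Function.Injective (c j i') := by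
    by_cases h : i' = i
    · subst h
      exact fun a b e => eq_of_heq (Sigma.mk.inj (hi.1 (a₁ := ⟨j, a⟩) (a₂ := ⟨j, b⟩) e)).2
    · exact ((isIso_iff_bijective (c j i')).mp (hc j i' h)).1
  let p (F : Fin n → Type v) : (timesFunctor (𝟭 (Type v)) n).obj F ≅ ∀ i, F i := Types.productIso F
  have hp (F : Fin n → Type v) (i : Fin n) :
      (p F).hom ≫ (↾fun f : ∀ i, F i => f i) = timesProj (𝟭 (Type v)) F i :=
    Types.productIso_hom_comp_eval F i
  let m (j : J) : (∀ i, A j i) ⟶ ∀ i, Z i := ↾fun a i => c j i (a i)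
  have key : IsCoprod m := by
    rw [isCoprod_type_iff]
    refine ⟨fun x y e => ?_, fun z => ?_⟩
    · obtain ⟨j, a⟩ := x
      obtain ⟨j', b⟩ := y
      obtain rfl : j = j' :=
        (Sigma.mk.inj (hi.1 (a₁ := ⟨j, a i⟩) (a₂ := ⟨j', b i⟩) (congrFun e i))).1
      rw [show a = b from funext fun i' => hinj j i' (congrFun e i')]
    · obtain ⟨⟨j, a⟩, ha⟩ := hi.2 (z i)
      have (i' : Fin n) : ∃ a, c j i' a = z i' := by
        by_cases h : i' = i
        · subst h; exact ⟨a, ha⟩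
        · exact ((isIso_iff_bijective (c j i')).mp (hc j i' h)).2 _
      choose a ha using this
      exact ⟨⟨j, a⟩, funext ha⟩
  refine key.of_iso (fun j => (p (A j)).inv) (p Z).inv fun j => ?_
  rw [Iso.comp_inv_eq, Category.assoc, Iso.eq_inv_comp]
  ext a i
  have h1 := ConcreteCategory.congr_hom (hp (A j) i) a
  have h2 := ConcreteCategory.congr_hom (hp Z i) ((timesFunctor (𝟭 (Type v)) n).map (c j) a)
  have h3 := ConcreteCategory.congr_hom (timesMap_proj (𝟭 (Type v)) (c j) i) a
  exact (congrArg (c j i) h1).trans (h3.symm.trans h2.symm)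

instance {V : Type u} [Category.{v} V] [HasCoproducts.{v} V] : HasInitial V :=
  hasColimitsOfShape_of_equivalence (Discrete.equivalence (Equiv.equivPEmpty PEmpty.{1}).symm).symm

/-- A coproduct preserving monad `T` on a category with coproducts and finite products, the
finite products preserving coproducts in each variable. -/
structure Stage : Type (v + 2) where
  C : Type (v + 1)
  cat : Category.{v} C
  coproducts : HasCoproducts.{v} C
  products : HasFiniteProducts C
  dist : IsDistCat C
  T : Monad C
  preserves : PreservesCoprods T.toFunctor

attribute [instance] Stage.cat Stage.coproducts Stage.products

/-- The identity monad on the category of sets. -/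
def Stage.zero : Stage.{v} where
  C := Type v
  cat := inferInstance
  coproducts := inferInstance
  products := inferInstance
  dist := isDistCat_type
  T := Monad.id (Type v)
  preserves := fun _ _ _ _ h => h

/-- The monad `ΓT^×` on `𝒢C`, for a monad `T` on `C`. -/
noncomputable def Stage.next (S : Stage.{v}) : Stage.{v} where
  C := VGraph S.C
  cat := inferInstance
  coproducts := inferInstance
  products := inferInstance
  dist := VGraph.isDistCat S.dist
  T := (times S.T).gamma (times_isDistributive S.dist S.T S.preserves)
  preserves := VGraph.gamma_preserves _ (times_isDistributive S.dist S.T S.preserves)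

/-- The inductively defined sequence of monads `𝒯_{≤n}` on `𝒢ⁿSet`. -/
noncomputable def stage : ℕ → Stage.{v}
  | 0 => Stage.zero
  | n + 1 => (stage n).next

/-- The category `𝒢ⁿSet` of `n`-globular sets. -/
abbrev NGlob (n : ℕ) : Type (v + 1) := (stage.{v} n).C

/-- The monad `𝒯_{≤n}` on `𝒢ⁿSet`, whose algebras are the strict `n`-categories. -/
noncomputable abbrev strictMonad (n : ℕ) : Monad (NGlob.{v} n) := (stage.{v} n).T

end

/-! ### Trivial fibrations, extensive categories, connected objects -/

section

/-- A natural transformation is a trivial `I`-fibration when its components are, i.e. when they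
have the right lifting property with respect to all the maps in `I`. -/
def IsTrivialFibration {C : Type*} [Category* C] {D : Type*} [Category* D]
    (I : MorphismProperty D) {F G : C ⥤ D} (φ : F ⟶ G) : Prop :=
  ∀ X, I.rlp (φ.app X)

variable {V : Type u} [Category.{v} V]

namespace VGraph

/-- The empty graph. -/
def empty (V : Type u) [Category.{v} V] : VGraph V := ⟨PEmpty, fun a _ => a.elim⟩

variable [HasInitial V]

/-- The graph `0`, with one object whose only hom is initial. -/
noncomputable def point (V : Type u) [Category.{v} V] [HasInitial V] : VGraph V :=
  ⟨PUnit, fun _ _ => ⊥_ V⟩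

def emptyTo (X : VGraph V) : empty V ⟶ X := ⟨fun a => a.elim, fun a _ => a.elim⟩

/-- The homs of the graph `(S)`. -/
noncomputable def suspHom (S : V) : Bool → Bool → V
  | false, true => S
  | _, _ => ⊥_ V

noncomputable def suspHomMap {S B : V} (i : S ⟶ B) : ∀ a b, suspHom S a b ⟶ suspHom B a b
  | false, true => i
  | false, false => 𝟙 _
  | true, false => 𝟙 _
  | true, true => 𝟙 _

/-- The graph `(S)` with two objects, `S` as hom from the first to the second one and all other
homs initial. -/
noncomputable def susp (S : V) : VGraph V := ⟨ULift Bool, fun a b => suspHom S a.down b.down⟩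

/-- The map `(i) : (S) ⟶ (B)`. -/
noncomputable def suspMap {S B : V} (i : S ⟶ B) : susp S ⟶ susp B :=
  ⟨id, fun a b => suspHomMap i a.down b.down⟩

/-- The class `I⁺` of maps of graphs, consisting of `∅ ⟶ 0` and of `(i) : (S) ⟶ (B)` for `i ∈ I`. -/
inductive plus (I : MorphismProperty V) : MorphismProperty (VGraph V)
  | point : plus I (emptyTo (point V))
  | susp {S B : V} (i : S ⟶ B) (hi : I i) : plus I (suspMap i)

end VGraph

/-- The class `I_{≤0}` of maps of sets, consisting of `∅ ⟶ 1` and `1 + 1 ⟶ 1`. -/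
inductive setGen : MorphismProperty (Type v)
  | point : setGen (↾fun a : PEmpty => (a.elim : PUnit))
  | fold : setGen (↾fun _ : PUnit.{v + 1} ⊕ PUnit.{v + 1} => PUnit.unit.{v + 1})

/-- The classes `I_{≤n}` of maps of `n`-globular sets. -/
noncomputable def genLE : ∀ n : ℕ, MorphismProperty (NGlob.{v} n)
  | 0 => setGen
  | n + 1 => VGraph.plus (genLE n)

/-- The functor which sends a family of morphisms `f_j : Y_j ⟶ X_j` to `∐ f_j : ∐ Y_j ⟶ ∐ X_j`. -/
noncomputable def coprodOver [HasCoproducts.{v} V] {J : Type v} (X : J → V) :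
    (∀ j, Over (X j)) ⥤ Over (∐ X) where
  obj f := Over.mk (Limits.Sigma.map fun j => (f j).hom)
  map g := Over.homMk (Limits.Sigma.map fun j => (g j).left)
  map_id f := by
    ext
    simp
  map_comp f g := by
    ext
    refine Limits.Sigma.hom_ext _ _ fun j => ?_
    simp

/-- A category with coproducts is extensive when the functors `∏ V/X_j ⥤ V/∐X_j` given by
coproducts are equivalences for all families of objects. -/
def IsExtensive (V : Type u) [Category.{v} V] [HasCoproducts.{v} V] : Prop :=
  ∀ (J : Type v) (X : J → V), (coprodOver X).IsEquivalence

/-- An object `B` is connected when the functor `V(B, -)` preserves coproducts. -/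
def IsConnectedObj (B : V) : Prop := PreservesCoprods (coyoneda.obj (Opposite.op B))

/-- A morphism of monads `α : A ⟶ T` on `𝒢V` is a `T`-operad over `Set`: it is a cartesian
transformation, and its components are bijective on objects. -/
structure IsOperadOverSet {T A : Monad (VGraph V)} (α : A ⟶ T) : Prop where
  cartesian : NatTrans.Equifibered α.toNatTrans
  bijective : ∀ X : VGraph V, Function.Bijective (α.app X).obj

/-- The `ΓF`-operad `α : A ⟶ ΓF` corresponds to the `F`-multitensor `ε : E ⟶ F`: up to an
isomorphism of monads, `α` is `Γε : ΓE ⟶ ΓF`. -/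
def Corresponds [HasCoproducts.{v} V] {E F : Multitensor V} {hF : F.IsDistributive}
    {A : Monad (VGraph V)} (α : A ⟶ F.gamma hF) (ε : Multitensor.Hom E F) : Prop :=
  ∃ (hE : E.IsDistributive) (θ : E.gamma hE ≅ A),
    ∀ X, θ.hom.app X ≫ α.app X = ε.gammaMap.app X

end

/-! ### Globular sets and strict `ω`-categories -/

/-- The category `𝔾` of globes. Its objects are the natural numbers. -/
@[ext] structure Globe where
  dim : ℕ

namespace Globe

/-- Besides the identities there are two morphisms `k ⟶ n` for each `k < n`, the cosource
(`some false`) and the cotarget (`some true`); the identities are represented by `none`. -/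
def Hom (k n : Globe) : Type :=
  {o : Option Bool // (o = none ∧ k = n) ∨ (o ≠ none ∧ k.dim < n.dim)}

lemma hom_comp_aux {k m n : Globe} (f : Hom k m) (g : Hom m n) :
    (f.1.or g.1 = none ∧ k = n) ∨ (f.1.or g.1 ≠ none ∧ k.dim < n.dim) := by
  obtain ⟨f, ⟨rfl, rfl⟩ | ⟨hf, hf'⟩⟩ := f
  · simpa using g.2
  · obtain ⟨b, rfl⟩ := Option.ne_none_iff_exists'.mp hf
    refine Or.inr ⟨by simp, lt_of_lt_of_le hf' ?_⟩
    rcases g.2 with ⟨_, h⟩ | ⟨_, h⟩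
    · exact le_of_eq (by rw [h])
    · exact h.le

instance : SmallCategory Globe where
  Hom := Hom
  id n := ⟨none, Or.inl ⟨rfl, rfl⟩⟩
  comp f g := ⟨f.1.or g.1, hom_comp_aux f g⟩
  id_comp f := Subtype.ext (by simp)
  comp_id f := Subtype.ext (by simp)
  assoc f g h := Subtype.ext (by simp [Option.or_assoc])

/-- The cosource (`b = false`) and the cotarget (`b = true`). -/
def face (b : Bool) {k n : Globe} (h : k.dim < n.dim) : k ⟶ n :=
  ⟨some b, Or.inr ⟨by simp, h⟩⟩

lemma face_face (b b' : Bool) {k m n : Globe} (h : k.dim < m.dim) (h' : m.dim < n.dim) :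
    face b h ≫ face b' h' = face b (h.trans h') := rfl

lemma hom_cases {k n : Globe} (f : k ⟶ n) :
    (∃ e : k = n, f = eqToHom e) ∨ ∃ (b : Bool) (h : k.dim < n.dim), f = face b h := by
  obtain ⟨o, ⟨rfl, rfl⟩ | ⟨h, h'⟩⟩ := f
  · exact Or.inl ⟨rfl, rfl⟩
  · obtain ⟨b, rfl⟩ := Option.ne_none_iff_exists'.mp h
    exact Or.inr ⟨b, h', rfl⟩

end Globe

/-- The category of globular sets. -/
abbrev Glob : Type (v + 1) := Globeᵒᵖ ⥤ Type v

namespace Glob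

/-- The set of `n`-cells. -/
abbrev cell (X : Glob.{v}) (n : Globe) : Type v := X.obj (Opposite.op n)

/-- The `k`-dimensional source (`b = false`) and target (`b = true`) of an `n`-cell. -/
def bd {X : Glob.{v}} (b : Bool) {k n : Globe} (h : k.dim < n.dim) (x : X.cell n) : X.cell k :=
  X.map (Globe.face b h).op x

lemma bd_bd {X : Glob.{v}} (b b' : Bool) {k m n : Globe} (h : k.dim < m.dim) (h' : m.dim < n.dim)
    (x : X.cell n) : bd b h (bd b' h' x) = bd b (h.trans h') x := by
  unfold bd
  rw [← Globe.face_face b b' h h', op_comp, X.map_comp]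
  rfl

lemma app_bd {X Y : Glob.{v}} (f : X ⟶ Y) (b : Bool) {k n : Globe} (h : k.dim < n.dim)
    (x : X.cell n) : f.app _ (bd b h x) = bd b h (f.app _ x) :=
  ConcreteCategory.congr_hom (f.naturality (Globe.face b h).op) x

end Glob

open Glob in
/-- The structure of a strict `ω`-category on a globular set. -/
structure OmegaStr (X : Glob.{v}) where
  /-- the identity `n`-cell of a `k`-cell -/
  idn {k n : Globe} (h : k.dim < n.dim) : X.cell k → X.cell n
  /-- the composite of `n`-cells along a common boundary `k`-cell -/
  comp {k n : Globe} (h : k.dim < n.dim) (x y : X.cell n) (e : bd true h x = bd false h y) : X.cell n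
  bd_idn (b) {k n : Globe} (h : k.dim < n.dim) (x) : bd b h (idn h x) = x
  idn_idn {k m n : Globe} (h : k.dim < m.dim) (h' : m.dim < n.dim) (x) :
    idn h' (idn h x) = idn (h.trans h') x
  src_comp {k n : Globe} (h : k.dim < n.dim) (x y e) : bd false h (comp h x y e) = bd false h x
  tgt_comp {k n : Globe} (h : k.dim < n.dim) (x y e) : bd true h (comp h x y e) = bd true h y
  bd_comp (b) {k m n : Globe} (h : k.dim < m.dim) (h' : m.dim < n.dim) (x y e e') :
    bd b h' (comp (h.trans h') x y e) = comp h (bd b h' x) (bd b h' y) e'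
  id_comp {k n : Globe} (h : k.dim < n.dim) (x e) : comp h (idn h (bd false h x)) x e = x
  comp_id {k n : Globe} (h : k.dim < n.dim) (x e) : comp h x (idn h (bd true h x)) e = x
  assoc {k n : Globe} (h : k.dim < n.dim) (x y z e e₁ e₂ e₃) :
    comp h (comp h x y e) z e₁ = comp h x (comp h y z e₂) e₃
  interchange {k m n : Globe} (h : k.dim < m.dim) (h' : m.dim < n.dim)
    (x y x' y' e₁ e₂ e₃ e₄ e₅ e₆) :
    comp (h.trans h') (comp h' x y e₁) (comp h' x' y' e₂) e₃ =
      comp h' (comp (h.trans h') x x' e₄) (comp (h.trans h') y y' e₅) e₆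
  idn_comp {k m n : Globe} (h : k.dim < m.dim) (h' : m.dim < n.dim) (x y e e') :
    idn h' (comp h x y e) = comp (h.trans h') (idn h' x) (idn h' y) e'

/-- A strict `ω`-category. -/
structure OmegaCat : Type (v + 1) where
  X : Glob.{v}
  str : OmegaStr X

namespace OmegaCat

open Glob

/-- A strict `ω`-functor. -/
structure Hom (C D : OmegaCat.{v}) : Type v where
  map : C.X ⟶ D.X
  map_idn {k n : Globe} (h : k.dim < n.dim) (x) :
    map.app _ (C.str.idn h x) = D.str.idn h (map.app _ x)
  map_comp {k n : Globe} (h : k.dim < n.dim) (x y e e') :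
    map.app _ (C.str.comp h x y e) = D.str.comp h (map.app _ x) (map.app _ y) e'

@[ext] lemma Hom.ext {C D : OmegaCat.{v}} {f g : Hom C D} (h : f.map = g.map) : f = g := by
  cases f; cases g; cases h; rfl

instance : Category.{v} OmegaCat.{v} where
  Hom := Hom
  id C := ⟨𝟙 _, fun _ _ => rfl, fun _ _ _ _ _ => rfl⟩
  comp f g := ⟨f.map ≫ g.map,
    fun h x => (congrArg (g.map.app _) (f.map_idn h x)).trans (g.map_idn h _),
    fun h x y e e' => by
      have e'' := (app_bd f.map true h x).symm.trans
        ((congrArg (f.map.app _) e).trans (app_bd f.map false h y))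
      exact (congrArg (g.map.app _) (f.map_comp h x y e e'')).trans (g.map_comp h _ _ e'' e')⟩

/-- The underlying globular set of a strict `ω`-category. -/
def forget : OmegaCat.{v} ⥤ Glob.{v} where
  obj C := C.X
  map f := f.map

/-! The free strict `ω`-category on a globular set `X` consists of the families of cells, indexed by
all morphisms from `X` to strict `ω`-categories, which are generated by the cells of `X`. -/

variable (X : Glob.{v})

/-- The morphisms from `X` to strict `ω`-categories. -/
abbrev Idx : Type (v + 1) := (C : OmegaCat.{v}) × (X ⟶ C.X)

abbrev Fam (n : Globe) : Type (v + 1) := ∀ i : Idx X, i.1.X.cell n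

variable {X}

/-- The families generated by the cells of `X`. -/
inductive Gen : ∀ {n : Globe}, Fam X n → Prop
  | cell {n : Globe} (x : X.cell n) : Gen fun i => i.2.app _ x
  | idn {k n : Globe} (h : k.dim < n.dim) (p : Fam X k) (hp : Gen p) :
      Gen fun i => i.1.str.idn h (p i)
  | comp {k n : Globe} (h : k.dim < n.dim) (p q : Fam X n)
      (e : ∀ i, bd true h (p i) = bd false h (q i)) (hp : Gen p) (hq : Gen q) :
      Gen fun i => i.1.str.comp h (p i) (q i) (e i)

lemma Gen.bd {n : Globe} {p : Fam X n} (hp : Gen p) (b : Bool) {m : Globe} (h : m.dim < n.dim) :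
    Gen fun i => bd b h (p i) := by
  induction hp with
  | cell x =>
    have := Gen.cell (Glob.bd b h x)
    simpa only [app_bd] using this
  | @idn k n h' p hp ih =>
    rcases lt_trichotomy m.dim k.dim with hm | hm | hm
    · have : (fun i : Idx X => Glob.bd b h (i.1.str.idn h' (p i))) = fun i => Glob.bd b hm (p i) := by
        funext i
        rw [← bd_bd b b hm h', i.1.str.bd_idn]
      rw [this]
      exact ih hm
    · obtain rfl : m = k := Globe.ext hm
      simpa only [OmegaStr.bd_idn] using hp
    · have : (fun i : Idx X => Glob.bd b h (i.1.str.idn h' (p i))) = fun i => i.1.str.idn hm (p i) := by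
        funext i
        rw [← i.1.str.idn_idn hm h, i.1.str.bd_idn]
      rw [this]
      exact Gen.idn hm p hp
  | @comp k n h' p q e hp hq ihp ihq =>
    rcases lt_trichotomy m.dim k.dim with hm | hm | hm
    · have : (fun i : Idx X => Glob.bd b h (i.1.str.comp h' (p i) (q i) (e i))) =
          fun i => Glob.bd b h (p i) := by
        funext i
        rw [← bd_bd b false hm h', i.1.str.src_comp, bd_bd]
      rw [this]
      exact ihp h
    · obtain rfl : m = k := Globe.ext hm
      cases b
      · simpa only [OmegaStr.src_comp] using ihp h
      · simpa only [OmegaStr.tgt_comp] using ihq h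
    · have e' (i : Idx X) : Glob.bd true hm (Glob.bd b h (p i)) =
          Glob.bd false hm (Glob.bd b h (q i)) := by
        rw [bd_bd, bd_bd]
        exact e i
      have : (fun i : Idx X => Glob.bd b h (i.1.str.comp h' (p i) (q i) (e i))) =
          fun i => i.1.str.comp hm (Glob.bd b h (p i)) (Glob.bd b h (q i)) (e' i) := by
        funext i
        exact i.1.str.bd_comp b hm h _ _ _ _
      rw [this]
      exact Gen.comp hm _ _ e' (ihp h) (ihq h)

lemma Gen.map {n : Globe} {p : Fam X n} (hp : Gen p) {m : Globe} (f : m ⟶ n) :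
    Gen (n := m) fun i => i.1.X.map f.op (p i) := by
  rcases Globe.hom_cases f with ⟨rfl, rfl⟩ | ⟨b, h, rfl⟩
  · have : (fun i : Idx X => i.1.X.map (eqToHom (Eq.refl m)).op (p i)) = p := by
      funext i
      exact ConcreteCategory.congr_hom (i.1.X.map_id _) (p i)
    rwa [this]
  · exact hp.bd b h

variable (X) in
/-- Formal composites of cells of `X`. -/
inductive Raw : Globe → Type v
  | cell {n : Globe} (x : X.cell n) : Raw n
  | idn {k n : Globe} (h : k.dim < n.dim) (r : Raw k) : Raw n
  | comp {k n : Globe} (h : k.dim < n.dim) (r r' : Raw n) : Raw n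

open Classical in
noncomputable def Raw.eval : ∀ {n : Globe}, Raw X n → Fam X n
  | _, cell x => fun i => i.2.app _ x
  | _, idn h r => fun i => i.1.str.idn h (r.eval i)
  | _, comp h r r' =>
    if e : ∀ i, bd true h (r.eval i) = bd false h (r'.eval i) then
      fun i => i.1.str.comp h (r.eval i) (r'.eval i) (e i)
    else r.eval

lemma Gen.exists_raw {n : Globe} {p : Fam X n} (hp : Gen p) : ∃ r : Raw X n, r.eval = p := by
  induction hp with
  | cell x => exact ⟨.cell x, rfl⟩
  | idn h p hp ih =>
    obtain ⟨r, rfl⟩ := ih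
    exact ⟨.idn h r, rfl⟩
  | comp h p q e hp hq ihp ihq =>
    obtain ⟨r, rfl⟩ := ihp
    obtain ⟨r', rfl⟩ := ihq
    exact ⟨.comp h r r', dif_pos e⟩

instance (n : Globe) : Small.{v} {p : Fam X n // Gen p} :=
  small_of_injective (β := Raw X n) (f := fun p => p.2.exists_raw.choose) fun p q e =>
    Subtype.ext (p.2.exists_raw.choose_spec.symm.trans
      ((congrArg Raw.eval e).trans q.2.exists_raw.choose_spec))

variable (X) in
/-- The underlying globular set of the free strict `ω`-category on `X`. -/
noncomputable def freeGlob : Glob.{v} where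
  obj n := Shrink.{v} {p : Fam X n.unop // Gen p}
  map f := ↾fun x => equivShrink _ ⟨fun i => i.1.X.map f (((equivShrink _).symm x).1 i),
    ((equivShrink _).symm x).2.map f.unop⟩
  map_id n := by
    ext x
    simp
  map_comp f g := by
    ext x
    simp

noncomputable def val {n : Globe} (x : (freeGlob X).cell n) : Fam X n :=
  ((equivShrink {p : Fam X n // Gen p}).symm x).1

noncomputable def ofFam {n : Globe} (p : Fam X n) (hp : Gen p) : (freeGlob X).cell n :=
  equivShrink {p : Fam X n // Gen p} ⟨p, hp⟩

lemma val_ofFam {n : Globe} (p : Fam X n) (hp : Gen p) : val (ofFam p hp) = p := by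
  simp [val, ofFam]

lemma gen_val {n : Globe} (x : (freeGlob X).cell n) : Gen (val x) :=
  ((equivShrink {p : Fam X n // Gen p}).symm x).2

lemma val_inj {n : Globe} {x y : (freeGlob X).cell n} (h : ∀ i, val x i = val y i) : x = y :=
  (equivShrink {p : Fam X n // Gen p}).symm.injective (Subtype.ext (funext h))

lemma val_bd (b : Bool) {k n : Globe} (h : k.dim < n.dim) (x : (freeGlob X).cell n) (i : Idx X) :
    val (bd b h x) i = bd b h (val x i) :=
  congrFun (val_ofFam _ _) i

lemma val_match {k n : Globe} {h : k.dim < n.dim} {x y : (freeGlob X).cell n}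
    (e : bd true h x = bd false h y) (i : Idx X) : bd true h (val x i) = bd false h (val y i) := by
  rw [← val_bd, e, val_bd]

variable (X) in
/-- The free strict `ω`-category on `X`. -/
noncomputable def free : OmegaCat.{v} where
  X := freeGlob X
  str :=
    { idn := fun h x => ofFam (fun i => i.1.str.idn h (val x i)) (Gen.idn h _ (gen_val x))
      comp := fun h x y e => ofFam (fun i => i.1.str.comp h (val x i) (val y i) (val_match e i))
        (Gen.comp h _ _ _ (gen_val x) (gen_val y))
      bd_idn := fun b _ _ h x => val_inj fun i => by
        simp only [val_bd, val_ofFam, OmegaStr.bd_idn]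
      idn_idn := fun h h' x => val_inj fun i => by
        simp only [val_ofFam, OmegaStr.idn_idn]
      src_comp := fun h x y e => val_inj fun i => by
        simp only [val_bd, val_ofFam, OmegaStr.src_comp]
      tgt_comp := fun h x y e => val_inj fun i => by
        simp only [val_bd, val_ofFam, OmegaStr.tgt_comp]
      bd_comp := fun b _ _ _ h h' x y e e' => val_inj fun i => by
        simp only [val_bd, val_ofFam]
        exact i.1.str.bd_comp b h h' _ _ _ _
      id_comp := fun h x e => val_inj fun i => by
        simp only [val_bd, val_ofFam, OmegaStr.id_comp]
      comp_id := fun h x e => val_inj fun i => by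
        simp only [val_bd, val_ofFam, OmegaStr.comp_id]
      assoc := fun h x y z e e₁ e₂ e₃ => val_inj fun i => by
        simp only [val_ofFam]
        exact i.1.str.assoc h _ _ _ _ _ _ _
      interchange := fun h h' x y x' y' e₁ e₂ e₃ e₄ e₅ e₆ => val_inj fun i => by
        simp only [val_ofFam]
        exact i.1.str.interchange h h' _ _ _ _ _ _ _ _ _ _
      idn_comp := fun h h' x y e e' => val_inj fun i => by
        simp only [val_ofFam]
        exact i.1.str.idn_comp h h' _ _ _ _ }

lemma val_map {m n : Globe} (f : m ⟶ n) (x : (freeGlob X).cell n) (i : Idx X) :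
    val (n := m) ((freeGlob X).map f.op x) i = i.1.X.map f.op (val x i) :=
  congrFun (val_ofFam (n := m) (fun i => i.1.X.map f.op (val x i)) ((gen_val x).map f)) i

/-- The inclusion of generators. -/
noncomputable def unit (X : Glob.{v}) : X ⟶ (free X).X where
  app n := ↾fun x => ofFam (n := n.unop) (fun i => i.2.app _ x) (Gen.cell x)
  naturality m n f := by
    ext x
    refine val_inj (n := n.unop) fun i => ?_
    refine Eq.trans ?_ (val_map f.unop (ofFam (n := m.unop) (fun i => i.2.app _ x) (Gen.cell x)) i).symm
    refine (congrFun (val_ofFam (n := n.unop) _ _) i).trans ?_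
    refine Eq.trans ?_ (congrArg (i.1.X.map f) (congrFun (val_ofFam (n := m.unop) _ _) i).symm)
    exact ConcreteCategory.congr_hom (i.2.naturality f) x

/-- The extension of a morphism to the free strict `ω`-category. -/
noncomputable def extend {C : OmegaCat.{v}} (f : X ⟶ C.X) : free X ⟶ C where
  map :=
    { app := fun n => ↾fun x => val (n := n.unop) x ⟨C, f⟩
      naturality := fun m n g => by
        ext x
        exact val_map (n := m.unop) g.unop x ⟨C, f⟩ }
  map_idn h x := congrFun (val_ofFam _ _) _
  map_comp h x y e e' := congrFun (val_ofFam _ _) _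

lemma val_unit {n : Globe} (x : X.cell n) (i : Idx X) :
    val ((unit X).app _ x) i = i.2.app _ x :=
  congrFun (val_ofFam _ (Gen.cell x)) i

lemma free_hom_eq {C : OmegaCat.{v}} (g : free X ⟶ C) {n : Globe} (p : Fam X n) (hp : Gen p) :
    g.map.app _ (ofFam p hp) = p ⟨C, unit X ≫ g.map⟩ := by
  induction hp with
  | cell x => rfl
  | idn h p hp ih =>
    have h1 : ofFam _ (Gen.idn h p hp) = (free X).str.idn h (ofFam p hp) :=
      val_inj fun i => by
        refine (congrFun (val_ofFam _ _) i).trans (Eq.trans ?_ (congrFun (val_ofFam _ _) i).symm)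
        rw [val_ofFam]
    rw [h1]
    exact (g.map_idn h _).trans (congrArg _ ih)
  | comp h p q e hp hq ihp ihq =>
    have e' : bd true h (ofFam p hp) = bd false h (ofFam q hq) := val_inj fun i => by
      rw [val_bd, val_bd, val_ofFam, val_ofFam, e]
    have h1 : ofFam _ (Gen.comp h p q e hp hq) = (free X).str.comp h (ofFam p hp) (ofFam q hq) e' :=
      val_inj fun i => by
        refine (congrFun (val_ofFam _ _) i).trans (Eq.trans ?_ (congrFun (val_ofFam _ _) i).symm)
        simp only [val_ofFam]
    rw [h1]
    have e'' := (app_bd g.map true h (ofFam p hp)).symm.trans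
      ((congrArg (g.map.app _) e').trans (app_bd g.map false h (ofFam q hq)))
    refine (g.map_comp h _ _ e' e'').trans ?_
    simp only [ihp, ihq]

/-- Strict `ω`-functors out of the free strict `ω`-category. -/
noncomputable def freeEquiv (X : Glob.{v}) (C : OmegaCat.{v}) : (free X ⟶ C) ≃ (X ⟶ forget.obj C) where
  toFun g := unit X ≫ g.map
  invFun f := extend f
  left_inv g := by
    refine Hom.ext ?_
    ext n x
    have h1 := free_hom_eq g (n := n.unop) _ (gen_val x)
    have h2 : ofFam (n := n.unop) _ (gen_val x) = x := val_inj (n := n.unop) fun i => by rw [val_ofFam]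
    rw [h2] at h1
    exact h1.symm
  right_inv f := by
    ext n x
    exact val_unit (n := n.unop) x ⟨C, f⟩

/-- The monad on globular sets whose algebras are strict `ω`-categories. -/
noncomputable def monad : Monad Glob.{v} :=
  (Adjunction.adjunctionOfEquivLeft (G := forget) freeEquiv fun _ _ _ _ _ => rfl).toMonad

end OmegaCat

/-! ### Operads and multitensors in the case `n = ∞` -/

section

namespace Globe

lemma hom_ne {m n : ℕ} (f : (⟨m⟩ : Globe) ⟶ ⟨n⟩) (h : n < m) : False := by
  rcases f.2 with ⟨_, h'⟩ | ⟨_, h'⟩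
  · have := congrArg dim h'
    simp only at this
    omega
  · simp only at h'
    omega

lemma hom_eq_none {m : ℕ} (f : (⟨m⟩ : Globe) ⟶ ⟨m⟩) : f.1 = none := by
  rcases f.2 with ⟨h, _⟩ | ⟨_, h'⟩
  · exact h
  · exact absurd h' (lt_irrefl _)

lemma hom_ne_none {m n : ℕ} (f : (⟨m⟩ : Globe) ⟶ ⟨n⟩) (h : m < n) : f.1 ≠ none := by
  rcases f.2 with ⟨_, h'⟩ | ⟨h', _⟩
  · have := congrArg dim h'
    simp only at this
    omega
  · exact h'

lemma dim_le {m n : Globe} (f : m ⟶ n) : m.dim ≤ n.dim := by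
  rcases f.2 with ⟨_, h⟩ | ⟨_, h⟩
  · exact le_of_eq (congrArg dim h)
  · exact h.le

/-- The morphism `m ⟶ n` of the same kind as a given morphism `m + 1 ⟶ n + 1`. -/
def unshift {m n : ℕ} (f : (⟨m + 1⟩ : Globe) ⟶ ⟨n + 1⟩) : (⟨m⟩ : Globe) ⟶ ⟨n⟩ :=
  ⟨f.1, f.2.imp (fun h => ⟨h.1, Globe.ext (Nat.succ_injective (congrArg dim h.2))⟩)
    (fun h => ⟨h.1, Nat.lt_of_succ_lt_succ h.2⟩)⟩

end Globe

namespace Glob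

/-- The `n`-cells of a graph `X` enriched in globular sets, regarded as a globular set. -/
def graphCell (X : VGraph Glob.{v}) : ℕ → Type v
  | 0 => X.Obj
  | n + 1 => (a : X.Obj) × (b : X.Obj) × (X.hom a b).cell ⟨n⟩

/-- The boundaries of the `n`-cells of a graph enriched in globular sets. -/
def graphBd (X : VGraph Glob.{v}) : ∀ {m n : ℕ}, ((⟨m⟩ : Globe) ⟶ ⟨n⟩) → graphCell X n → graphCell X m
  | 0, 0, _, x => x
  | 0, _ + 1, f, x => if f.1 = some true then x.2.1 else x.1
  | _ + 1, _ + 1, f, x => ⟨x.1, x.2.1, (X.hom x.1 x.2.1).map (Globe.unshift f).op x.2.2⟩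
  | _ + 1, 0, f, _ => (Globe.hom_ne f (Nat.succ_pos _)).elim

lemma graphBd_id (X : VGraph Glob.{v}) (n : ℕ) (x : graphCell X n) :
    graphBd X (𝟙 (⟨n⟩ : Globe)) x = x := by
  cases n with
  | zero => rfl
  | succ n =>
    obtain ⟨a, b, x⟩ := x
    exact congrArg (fun y => (⟨a, b, y⟩ : graphCell X (n + 1)))
      (ConcreteCategory.congr_hom ((X.hom a b).map_id (Opposite.op (⟨n⟩ : Globe))) x)

lemma graphBd_comp (X : VGraph Glob.{v}) {l m n : ℕ} (f : (⟨l⟩ : Globe) ⟶ ⟨m⟩)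
    (g : (⟨m⟩ : Globe) ⟶ ⟨n⟩) (x : graphCell X n) :
    graphBd X (f ≫ g) x = graphBd X f (graphBd X g x) := by
  have hfg : (f ≫ g).1 = f.1.or g.1 := rfl
  rcases l with _ | l <;> rcases m with _ | m <;> rcases n with _ | n
  · rfl
  · simp only [graphBd, hfg, Globe.hom_eq_none f, Option.none_or]
  · exact (Globe.hom_ne g (Nat.succ_pos _)).elim
  · obtain ⟨b, hb⟩ := Option.ne_none_iff_exists'.mp (Globe.hom_ne_none f (Nat.succ_pos _))
    simp only [graphBd, hfg, hb, Option.some_or]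
  · exact (Globe.hom_ne f (Nat.succ_pos _)).elim
  · exact (Globe.hom_ne f (Nat.succ_pos _)).elim
  · exact (Globe.hom_ne g (Nat.succ_pos _)).elim
  · obtain ⟨a, b, x⟩ := x
    exact congrArg (fun y => (⟨a, b, y⟩ : graphCell X (l + 1))) (ConcreteCategory.congr_hom
      ((X.hom a b).map_comp (Globe.unshift g).op (Globe.unshift f).op) x)

/-- A graph enriched in globular sets, regarded as a globular set. -/
def ofGraph (X : VGraph Glob.{v}) : Glob.{v} where
  obj n := graphCell X n.unop.dim
  map f := ↾(graphBd X f.unop)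
  map_id n := by
    ext x
    exact graphBd_id X n.unop.dim x
  map_comp f g := by
    ext x
    exact graphBd_comp X g.unop f.unop x

/-- The action on cells of a morphism of graphs enriched in globular sets. -/
def graphMap {X Y : VGraph Glob.{v}} (f : X ⟶ Y) : ∀ n, graphCell X n → graphCell Y n
  | 0, x => f.obj x
  | _ + 1, x => ⟨f.obj x.1, f.obj x.2.1, (f.map x.1 x.2.1).app _ x.2.2⟩

lemma graphMap_bd {X Y : VGraph Glob.{v}} (f : X ⟶ Y) {m n : ℕ} (g : (⟨m⟩ : Globe) ⟶ ⟨n⟩)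
    (x : graphCell X n) : graphMap f m (graphBd X g x) = graphBd Y g (graphMap f n x) := by
  rcases m with _ | m <;> rcases n with _ | n
  · rfl
  · exact apply_ite f.obj _ _ _
  · exact (Globe.hom_ne g (Nat.succ_pos _)).elim
  · obtain ⟨a, b, x⟩ := x
    exact congrArg (fun y => (⟨f.obj a, f.obj b, y⟩ : graphCell Y (m + 1)))
      (ConcreteCategory.congr_hom ((f.map a b).naturality (Globe.unshift g).op) x)

/-- The identification of graphs enriched in globular sets with globular sets. -/
def fromGraph : VGraph Glob.{v} ⥤ Glob.{v} where
  obj := ofGraph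
  map f :=
    { app := fun n => ↾(graphMap f n.unop.dim)
      naturality := fun m n g => by
        ext x
        exact graphMap_bd f (m := n.unop.dim) (n := m.unop.dim) g.unop x }
  map_id X := by
    ext ⟨⟨n⟩⟩ x
    cases n <;> rfl
  map_comp f g := by
    ext ⟨⟨n⟩⟩ x
    cases n <;> rfl

/-- The `k`-globe, i.e. the representable globular set. -/
def globe (k : Globe) : Glob.{v} where
  obj n := ULift (n.unop ⟶ k)
  map f := ↾fun x => ⟨f.unop ≫ x.down⟩

/-- The `k`-globe with its unique `k`-cell removed. -/
def globeBoundary (k : Globe) : Glob.{v} where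
  obj n := ULift {_f : n.unop ⟶ k // n.unop.dim < k.dim}
  map f := ↾fun x => ⟨f.unop ≫ x.down.1, lt_of_le_of_lt (Globe.dim_le f.unop) x.down.2⟩

/-- The inclusion `∂k ↪ k`. -/
def globeIncl (k : Globe) : globeBoundary.{v} k ⟶ globe k where
  app n := ↾fun x => ⟨x.down.1⟩

/-- The class `I_{≤∞}` of maps of globular sets. -/
inductive genInf : MorphismProperty Glob.{v}
  | mk (k : Globe) : genInf (globeIncl k)

end Glob

/-- A natural isomorphism `κ : Φ S ≅ T Φ` compatible with the structures of monads `S` on `C` and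
`T` on `D`. If `Φ` is an equivalence, it identifies the monads `S` and `T`. -/
structure MonadIsoAlong {C : Type*} [Category* C] {D : Type*} [Category* D] (Φ : C ⥤ D)
    (S : Monad C) (T : Monad D) where
  iso : S.toFunctor ⋙ Φ ≅ Φ ⋙ T.toFunctor
  unit : ∀ X, Φ.map (S.η.app X) ≫ iso.hom.app X = T.η.app (Φ.obj X)
  mult : ∀ X, Φ.map (S.μ.app X) ≫ iso.hom.app X =
    iso.hom.app (S.obj X) ≫ T.map (iso.hom.app X) ≫ T.μ.app (Φ.obj X)

/-- The monad `𝒯_{≤∞}` on globular sets, whose algebras are the strict `ω`-categories. -/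
noncomputable abbrev omegaMonad : Monad Glob.{v} := OmegaCat.monad

/-- A morphism of monads `α : A ⟶ 𝒯_{≤∞}` is an operad over `Set`: it is a cartesian
transformation, and its components are bijective on `0`-cells. -/
structure Glob.IsOperadOverSet {T A : Monad Glob.{v}} (α : A ⟶ T) : Prop where
  cartesian : NatTrans.Equifibered α.toNatTrans
  bijective : ∀ X, Function.Bijective ((α.app X).app (Opposite.op ⟨0⟩))

/-- The operad `α : A ⟶ 𝒯_{≤∞}` corresponds to the `𝒯_{≤∞}^×`-multitensor `ε : E ⟶ 𝒯_{≤∞}^×`: under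
the identification of graphs enriched in globular sets with globular sets, which identifies
`Γ(𝒯_{≤∞}^×)` with `𝒯_{≤∞}`, `α` is `Γε : ΓE ⟶ Γ(𝒯_{≤∞}^×)` up to an isomorphism of monads. -/
def CorrespondsInf {A : Monad Glob.{v}} (α : A ⟶ omegaMonad) {E : Multitensor Glob.{v}}
    (ε : Multitensor.Hom E (times omegaMonad)) : Prop :=
  ∃ (hE : E.IsDistributive) (hT : (times omegaMonad.{v}).IsDistributive)
    (κ : MonadIsoAlong Glob.fromGraph ((times omegaMonad.{v}).gamma hT) omegaMonad)
    (θ : MonadIsoAlong Glob.fromGraph (E.gamma hE) A),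
    ∀ X, θ.iso.hom.app X ≫ α.app (Glob.fromGraph.obj X) =
      Glob.fromGraph.map (ε.gammaMap.app X) ≫ κ.iso.hom.app X

end

/-! ### Coproducts and lifting properties -/

section

variable {V : Type u} [Category.{v} V]

/-! A component of Γψ, or of Γε, is the identity on objects. Between objects a and b it is the
coproduct, over the sequences a = x_0, …, x_n = b, of the components of ψ, or of ε, at X(x_0, x_1),
…, X(x_{n-1}, x_n). For Γψ this uses that H preserves coproducts, so that H∐ is again a coproduct.
Three observations then give the proposition.

Lifting against I⁺ is a condition on homs (`VGraph.rlp_plus_iff`). A map out of the graph 0 is an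
object, so lifting against ∅ → 0 is surjectivity on objects, which is clear here. A map out of (S)
is a pair of objects a, b with a map S → X(a, b), so lifting against (i) means that all hom maps
lift against i.

A coproduct of maps f_j lifts against I exactly when every f_j does (`rlp_coprod_iff`). The squares
from f_j to the coproduct are pullbacks, and lifting properties are stable under pullback.
Conversely, a map from a connected B to ∐ B_j factors through one B_j, and the pullback square turns
the lifting problem into one against f_j. Extensivity enters only through these pullback squares
(`HasCoprodPullbacks`).

Every finite sequence of objects is the sequence of homs along a path in some graph
(`VGraph.forall_homs`), so testing ψ or ε on homs of graphs tests all components.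

For the corollary the same argument is run on Γε. Coproduct squares are pullbacks in sets, in
globular sets, and in graphs over any category with an initial object. The codomains of the
generators stay connected, since (B) is connected when B is, and globes are connected by Yoneda. For
finite n the operad is Γε up to an isomorphism of monads, and I_{≤n+1} is (I_{≤n})⁺ by definition.
For n = ∞, `Glob.fromGraph` is an equivalence which sends ∅ → 0 to ∂0 ↪ 0 and the suspension of ∂k ↪
k to ∂(k+1) ↪ k+1, up to isomorphism. Hence it matches (I_{≤∞})⁺ with I_{≤∞}
(`Glob.rlp_fromGraph_map_iff`). -/

/-- For every family of morphisms `f j`, the squares from `f j` to the coproduct of the family are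
pullbacks. -/
def HasCoprodPullbacks (V : Type u) [Category.{v} V] : Prop :=
  ∀ ⦃J : Type v⦄ ⦃A B : J → V⦄ ⦃X Y : V⦄ (a : ∀ j, A j ⟶ X) (b : ∀ j, B j ⟶ Y)
    (f : ∀ j, A j ⟶ B j) (g : X ⟶ Y), IsCoprod a → IsCoprod b →
      (∀ j, a j ≫ g = f j ≫ b j) → ∀ j, IsPullback (a j) (f j) g (b j)

/-- Maps from B to a coproduct form the disjoint union of the sets of maps to the summands; this is
the surjectivity half. -/
lemma IsConnectedObj.exists_fac {B : V} (hB : IsConnectedObj B) {J : Type v} {A : J → V} {Z : V}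
    {c : ∀ j, A j ⟶ Z} (hc : IsCoprod c) (f : B ⟶ Z) : ∃ j, ∃ g : B ⟶ A j, g ≫ c j = f := by
  obtain ⟨⟨j, g⟩, h⟩ := (isCoprod_type_iff.mp (hB J A Z c hc)).2 f
  exact ⟨j, g, h⟩

/-- Each f_j is a pullback of g, which gives one direction. For the other, connectedness of the
codomain of i puts the bottom of a square inside one summand, the pullback puts the top there too,
and a lift against f_j followed by the inclusion solves the problem. -/
lemma rlp_coprod_iff (hV : HasCoprodPullbacks V) {I : MorphismProperty V}
    (hI : ∀ ⦃S B : V⦄ (i : S ⟶ B), I i → IsConnectedObj B) {J : Type v} {A B : J → V} {X Y : V}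
    {a : ∀ j, A j ⟶ X} {b : ∀ j, B j ⟶ Y} (ha : IsCoprod a) (hb : IsCoprod b)
    (f : ∀ j, A j ⟶ B j) (g : X ⟶ Y) (w : ∀ j, a j ≫ g = f j ≫ b j) :
    I.rlp g ↔ ∀ j, I.rlp (f j) := by
  have hp := hV a b f g ha hb w
  refine ⟨fun hg j => MorphismProperty.of_isPullback (hp j) hg, fun hf S T i hi => ⟨?_⟩⟩
  intro s t sq
  obtain ⟨j, t', rfl⟩ := (hI i hi).exists_fac hb t
  -- The top map and the factored bottom map agree in Y, so they induce a map into the pullback A_j.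
  have w' : s ≫ g = (i ≫ t') ≫ b j := by rw [sq.w, Category.assoc]
  have := hf j i hi
  have sq' : CommSq ((hp j).lift s (i ≫ t') w') i (f j) t' := ⟨(hp j).lift_snd _ _ _⟩
  exact CommSq.HasLift.mk' ⟨sq'.lift ≫ a j,
    by rw [← Category.assoc, sq'.fac_left, (hp j).lift_fst],
    by rw [Category.assoc, w, ← Category.assoc, sq'.fac_right]⟩

lemma IsPullback.of_lift {A B X Y : V} {a : A ⟶ X} {f : A ⟶ B} {g : X ⟶ Y} {b : B ⟶ Y}
    (w : a ≫ g = f ≫ b)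
    (H : ∀ (S : V) (s : S ⟶ X) (t : S ⟶ B), s ≫ g = t ≫ b → ∃ l : S ⟶ A, l ≫ a = s ∧ l ≫ f = t)
    (H' : ∀ (S : V) (l l' : S ⟶ A), l ≫ a = l' ≫ a → l ≫ f = l' ≫ f → l = l') :
    IsPullback a f g b :=
  ⟨⟨w⟩, ⟨PullbackCone.IsLimit.mk _ (fun s => (H _ _ _ s.condition).choose)
    (fun s => (H _ _ _ s.condition).choose_spec.1) (fun s => (H _ _ _ s.condition).choose_spec.2)
    fun s _ h h' => H' _ _ _ (h.trans (H _ _ _ s.condition).choose_spec.1.symm)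
      (h'.trans (H _ _ _ s.condition).choose_spec.2.symm)⟩⟩

lemma ι_coprodOver_hom [HasCoproducts.{v} V] {J : Type v} {B : J → V} (P : ∀ j, Over (B j)) (j : J) :
    Sigma.ι (fun k => (P k).left) j ≫ ((coprodOver B).obj P).hom = (P j).hom ≫ Sigma.ι B j :=
  Sigma.ι_map (fun k => (P k).hom) j

lemma ι_coprodOver_map [HasCoproducts.{v} V] {J : Type v} {B : J → V} {P Q : ∀ j, Over (B j)}
    (φ : P ⟶ Q) (j : J) : Sigma.ι (fun k => (P k).left) j ≫ ((coprodOver B).map φ).left =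
      (φ j).left ≫ Sigma.ι (fun k => (Q k).left) j :=
  Sigma.ι_map (fun k => (φ k).left) j

open Classical in
-- An object over B_j becomes a family over all the B_k when it is completed by initial objects, and
-- the coproduct of this family is the object itself. Fullness of `coprodOver` then produces the map
-- into the alleged pullback, and faithfulness makes it unique.
lemma IsExtensive.hasCoprodPullbacks [HasCoproducts.{v} V] (hV : IsExtensive V) :
    HasCoprodPullbacks V := by
  -- Coproduct cocones are unique up to isomorphism, so the chosen coproducts, on which `coprodOver`
  -- is defined, suffice.
  suffices H : ∀ (J : Type v) (A B : J → V) (f : ∀ j, A j ⟶ B j) (j : J),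
      IsPullback (Sigma.ι A j) (f j) (Limits.Sigma.map f) (Sigma.ι B j) by
    intro J A B X Y a b f g ha hb w j
    obtain ⟨e, he⟩ := ha.exists_iso (IsCoprod.sigma A)
    obtain ⟨e', he'⟩ := hb.exists_iso (IsCoprod.sigma B)
    refine (H J A B f j).of_iso (Iso.refl _) e.symm (Iso.refl _) e'.symm ?_ ?_ ?_ ?_
    · simp [← he]
    · simp
    · rw [Iso.symm_hom, Iso.symm_hom, Iso.comp_inv_eq, Category.assoc, Iso.eq_inv_comp]
      refine ha.hom_ext fun j => ?_
      rw [← Category.assoc, he, Sigma.ι_map, ← Category.assoc, w, Category.assoc, he']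
    · simp [← he']
  intro J A B f j
  -- The family P is S at the index j and initial at the other indices. So the j-th inclusion into ∐
  -- P is invertible, and a map out of P j extends to the whole family.
  have key (S : Over (B j)) : ∃ (P : ∀ k, Over (B k)) (e : S ⟶ P j), IsIso e ∧
      IsIso (Sigma.ι (fun k => (P k).left) j) ∧
        ∀ (F : ∀ k, Over (B k)) (m : P j ⟶ F j), ∃ φ : P ⟶ F, φ j = m := by
    let P (k : J) : Over (B k) :=
      if h : k = j then h ▸ S else Over.mk (initial.to (B k))
    have hj : S = P j := by simp [P]
    have hk (k : J) (h : k ≠ j) : Nonempty (IsInitial (P k).left) := by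
      have : P k = Over.mk (initial.to (B k)) := dif_neg h
      rw [this]
      exact ⟨initialIsInitial⟩
    refine ⟨P, eqToHom hj, inferInstance, ?_, fun F m => ?_⟩
    · let r : (∐ fun k => (P k).left) ⟶ (P j).left :=
        Sigma.desc fun k => if h : k = j then eqToHom (by rw [h]) else (hk k h).some.to _
      have hr : Sigma.ι (fun k => (P k).left) j ≫ r = 𝟙 _ := by simp [r]
      refine ⟨r, hr, Limits.Sigma.hom_ext _ _ fun k => ?_⟩
      by_cases h : k = j
      · subst h
        rw [← Category.assoc, hr, Category.id_comp, Category.comp_id]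
      · exact (hk k h).some.hom_ext _ _
    · refine ⟨fun k => if h : k = j then by subst h; exact m
        else Over.homMk ((hk k h).some.to _) ((hk k h).some.hom_ext _ _), ?_⟩
      simp
  have := hV J B
  let F (k : J) : Over (B k) := Over.mk (f k)
  refine IsPullback.of_lift (by simp) (fun S s t w => ?_) (fun S l l' h h' => ?_)
  -- Existence. Along the isomorphism i from S to ∐ P, the map s becomes a map ∐ P → ∐ A over ∐ B.
  -- By fullness it comes from a family of maps over the B_k, whose j-th member gives the lift.
  · obtain ⟨P, e, _, _, hP⟩ := key (Over.mk t)
    have : IsIso e.left := inferInstanceAs (IsIso ((Over.forget _).map e))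
    let i : S ⟶ _ := e.left ≫ Sigma.ι (fun k => (P k).left) j
    have : IsIso i := IsIso.comp_isIso
    have hi : i ≫ ((coprodOver B).obj P).hom = t ≫ Sigma.ι B j := by
      refine (Category.assoc _ _ _).trans ((congrArg (e.left ≫ ·) (ι_coprodOver_hom P j)).trans ?_)
      exact (Category.assoc _ _ _).symm.trans (congrArg (· ≫ _) (Over.w e))
    obtain ⟨r, hr⟩ : ∃ r : (∐ fun k => (P k).left) ⟶ ∐ A, i ≫ r = s :=
      ⟨inv i ≫ s, IsIso.hom_inv_id_assoc i s⟩
    have hr' : r ≫ Limits.Sigma.map f = ((coprodOver B).obj P).hom := by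
      refine (cancel_epi i).mp ((Category.assoc _ _ _).symm.trans ?_)
      rw [hr]
      exact w.trans hi.symm
    let ψ : (coprodOver B).obj P ⟶ (coprodOver B).obj F := Over.homMk r hr'
    obtain ⟨φ, hφ⟩ := (coprodOver B).map_surjective ψ
    refine ⟨e.left ≫ (φ j).left, ?_, ?_⟩
    · have h1 : ((coprodOver B).map φ).left = r := congrArg Over.Hom.left hφ
      have h2 : Sigma.ι (fun k => (P k).left) j ≫ ((coprodOver B).map φ).left =
          (φ j).left ≫ Sigma.ι A j := ι_coprodOver_map φ j
      rw [Category.assoc]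
      refine (congrArg (e.left ≫ ·) h2.symm).trans ?_
      rw [h1]
      exact (Category.assoc _ _ _).symm.trans hr
    · exact (Category.assoc _ _ _).trans ((congrArg (e.left ≫ ·) (Over.w (φ j))).trans (Over.w e))
  -- Uniqueness. Both candidates are maps to `f j` over `B j` from the same object, and they extend
  -- to families φ and φ'. Faithfulness reduces φ = φ' to an equality of maps out of ∐ P. This can
  -- be tested on the j-th summand, whose inclusion is invertible, and there it is the hypothesis
  -- `h`.
  · obtain ⟨P, e, _, _, hP⟩ := key (Over.mk (l ≫ f j))
    have : IsIso e.left := inferInstanceAs (IsIso ((Over.forget _).map e))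
    let m : Over.mk (l ≫ f j) ⟶ F j := Over.homMk l
    let m' : Over.mk (l ≫ f j) ⟶ F j := Over.homMk l' h'.symm
    obtain ⟨φ, hφ⟩ := hP F (inv e ≫ m)
    obtain ⟨φ', hφ'⟩ := hP F (inv e ≫ m')
    suffices φ = φ' by
      rw [← this, hφ, cancel_epi] at hφ'
      exact congrArg Over.Hom.left hφ'
    refine (coprodOver B).map_injective (Over.OverMorphism.ext ?_)
    refine (cancel_epi (Sigma.ι (fun k => (P k).left) j)).mp ?_
    refine (ι_coprodOver_map φ j).trans (Eq.trans ?_ (ι_coprodOver_map φ' j).symm)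
    have he := congrArg (e.left ≫ ·) (congrArg Over.Hom.left hφ)
    have he' := congrArg (e.left ≫ ·) (congrArg Over.Hom.left hφ')
    have h1 (n : Over.mk (l ≫ f j) ⟶ F j) : e.left ≫ (inv e ≫ n).left = n.left := by
      rw [← Over.comp_left, IsIso.hom_inv_id_assoc]
    refine (cancel_epi e.left).mp ?_
    refine (Category.assoc _ _ _).symm.trans (Eq.trans ?_ (Category.assoc _ _ _))
    refine (congrArg (· ≫ _) (he.trans (h1 m))).trans (Eq.trans ?_
      (congrArg (· ≫ _) (he'.trans (h1 m'))).symm)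
    exact h

/-! ### Coproduct squares in graphs, sets and globular sets -/

/-- Coproducts of graphs are disjoint unions with initial homs between different parts, so the
pullback is decided on objects; no exactness property of the enriching category enters. -/
lemma VGraph.hasCoprodPullbacks [HasInitial V] : HasCoprodPullbacks (VGraph V) := by
  intro J A B X Y a b f g ha hb w j
  rw [isCoprod_iff_decomp] at ha hb
  have hinj (j : J) : Function.Injective (a j).obj :=
    fun x y e => eq_of_heq (Sigma.mk.inj (ha.inj e)).2
  have hw (j : J) (x) : g.obj ((a j).obj x) = (b j).obj ((f j).obj x) :=
    congrFun (congrArg Hom.obj (w j)) x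
  -- The inclusion of a part is injective on objects and invertible on homs, hence a monomorphism;
  -- likewise for `a` below.
  have hb' (j : J) : Mono (b j) := ⟨fun {S} p q h => by
    have h0 (x) : p.obj x = q.obj x :=
      eq_of_heq (Sigma.mk.inj (hb.inj (congrFun (congrArg Hom.obj h) x))).2
    refine hom_ext h0 fun x y => ?_
    have := hb.iso j (q.obj x) (q.obj y)
    rw [← cancel_mono ((b j).map _ _), Category.assoc, cast_map, ← Category.assoc]
    exact map_congr h x y⟩
  have ha' (j : J) : Mono (a j) := ⟨fun {S} p q h => by
    have h0 (x) : p.obj x = q.obj x :=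
      eq_of_heq (Sigma.mk.inj (ha.inj (congrFun (congrArg Hom.obj h) x))).2
    refine hom_ext h0 fun x y => ?_
    have := ha.iso j (q.obj x) (q.obj y)
    rw [← cancel_mono ((a j).map _ _), Category.assoc, cast_map, ← Category.assoc]
    exact map_congr h x y⟩
  refine IsPullback.of_lift (w j) (fun S s t h => ?_)
    (fun S l l' h _ => (cancel_mono (a j)).mp h)
  -- An object of part k of X is sent by g to part k of Y. As g (s x) equals the image of t x, which
  -- lies in part j, the object s x lies in part j.
  have h0 (x : S.Obj) : ∃ y, (a j).obj y = s.obj x := by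
    obtain ⟨⟨k, y⟩, hy⟩ := ha.bij.2 (s.obj x)
    have h1 : g.obj (s.obj x) = (b j).obj (t.obj x) := congrFun (congrArg Hom.obj h) x
    rw [← hy, hw] at h1
    obtain rfl := (Sigma.mk.inj (hb.inj h1)).1
    exact ⟨y, hy⟩
  choose l₀ hl₀ using h0
  have := ha.iso j
  let l : S ⟶ A j := ⟨l₀, fun x y => s.map x y ≫ X.cast (hl₀ x).symm (hl₀ y).symm ≫
    inv ((a j).map (l₀ x) (l₀ y))⟩
  have hl : l ≫ a j = s := hom_ext hl₀ fun x y => by simp [l]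
  -- The triangle over B j holds after composition with the monomorphism b j.
  refine ⟨l, hl, (cancel_mono (b j)).mp ?_⟩
  rw [Category.assoc, ← w, ← Category.assoc, hl, h]

lemma hasCoprodPullbacks_type : HasCoprodPullbacks (Type v) := by
  intro J A B X Y a b f g ha hb w j
  rw [isCoprod_type_iff] at ha hb
  have hw (j : J) (x) : g (a j x) = b j (f j x) := ConcreteCategory.congr_hom (w j) x
  rw [Types.isPullback_iff]
  refine ⟨w j, fun x y h => ?_, fun x y h => ?_⟩
  · exact eq_of_heq (Sigma.mk.inj (ha.1 (a₁ := ⟨j, x⟩) (a₂ := ⟨j, y⟩) h.1)).2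
  · obtain ⟨⟨k, z⟩, rfl⟩ := ha.2 x
    have h1 : b k (f k z) = b j y := (hw k z).symm.trans h
    have h2 := hb.1 (a₁ := ⟨k, f k z⟩) (a₂ := ⟨j, y⟩) h1
    obtain ⟨rfl, h3⟩ := Sigma.mk.inj h2
    exact ⟨z, rfl, eq_of_heq h3⟩

end

/-- Coproducts and pullbacks of presheaves are computed pointwise, which reduces the claim to sets.
-/
lemma Glob.hasCoprodPullbacks : HasCoprodPullbacks Glob.{v} := by
  intro J A B X Y a b f g ha hb w j
  refine IsPullback.of_forall_isPullback_app fun n => ?_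
  exact hasCoprodPullbacks_type _ _ (fun j => (f j).app n) (g.app n)
    (ha.map ((evaluation _ _).obj n)) (hb.map ((evaluation _ _).obj n))
    (fun j => NatTrans.congr_app (w j) n) j

/-! ### Lifting properties of morphisms of graphs -/

namespace VGraph

variable {V : Type u} [Category.{v} V]

section

variable [HasInitial V]

/-- The morphism `(S) ⟶ X` given by two objects of `X` and a morphism to the hom between them. -/
noncomputable def suspDesc {X : VGraph V} {S : V} (a b : X.Obj) (s : S ⟶ X.hom a b) :
    susp S ⟶ X where
  obj z := cond z.down b a
  map
    | ⟨false⟩, ⟨true⟩ => s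
    | ⟨false⟩, ⟨false⟩ => initial.to _
    | ⟨true⟩, ⟨false⟩ => initial.to _
    | ⟨true⟩, ⟨true⟩ => initial.to _

/-- The homs of (S) other than the one from the first object to the second are initial, so nothing
needs to be compared there. -/
lemma susp_hom_ext {X : VGraph V} {S : V} {f g : susp S ⟶ X} (h : ∀ z, f.obj z = g.obj z)
    (h' : f.map ⟨false⟩ ⟨true⟩ ≫ X.cast (h _) (h _) = g.map ⟨false⟩ ⟨true⟩) : f = g := by
  refine hom_ext h ?_
  rintro ⟨_ | _⟩ ⟨_ | _⟩
  · exact initialIsInitial.hom_ext _ _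
  · exact h'
  · exact initialIsInitial.hom_ext _ _
  · exact initialIsInitial.hom_ext _ _

/-- A map from 0 to a graph is just an object of it, because the only hom of 0 is initial. -/
lemma rlp_emptyTo_iff {X Y : VGraph V} (f : X ⟶ Y) :
    HasLiftingProperty (emptyTo (point V)) f ↔ Function.Surjective f.obj := by
  have uniq {Z : VGraph V} (p q : empty V ⟶ Z) : p = q :=
    hom_ext (fun a => a.elim) fun a _ => a.elim
  refine ⟨fun h y => ?_, fun h => ⟨fun {s t} _ => ?_⟩⟩
  · let t : point V ⟶ Y := ⟨fun _ => y, fun _ _ => initial.to _⟩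
    have sq : CommSq (emptyTo X) (emptyTo (point V)) f t := ⟨uniq _ _⟩
    exact ⟨sq.lift.obj ⟨⟩, congrFun (congrArg Hom.obj sq.fac_right) _⟩
  · obtain ⟨x, hx⟩ := h (t.obj ⟨⟩)
    exact CommSq.HasLift.mk' ⟨⟨fun _ => x, fun _ _ => initial.to _⟩, uniq _ _,
      hom_ext (fun _ => hx) fun _ _ => initialIsInitial.hom_ext _ _⟩

/-- Since (i) is the identity on objects, a square from (i) to f is a pair of objects a, b of X with
a square from i to the hom map of f at (a, b), and lifts correspond to lifts. -/
lemma rlp_suspMap_iff {X Y : VGraph V} (f : X ⟶ Y) {S B : V} (i : S ⟶ B) :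
    HasLiftingProperty (suspMap i) f ↔ ∀ a b, HasLiftingProperty i (f.map a b) := by
  refine ⟨fun h a b => ⟨fun {s t} sq => ?_⟩, fun h => ⟨fun {s t} sq => ?_⟩⟩
  · have hf (z : Bool) : f.obj (cond z b a) = cond z (f.obj b) (f.obj a) := by cases z <;> rfl
    have sq' : CommSq (suspDesc a b s) (suspMap i) f (suspDesc (f.obj a) (f.obj b) t) :=
      ⟨susp_hom_ext (fun z => hf z.down) ((Category.comp_id _).trans sq.w)⟩
    obtain ⟨l, hl, hl'⟩ := (h.sq_hasLift sq').exists_lift.some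
    -- The upper triangle forces the lift to have endpoints a and b, but only up to a propositional
    -- equality. Its map on the hom is therefore transported along `X.cast`.
    have h0 (z) : l.obj z = cond z.down b a :=
      congrFun (congrArg Hom.obj hl) z
    have h1 := map_congr hl ⟨false⟩ ⟨true⟩
    have h2 := map_congr hl' ⟨false⟩ ⟨true⟩
    refine CommSq.HasLift.mk' ⟨l.map ⟨false⟩ ⟨true⟩ ≫ X.cast (h0 _) (h0 _), ?_, ?_⟩
    · exact (Category.assoc _ _ _).symm.trans h1
    · refine (Category.assoc _ _ _).trans ((congrArg (_ ≫ ·) (cast_map f _ _)).trans ?_)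
      exact (Category.assoc _ _ _).symm.trans h2
  -- On objects the bottom map is f after s, so that its hom component can be read as a map into the
  -- codomain of a hom map of f.
  · obtain ⟨t₀, t₁⟩ := t
    obtain rfl : f.obj ∘ s.obj = t₀ := congrArg Hom.obj sq.w
    have w := map_congr sq.w ⟨false⟩ ⟨true⟩
    have sq' : CommSq (s.map ⟨false⟩ ⟨true⟩) i (f.map _ _) (t₁ ⟨false⟩ ⟨true⟩) :=
      ⟨(Category.comp_id _).symm.trans w⟩
    obtain ⟨l, hl, hl'⟩ := ((h _ _).sq_hasLift sq').exists_lift.some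
    have hb (z : Bool) : cond z (s.obj ⟨true⟩) (s.obj ⟨false⟩) = s.obj ⟨z⟩ := by cases z <;> rfl
    refine CommSq.HasLift.mk' ⟨suspDesc _ _ l, ?_, ?_⟩
    · exact susp_hom_ext (fun z => hb z.down) ((Category.comp_id _).trans hl)
    · exact susp_hom_ext (fun z => congrArg f.obj (hb z.down))
        ((Category.comp_id _).trans hl')

lemma rlp_plus_iff (I : MorphismProperty V) {X Y : VGraph V} (f : X ⟶ Y)
    (hf : Function.Surjective f.obj) : (plus I).rlp f ↔ ∀ a b, I.rlp (f.map a b) := by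
  refine ⟨fun h a b S B i hi => (rlp_suspMap_iff f i).mp (h _ (plus.susp i hi)) a b, fun h => ?_⟩
  rintro _ _ _ (_ | ⟨i, hi⟩)
  · exact (rlp_emptyTo_iff f).mpr hf
  · exact (rlp_suspMap_iff f i).mpr fun a b => h a b i hi

/-- Every sequence of objects is the sequence of homs along a sequence of objects of a graph. -/
lemma forall_homs {P : ∀ n, (Fin n → V) → Prop}
    (h : ∀ (X : VGraph V) (a b : X.Obj) (x : SeqFrom a b), P x.1.len (X.homs x.1))
    (n : ℕ) (Z : Fin n → V) : P n Z := by
  -- The path 0 → 1 → … → n, with the entries of Z as homs between consecutive vertices. The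
  -- vertices are distinct, so repeated or unrelated entries do not interfere.
  let X : VGraph V := ⟨ULift (Fin (n + 1)), fun a b =>
    if h : a.down.val + 1 = b.down.val then Z ⟨a.down.val, by omega⟩ else ⊥_ V⟩
  let x : ObjSeq X.Obj := ⟨n, fun l => ⟨l⟩⟩
  have e : X.homs x = Z := funext fun i => by simp [homs, X, x]
  have := h X _ _ ⟨x, rfl, rfl⟩
  change P n (X.homs x) at this
  rwa [e] at this

end

end VGraph

/-! ### Lifting properties of `Γψ` and `Γε` -/

section

variable {V : Type u} [Category.{v} V] [HasCoproducts.{v} V]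

/-- Γε is the identity on objects and a coproduct of components of ε on homs, so lifting against I⁺
splits into lifting of these components against I. All components occur, by `VGraph.forall_homs`. -/
lemma Multitensor.Hom.rlp_gammaMap_iff (hV : HasCoprodPullbacks V) {E F : Multitensor V}
    (ε : Multitensor.Hom E F) {I : MorphismProperty V}
    (hI : ∀ ⦃S B : V⦄ (i : S ⟶ B), I i → IsConnectedObj B) :
    IsTrivialFibration (VGraph.plus I) ε.gammaMap ↔ ∀ n, IsTrivialFibration I (ε.app n) := by
  have key (X : VGraph V) : (VGraph.plus I).rlp (ε.gammaMap.app X) ↔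
      ∀ (a b : X.Obj) (x : SeqFrom a b), I.rlp ((ε.app x.1.len).app (X.homs x.1)) := by
    refine (VGraph.rlp_plus_iff I _ Function.surjective_id).trans (forall₂_congr fun a b => ?_)
    exact rlp_coprod_iff hV hI (E.isCoprod_incl X a b) (F.isCoprod_incl X a b) _ _
      fun x => Sigma.ι_desc _ x
  refine (forall_congr' key).trans ⟨fun h n Z => ?_, fun h X a b x => h _ _⟩
  exact VGraph.forall_homs (P := fun n Z => I.rlp ((ε.app n).app Z)) h n Z

variable {W : Type u'} [Category.{v} W] [HasCoproducts.{v} W]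

/-- The hom maps of Γψ are coproducts of components of ψ once H∐ is recognized as a coproduct, so
the criteria for I⁺ and for coproducts apply one after the other. -/
lemma LaxMonFunctor.rlp_gammaMap_iff (hW : HasCoprodPullbacks W) {E : Multitensor V}
    {F : Multitensor W} (H : LaxMonFunctor E F) (hH : PreservesCoprods H.functor)
    {I : MorphismProperty W} (hI : ∀ ⦃S B : W⦄ (i : S ⟶ B), I i → IsConnectedObj B) :
    (∀ (n : ℕ) (X : Fin n → V), I.rlp (H.coh X)) ↔
      IsTrivialFibration (VGraph.plus I) H.gammaMap := by
  have key (X : VGraph V) : (VGraph.plus I).rlp (H.gammaMap.app X) ↔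
      ∀ (a b : X.Obj) (x : SeqFrom a b), I.rlp (H.coh (X.homs x.1)) := by
    refine (VGraph.rlp_plus_iff I _ Function.surjective_id).trans (forall₂_congr fun a b => ?_)
    -- H sends the inclusions into ΓE(X)(a, b) to a coproduct cocone. With respect to it, what
    -- remains to check is that Γψ restricts to ψ on each summand.
    refine rlp_coprod_iff hW hI (F.isCoprod_incl ((VGraph.mapFunctor H.functor).obj X) a b)
      (hH _ _ _ _ (E.isCoprod_incl X a b)) _ _ fun x => ?_
    have h1 := Sigma.ι_map (fun x : SeqFrom (S := X.Obj) a b => H.coh (X.homs x.1)) x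
    have h2 := ι_comp_sigmaComparison H.functor (fun x : SeqFrom (S := X.Obj) a b =>
      (E.ten x.1.len).obj (X.homs x.1)) x
    refine (Category.assoc _ _ _).symm.trans ((congrArg (· ≫ _) h1).trans ?_)
    exact (Category.assoc _ _ _).trans (congrArg (_ ≫ ·) h2)
  refine Iff.trans ⟨fun h X a b x => h _ _, fun h n Z => ?_⟩ (forall_congr' key).symm
  exact VGraph.forall_homs (P := fun n Z => I.rlp (H.coh Z)) h n Z

end

/-! ### Connected objects -/

section

variable {V : Type u} [Category.{v} V]

lemma IsConnectedObj.mk {B : V} (h : ∀ (J : Type v) (A : J → V) (Z : V) (c : ∀ j, A j ⟶ Z),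
    IsCoprod c → ∀ f : B ⟶ Z, ∃! x : (j : J) × (B ⟶ A j), x.2 ≫ c x.1 = f) : IsConnectedObj B := by
  intro J A Z c hc
  refine isCoprod_type_iff.mpr ⟨fun x y e => ?_, fun f => (h J A Z c hc f).exists⟩
  exact (h J A Z c hc (x.2 ≫ c x.1)).unique rfl e.symm

/-- The initial object is the empty coproduct, and a map from B to it would have to factor through
one of no summands. -/
lemma IsConnectedObj.not_initial {B : V} (hB : IsConnectedObj B) {Z : V} (hZ : IsInitial Z)
    (f : B ⟶ Z) : False :=
  (hB.exists_fac (J := PEmpty) (IsCoprod.of_isInitial (A := fun j => j.elim)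
    (fun j => j.elim) ⟨hZ⟩) f).choose.elim

variable [HasInitial V]

/-- Maps out of 0 are objects, and the objects of a coproduct of graphs form a disjoint union. -/
lemma VGraph.isConnectedObj_point : IsConnectedObj (point V) := by
  refine IsConnectedObj.mk fun J A Z c hc f => ?_
  rw [isCoprod_iff_decomp] at hc
  have ext {X : VGraph V} {p q : point V ⟶ X} (h : p.obj ⟨⟩ = q.obj ⟨⟩) : p = q :=
    hom_ext (fun _ => h) fun _ _ => initialIsInitial.hom_ext _ _
  obtain ⟨⟨j, x⟩, hx⟩ := hc.bij.2 (f.obj ⟨⟩)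
  refine ⟨⟨j, ⟨fun _ => x, fun _ _ => initial.to _⟩⟩, ext hx, ?_⟩
  rintro ⟨k, g⟩ hg
  have h0 : (c k).obj (g.obj ⟨⟩) = (c j).obj x :=
    (congrFun (congrArg Hom.obj hg) ⟨⟩).trans hx.symm
  obtain ⟨rfl, h1⟩ := Sigma.mk.inj (hc.inj h0)
  exact congrArg (Sigma.mk k) (ext (eq_of_heq h1))

/-- A map out of (B) is a pair of objects and a map from B to the hom between them. If the objects
lay in different parts of a coproduct, that hom would be initial, which is impossible for a
connected B. Within one part, the inclusion is invertible on homs. -/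
lemma VGraph.isConnectedObj_susp {B : V} (hB : IsConnectedObj B) : IsConnectedObj (susp B) := by
  refine IsConnectedObj.mk fun J A Z c hc f => ?_
  rw [isCoprod_iff_decomp] at hc
  obtain ⟨⟨j, a⟩, ha⟩ := hc.bij.2 (f.obj ⟨false⟩)
  obtain ⟨⟨k, b⟩, hb⟩ := hc.bij.2 (f.obj ⟨true⟩)
  let m : B ⟶ Z.hom ((c j).obj a) ((c k).obj b) := f.map ⟨false⟩ ⟨true⟩ ≫ Z.cast ha.symm hb.symm
  -- Both endpoints lie in the same part; otherwise `m` would map B to an initial object.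
  obtain rfl : j = k := by
    by_contra hjk
    exact hB.not_initial (hc.init j k a b hjk).some m
  have := hc.iso j
  have hab (z : Bool) : (c j).obj (cond z b a) = f.obj ⟨z⟩ := by
    cases z
    · exact ha
    · exact hb
  refine ⟨⟨j, suspDesc a b (m ≫ inv ((c j).map a b))⟩,
    susp_hom_ext (fun z => hab z.down) ?_, ?_⟩
  · change ((m ≫ inv ((c j).map a b)) ≫ (c j).map a b) ≫ Z.cast ha hb = _
    rw [Category.assoc m, IsIso.inv_hom_id, Category.comp_id]
    exact (Category.assoc _ _ _).trans ((congrArg (_ ≫ ·) (cast_trans _ _ _ _ _)).trans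
      (Category.comp_id _))
  · rintro ⟨l, g⟩ hg
    -- Uniqueness: disjointness of the parts determines the index and both endpoints of any other
    -- factorization. The map on the hom is then determined because the inclusion is invertible
    -- there; the rest is bookkeeping of transports.
    have h0 (z : Bool) : (c l).obj (g.obj ⟨z⟩) = (c j).obj (cond z b a) :=
      (congrFun (congrArg Hom.obj hg) ⟨z⟩).trans (hab z).symm
    obtain rfl := (Sigma.mk.inj (hc.inj (h0 true))).1
    have h1 (z : Bool) : g.obj ⟨z⟩ = cond z b a := eq_of_heq (Sigma.mk.inj (hc.inj (h0 z))).2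
    refine congrArg (Sigma.mk l) (susp_hom_ext (fun z => h1 z.down) ?_)
    change _ = m ≫ inv ((c l).map a b)
    have := this a b
    refine (IsIso.eq_comp_inv ((c l).map a b)).mpr ((Category.assoc _ _ _).trans ?_)
    refine (congrArg (_ ≫ ·) (cast_map (c l) _ _)).trans ((Category.assoc _ _ _).symm.trans ?_)
    have h2 := map_congr hg ⟨false⟩ ⟨true⟩
    have h3 := congrArg (· ≫ Z.cast ha.symm hb.symm) h2
    refine Eq.trans ?_ h3
    refine Eq.trans ?_ (Category.assoc _ _ _).symm
    exact congrArg (_ ≫ ·) (cast_trans _ _ _ _ _).symm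

lemma VGraph.isConnectedObj_plus {I : MorphismProperty V}
    (hI : ∀ ⦃S B : V⦄ (i : S ⟶ B), I i → IsConnectedObj B) ⦃S B : VGraph V⦄ (i : S ⟶ B)
    (hi : plus I i) : IsConnectedObj B := by
  cases hi with
  | point => exact isConnectedObj_point
  | susp i hi => exact isConnectedObj_susp (hI i hi)

end

/-! ### The finite stages: generators of n-globular sets, and operads versus multitensors -/

lemma isConnectedObj_setGen ⦃S B : Type v⦄ (i : S ⟶ B) (hi : setGen i) : IsConnectedObj B := by
  -- Both generators have the one-point set as codomain.
  have : IsConnectedObj PUnit.{v + 1} := by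
    refine IsConnectedObj.mk fun J A Z c hc f => ?_
    rw [isCoprod_type_iff] at hc
    obtain ⟨⟨j, x⟩, hx⟩ := hc.2 (f ⟨⟩)
    refine ⟨⟨j, ↾fun _ => x⟩, ?_, ?_⟩
    · ext
      exact hx
    · rintro ⟨k, g⟩ hg
      have h := hc.1 (a₁ := ⟨k, g ⟨⟩⟩) (a₂ := ⟨j, x⟩)
        ((ConcreteCategory.congr_hom hg ⟨⟩).trans hx.symm)
      obtain ⟨rfl, h1⟩ := Sigma.mk.inj h
      refine congrArg (Sigma.mk k) ?_
      ext
      exact eq_of_heq h1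
  cases hi <;> exact this

lemma NGlob.hasCoprodPullbacks : ∀ n, HasCoprodPullbacks (NGlob.{v} n)
  | 0 => hasCoprodPullbacks_type
  | n + 1 => VGraph.hasCoprodPullbacks (V := NGlob.{v} n)

lemma isConnectedObj_genLE : ∀ (n : ℕ) ⦃S B : NGlob.{v} n⦄ (i : S ⟶ B), genLE n i → IsConnectedObj B
  | 0 => isConnectedObj_setGen
  | n + 1 => VGraph.isConnectedObj_plus (V := NGlob.{v} n) (isConnectedObj_genLE n)

/-- Each component of Γε is the component of α precomposed with an isomorphism, and a right lifting
class respects isomorphisms. -/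
lemma Corresponds.isTrivialFibration_iff {V : Type u} [Category.{v} V] [HasCoproducts.{v} V]
    {E F : Multitensor V} {hF : F.IsDistributive} {A : Monad (VGraph V)} {α : A ⟶ F.gamma hF}
    {ε : Multitensor.Hom E F} (h : Corresponds α ε) (I : MorphismProperty (VGraph V)) :
    IsTrivialFibration I α.toNatTrans ↔ IsTrivialFibration I ε.gammaMap := by
  obtain ⟨hE, θ, hθ⟩ := h
  refine forall_congr' fun X => ?_
  let e : (E.gamma hE).obj X ≅ A.obj X := ((MonadIso.toNatIso θ).app X)
  refine (MorphismProperty.cancel_left_of_respectsIso I.rlp e.hom _).symm.trans ?_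
  exact iff_of_eq (congrArg (fun g : (E.gamma hE).obj X ⟶ (F.gamma hF).obj X => I.rlp g) (hθ X))

/-! ### Globular sets -/

/-- All four corners of a square between images lie in the image of F, so squares and their lifts
correspond. -/
lemma CategoryTheory.Functor.FullyFaithful.hasLiftingProperty_map_iff {C : Type*} [Category* C]
    {D : Type*} [Category* D] {F : C ⥤ D} (hF : F.FullyFaithful) {A B X Y : C} (i : A ⟶ B)
    (f : X ⟶ Y) : HasLiftingProperty (F.map i) (F.map f) ↔ HasLiftingProperty i f := by
  refine ⟨fun h => ⟨fun {s t} sq => ?_⟩, fun h => ⟨fun {s t} sq => ?_⟩⟩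
  · have sq' := sq.map F
    exact CommSq.HasLift.mk' ⟨hF.preimage sq'.lift, hF.map_injective (by simp),
      hF.map_injective (by simp)⟩
  · have sq' : CommSq (hF.preimage s) i f (hF.preimage t) := ⟨hF.map_injective (by simp [sq.w])⟩
    exact CommSq.HasLift.mk' ⟨F.map sq'.lift, by rw [← F.map_comp, sq'.fac_left, hF.map_preimage],
      by rw [← F.map_comp, sq'.fac_right, hF.map_preimage]⟩

namespace Globe

/-- The morphism `m + 1 ⟶ n + 1` of the same kind as a given morphism `m ⟶ n`. -/
def shift {m n : ℕ} (f : (⟨m⟩ : Globe) ⟶ ⟨n⟩) : (⟨m + 1⟩ : Globe) ⟶ ⟨n + 1⟩ :=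
  ⟨f.1, f.2.imp (fun h => ⟨h.1, Globe.ext (congrArg Nat.succ (congrArg dim h.2))⟩)
    (fun h => ⟨h.1, Nat.succ_lt_succ h.2⟩)⟩

lemma unshift_injective {m n : ℕ} : Function.Injective (unshift (m := m) (n := n)) := by
  intro f g h
  have h' : (unshift f).1 = (unshift g).1 := by rw [h]
  exact Subtype.ext h'

/-- There is no identity from 0 to n + 1, so the case `none` does not occur and the default `false`
is never taken. -/
lemma hom_zero {n : ℕ} (f : (⟨0⟩ : Globe) ⟶ ⟨n + 1⟩) : f = face (f.1.getD false) n.succ_pos := by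
  obtain ⟨b, hb⟩ := Option.ne_none_iff_exists'.mp (hom_ne_none f n.succ_pos)
  exact Subtype.ext (by rw [hb]; rfl)

end Globe

namespace Glob

/-- The initial globular set maps to the constant presheaf on the empty set. -/
lemma isEmpty_initial (n : Globeᵒᵖ) : IsEmpty ((⊥_ Glob.{v}).obj n) :=
  ⟨fun x => ((initial.to ((Functor.const _).obj PEmpty.{v + 1} : Glob.{v})).app n x).elim⟩

lemma isIso_of_bijective {X Y : Glob.{v}} (f : X ⟶ Y)
    (h : ∀ n : ℕ, Function.Bijective (f.app (Opposite.op ⟨n⟩))) : IsIso f := by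
  rw [NatTrans.isIso_iff_isIso_app]
  exact fun n => (isIso_iff_bijective _).mpr (h n.unop.dim)

/-! #### The equivalence between graphs enriched in globular sets and globular sets -/

/-- The 0-cells recover the map on objects, and the (n+1)-cells recover the n-cells of all hom maps.
-/
lemma fromGraph_map_injective {X Y : VGraph Glob.{v}} {f g : X ⟶ Y}
    (h : fromGraph.map f = fromGraph.map g) : f = g := by
  have hn (n : ℕ) (x : graphCell X n) : graphMap f n x = graphMap g n x :=
    ConcreteCategory.congr_hom (NatTrans.congr_app h (Opposite.op ⟨n⟩)) x
  obtain ⟨f₀, f₁⟩ := f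
  obtain ⟨g₀, g₁⟩ := g
  obtain rfl : f₀ = g₀ := funext (hn 0)
  refine VGraph.hom_ext' fun a b => ?_
  ext ⟨⟨n⟩⟩ x
  have h1 := hn (n + 1) ⟨a, b, x⟩
  exact eq_of_heq (Sigma.mk.inj (eq_of_heq (Sigma.mk.inj h1).2)).2

/-- Compatibility with 0-dimensional sources and targets makes a map of globular sets send the hom
at (a, b) into the hom at the images of a and b. -/
lemma exists_fromGraph_map {X Y : VGraph Glob.{v}} (g : fromGraph.obj X ⟶ fromGraph.obj Y) :
    ∃ f : X ⟶ Y, fromGraph.map f = g := by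
  let γ (n : ℕ) (x : graphCell X n) : graphCell Y n := g.app (Opposite.op ⟨n⟩) x
  have hγ {m n : ℕ} (f : (⟨m⟩ : Globe) ⟶ ⟨n⟩) (x : graphCell X n) :
      γ m (graphBd X f x) = graphBd Y f (γ n x) :=
    ConcreteCategory.congr_hom (g.naturality f.op) x
  have h (a b : X.Obj) (n : ℕ) (x : (X.hom a b).cell ⟨n⟩) :
      ∃ y : (Y.hom (γ 0 a) (γ 0 b)).cell ⟨n⟩, γ (n + 1) ⟨a, b, x⟩ = ⟨γ 0 a, γ 0 b, y⟩ := by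
    -- The first two entries of an (n+1)-cell are its 0-source and 0-target, and g commutes with
    -- these.
    have h0 := hγ (Globe.face false n.succ_pos) ⟨a, b, x⟩
    have h1 := hγ (Globe.face true n.succ_pos) ⟨a, b, x⟩
    change γ 0 a = (γ (n + 1) ⟨a, b, x⟩).1 at h0
    change γ 0 b = (γ (n + 1) ⟨a, b, x⟩).2.1 at h1
    rw [h0, h1]
    exact ⟨_, rfl⟩
  choose y hy using h
  refine ⟨⟨γ 0, fun a b => ⟨fun n => ↾(y a b n.unop.dim), fun m n f => ?_⟩⟩, ?_⟩
  · ext x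
    -- A morphism of globes acts on the n-cells of a hom as its shift acts on the (n+1)-cells of the
    -- whole, so naturality of g at the shift is naturality on the hom.
    have h1 := hγ (Globe.shift (m := n.unop.dim) (n := m.unop.dim) f.unop) ⟨a, b, x⟩
    rw [hy] at h1
    have h2 := (hy a b n.unop.dim ((X.hom a b).map f x)).symm.trans h1
    exact eq_of_heq (Sigma.mk.inj (eq_of_heq (Sigma.mk.inj h2).2)).2
  · ext ⟨⟨n⟩⟩ x
    cases n with
    | zero => rfl
    | succ n => exact (hy x.1 x.2.1 n x.2.2).symm

/-- `fromGraph` is fully faithful. -/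
noncomputable def fullyFaithfulFromGraph : fromGraph.{v}.FullyFaithful where
  preimage g := (exists_fromGraph_map g).choose
  map_preimage g := (exists_fromGraph_map g).choose_spec
  preimage_map f := fromGraph_map_injective (exists_fromGraph_map (fromGraph.map f)).choose_spec

/-- The graph enriched in globular sets corresponding to a globular set. -/
def toGraph (Z : Glob.{v}) : VGraph Glob.{v} where
  Obj := Z.cell ⟨0⟩
  hom a b :=
    { obj := fun n => {x : Z.cell ⟨n.unop.dim + 1⟩ //
        bd false (Nat.succ_pos _) x = a ∧ bd true (Nat.succ_pos _) x = b}
      map := fun {m n} f => ↾fun x => ⟨Z.map (Globe.shift (m := n.unop.dim) (n := m.unop.dim)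
          f.unop).op x.1, by
        -- Composing a face of dimension 0 with a shifted morphism gives the face of the same kind,
        -- so restriction does not change the 0-source and 0-target.
        have h (c : Bool) : bd c (Nat.succ_pos _) (Z.map (Globe.shift (m := n.unop.dim)
            (n := m.unop.dim) f.unop).op x.1) = bd (k := ⟨0⟩) c (Nat.succ_pos _) x.1 :=
          (ConcreteCategory.congr_hom (Z.map_comp _ _) x.1).symm
        rw [h, h]
        exact x.2⟩
      map_id := fun n => by
        ext x
        exact ConcreteCategory.congr_hom (Z.map_id _) x.1
      map_comp := fun {l m n} f g => by
        ext x
        exact ConcreteCategory.congr_hom (Z.map_comp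
          (Globe.shift (m := m.unop.dim) (n := l.unop.dim) f.unop).op
          (Globe.shift (m := n.unop.dim) (n := m.unop.dim) g.unop).op) x.1 }

/-- The cell of `Z` given by a cell of `toGraph Z`. -/
def toGraphCell (Z : Glob.{v}) : ∀ n : ℕ, graphCell (toGraph Z) n → Z.cell ⟨n⟩
  | 0, x => x
  | _ + 1, x => x.2.2.1

lemma toGraphCell_bd (Z : Glob.{v}) {m n : ℕ} (f : (⟨m⟩ : Globe) ⟶ ⟨n⟩)
    (x : graphCell (toGraph Z) n) :
    toGraphCell Z m (graphBd (toGraph Z) f x) = Z.map f.op (toGraphCell Z n x) := by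
  rcases m with _ | m <;> rcases n with _ | n
  · obtain rfl : f = 𝟙 _ := Subtype.ext (Globe.hom_eq_none f)
    exact (ConcreteCategory.congr_hom (Z.map_id _) x).symm
  · obtain ⟨a, b, x, hx, hx'⟩ := x
    rw [Globe.hom_zero f]
    cases f.1.getD false
    · exact hx.symm
    · exact hx'.symm
  · exact (Globe.hom_ne f (Nat.succ_pos _)).elim
  · rfl

/-- A globular set is recovered from its 0-cells and the globular sets of higher cells between them,
because a cell of positive dimension determines its 0-source and 0-target. -/
lemma exists_iso_fromGraph (Z : Glob.{v}) : ∃ X, Nonempty (fromGraph.obj X ≅ Z) := by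
  let e : fromGraph.obj (toGraph Z) ⟶ Z :=
    { app := fun n => ↾(toGraphCell Z n.unop.dim)
      naturality := fun m n f => by
        ext x
        exact toGraphCell_bd Z (m := n.unop.dim) (n := m.unop.dim) f.unop x }
  have : IsIso e := isIso_of_bijective e fun n => by
    change Function.Bijective (toGraphCell Z n)
    cases n with
    | zero => exact Function.bijective_id
    | succ n =>
      refine ⟨?_, fun x => ⟨⟨_, _, x, rfl, rfl⟩, rfl⟩⟩
      rintro ⟨a, b, x, rfl, rfl⟩ ⟨a', b', x', rfl, rfl⟩ (rfl : x = x')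
      rfl
  exact ⟨_, ⟨asIso e⟩⟩

/-! #### Boundary inclusions of globes -/

/-- The comparison between the cells of the `(k + 1)`-globe and those of the graph `(k)`. -/
noncomputable def globeCell (k : ℕ) :
    ∀ n : ℕ, ((⟨n⟩ : Globe) ⟶ ⟨k + 1⟩) → graphCell (VGraph.susp (globe.{v} ⟨k⟩)) n
  -- The cosource 0 → k+1 is the first object and the cotarget the second; the default is never
  -- used, there being no identity 0 → k+1.
  | 0, f => ⟨f.1.getD false⟩
  | _ + 1, f => ⟨⟨false⟩, ⟨true⟩, ⟨Globe.unshift f⟩⟩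

/-- The comparison between the cells of the boundary of the `(k + 1)`-globe and those of the graph
`(∂k)`. -/
noncomputable def boundaryCell (k : ℕ) : ∀ n : ℕ, ((⟨n⟩ : Globe) ⟶ ⟨k + 1⟩) → n < k + 1 →
    graphCell (VGraph.susp (globeBoundary.{v} ⟨k⟩)) n
  | 0, f, _ => ⟨f.1.getD false⟩
  | _ + 1, f, h => ⟨⟨false⟩, ⟨true⟩, ⟨Globe.unshift f, Nat.lt_of_succ_lt_succ h⟩⟩

/-- A composite of faces has the kind of its first factor unless that factor is an identity. The
right-hand side follows the case distinction in `graphBd`. -/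
lemma comp_getD {n k : ℕ} (f : (⟨0⟩ : Globe) ⟶ ⟨n⟩) (g : (⟨n⟩ : Globe) ⟶ ⟨k⟩) :
    (f ≫ g).1.getD false = if n = 0 then g.1.getD false else decide (f.1 = some true) := by
  have hfg : (f ≫ g).1 = f.1.or g.1 := rfl
  rw [hfg]
  cases n with
  | zero => rw [Globe.hom_eq_none f]; rfl
  | succ n =>
    rw [Globe.hom_zero f]
    cases f.1.getD false <;> rfl

lemma globeCell_bd (k : ℕ) {m n : ℕ} (f : (⟨m⟩ : Globe) ⟶ ⟨n⟩) (g : (⟨n⟩ : Globe) ⟶ ⟨k + 1⟩) :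
    globeCell.{v} k m (f ≫ g) = graphBd _ f (globeCell k n g) := by
  rcases m with _ | m <;> rcases n with _ | n
  · exact congrArg ULift.up (comp_getD f g)
  · refine (congrArg ULift.up (comp_getD f g)).trans ?_
    by_cases h : f.1 = some true <;> simp [h, graphBd, globeCell]
  · exact (Globe.hom_ne f (Nat.succ_pos _)).elim
  · rfl

lemma boundaryCell_bd (k : ℕ) {m n : ℕ} (f : (⟨m⟩ : Globe) ⟶ ⟨n⟩) (g : (⟨n⟩ : Globe) ⟶ ⟨k + 1⟩)
    (h : m < k + 1) (h' : n < k + 1) :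
    boundaryCell.{v} k m (f ≫ g) h = graphBd _ f (boundaryCell k n g h') := by
  rcases m with _ | m <;> rcases n with _ | n
  · exact congrArg ULift.up (comp_getD f g)
  · refine (congrArg ULift.up (comp_getD f g)).trans ?_
    by_cases h : f.1 = some true <;> simp [h, graphBd, boundaryCell]
  · exact (Globe.hom_ne f (Nat.succ_pos _)).elim
  · rfl

lemma globeCell_bijective (k n : ℕ) : Function.Bijective (globeCell.{v} k n) := by
  cases n with
  | zero =>
    refine ⟨fun f g h => ?_, fun x => ⟨Globe.face x.down k.succ_pos, rfl⟩⟩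
    have h' : f.1.getD false = g.1.getD false := congrArg ULift.down h
    rw [Globe.hom_zero f, Globe.hom_zero g, h']
  | succ n =>
    refine ⟨fun f g h => ?_, ?_⟩
    · have h1 := eq_of_heq (Sigma.mk.inj (eq_of_heq (Sigma.mk.inj h).2)).2
      have h2 : Globe.unshift f = Globe.unshift g := ULift.up.inj h1
      exact Globe.unshift_injective h2
    -- Cells of positive dimension exist only in the hom from the first object to the second, the
    -- other homs being empty.
    · rintro ⟨⟨_ | _⟩, ⟨_ | _⟩, x⟩
      · exact ((isEmpty_initial _).false x).elim
      · exact ⟨Globe.shift x.down, rfl⟩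
      · exact ((isEmpty_initial _).false x).elim
      · exact ((isEmpty_initial _).false x).elim

lemma boundaryCell_bijective (k n : ℕ) : Function.Bijective
    fun f : {_f : (⟨n⟩ : Globe) ⟶ ⟨k + 1⟩ // n < k + 1} => boundaryCell.{v} k n f.1 f.2 := by
  cases n with
  | zero =>
    refine ⟨fun f g h => Subtype.ext ?_,
      fun x => ⟨⟨Globe.face x.down k.succ_pos, k.succ_pos⟩, rfl⟩⟩
    have h' : f.1.1.getD false = g.1.1.getD false := congrArg ULift.down h
    rw [Globe.hom_zero f.1, Globe.hom_zero g.1, h']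
  | succ n =>
    refine ⟨fun f g h => ?_, ?_⟩
    · have h1 := eq_of_heq (Sigma.mk.inj (eq_of_heq (Sigma.mk.inj h).2)).2
      have h2 : Globe.unshift f.1 = Globe.unshift g.1 := congrArg Subtype.val (ULift.up.inj h1)
      exact Subtype.ext (Globe.unshift_injective h2)
    · rintro ⟨⟨_ | _⟩, ⟨_ | _⟩, x⟩
      · exact ((isEmpty_initial _).false x).elim
      · exact ⟨⟨Globe.shift x.down.1, Nat.succ_lt_succ x.down.2⟩, rfl⟩
      · exact ((isEmpty_initial _).false x).elim
      · exact ((isEmpty_initial _).false x).elim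

/-- The (k+1)-globe is the suspension of the k-globe: two 0-cells, and the cells of the k-globe
raised by one dimension between them. Removing the top cell commutes with this. -/
lemma globeIncl_succ_iso (k : ℕ) : Nonempty (Arrow.mk (globeIncl.{v} ⟨k + 1⟩) ≅
    Arrow.mk (fromGraph.map (VGraph.suspMap (globeIncl.{v} ⟨k⟩)))) := by
  let φ : globeBoundary.{v} ⟨k + 1⟩ ⟶ fromGraph.obj (VGraph.susp (globeBoundary.{v} ⟨k⟩)) :=
    { app := fun n => ↾fun x => boundaryCell k n.unop.dim x.down.1 x.down.2
      naturality := fun m n f => by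
        ext x
        exact boundaryCell_bd k (m := n.unop.dim) (n := m.unop.dim) f.unop x.down.1 _ x.down.2 }
  let ψ : globe.{v} ⟨k + 1⟩ ⟶ fromGraph.obj (VGraph.susp (globe.{v} ⟨k⟩)) :=
    { app := fun n => ↾fun x => globeCell k n.unop.dim x.down
      naturality := fun m n f => by
        ext x
        exact globeCell_bd k (m := n.unop.dim) (n := m.unop.dim) f.unop x.down }
  have : IsIso φ := isIso_of_bijective φ fun n =>
    (boundaryCell_bijective k n).comp Equiv.ulift.bijective
  have : IsIso ψ := isIso_of_bijective ψ fun n =>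
    (globeCell_bijective k n).comp Equiv.ulift.bijective
  refine ⟨Arrow.isoMk (asIso φ) (asIso ψ) ?_⟩
  ext ⟨⟨n⟩⟩ x
  cases n <;> rfl

/-- The 0-globe is a single point without higher cells, like the graph 0, and its boundary is empty.
-/
lemma globeIncl_zero_iso : Nonempty (Arrow.mk (globeIncl.{v} ⟨0⟩) ≅
    Arrow.mk (fromGraph.map (VGraph.emptyTo (VGraph.point Glob.{v})))) := by
  have h (n : Globeᵒᵖ) : (globeBoundary.{v} ⟨0⟩).obj n → False := fun x =>
    Nat.not_lt_zero _ x.down.2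
  let φ : globeBoundary.{v} ⟨0⟩ ⟶ fromGraph.obj (VGraph.empty Glob.{v}) :=
    { app := fun n => ↾fun x => (h n x).elim
      naturality := fun m n f => by
        ext x
        exact (h m x).elim }
  let p : ∀ n : ℕ, ((⟨n⟩ : Globe) ⟶ ⟨0⟩) → graphCell (VGraph.point Glob.{v}) n
    | 0, _ => ⟨⟩
    | _ + 1, f => (Globe.hom_ne f (Nat.succ_pos _)).elim
  let ψ : globe.{v} ⟨0⟩ ⟶ fromGraph.obj (VGraph.point Glob.{v}) :=
    { app := fun n => ↾fun x => p n.unop.dim x.down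
      naturality := fun m n f => by
        ext x
        obtain ⟨⟨_ | m⟩⟩ := m
        · obtain ⟨⟨_ | n⟩⟩ := n
          · rfl
          · exact (Globe.hom_ne f.unop (Nat.succ_pos _)).elim
        · exact (Globe.hom_ne x.down (Nat.succ_pos _)).elim }
  have : IsIso φ := isIso_of_bijective φ fun n => by
    refine ⟨fun x => (h _ x).elim, fun y => ?_⟩
    cases n with
    | zero => exact PEmpty.elim y
    | succ n => exact PEmpty.elim y.1
  have : IsIso ψ := isIso_of_bijective ψ fun n => by
    cases n with
    | zero =>
      refine ⟨fun x y _ => ULift.ext _ _ (Subtype.ext ?_), fun y => ⟨⟨𝟙 _⟩, rfl⟩⟩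
      exact (Globe.hom_eq_none x.down).trans (Globe.hom_eq_none y.down).symm
    | succ n =>
      -- A higher cell of the graph 0 would lie in its hom, which is initial and hence empty.
      exact ⟨fun x => (Globe.hom_ne x.down (Nat.succ_pos _)).elim,
        fun y => ((isEmpty_initial _).false y.2.2).elim⟩
  refine ⟨Arrow.isoMk (asIso φ) (asIso ψ) ?_⟩
  ext n x
  exact (h n x).elim

/-- Under the identification of graphs with globular sets, ∂0 ↪ 0 is ∅ → 0 and ∂(k+1) ↪ k+1 is the
suspension of ∂k ↪ k. So I_{≤∞} is its own successor, which is the meaning of ∞ + 1 = ∞ on the level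
of generators. -/
lemma rlp_fromGraph_map_iff {X Y : VGraph Glob.{v}} (f : X ⟶ Y) :
    genInf.rlp (fromGraph.map f) ↔ (VGraph.plus genInf).rlp f := by
  have h0 : HasLiftingProperty (globeIncl.{v} ⟨0⟩) (fromGraph.map f) ↔
      HasLiftingProperty (VGraph.emptyTo (VGraph.point Glob.{v})) f :=
    (HasLiftingProperty.iff_of_arrow_iso_left globeIncl_zero_iso.some _).trans
      (fullyFaithfulFromGraph.hasLiftingProperty_map_iff _ _)
  have hs (k : ℕ) : HasLiftingProperty (globeIncl.{v} ⟨k + 1⟩) (fromGraph.map f) ↔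
      HasLiftingProperty (VGraph.suspMap (globeIncl.{v} ⟨k⟩)) f :=
    (HasLiftingProperty.iff_of_arrow_iso_left (globeIncl_succ_iso k).some _).trans
      (fullyFaithfulFromGraph.hasLiftingProperty_map_iff _ _)
  constructor
  · rintro h _ _ _ (_ | ⟨_, ⟨⟨k⟩⟩⟩)
    · exact h0.mp (h _ (genInf.mk _))
    · exact (hs k).mp (h _ (genInf.mk _))
  · rintro h _ _ _ ⟨⟨_ | k⟩⟩
    · exact h0.mpr (h _ VGraph.plus.point)
    · exact (hs k).mpr (h _ (VGraph.plus.susp _ (genInf.mk _)))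

/-- By Yoneda, maps from the k-globe to Z are the k-cells of Z, and coproducts of globular sets are
disjoint unions in each dimension. -/
lemma isConnectedObj_globe (k : Globe) : IsConnectedObj (globe.{v} k) := by
  refine IsConnectedObj.mk fun J A Z c hc f => ?_
  have hk := isCoprod_type_iff.mp (hc.map ((evaluation _ _).obj (Opposite.op k)))
  -- The injectivity part of Yoneda: a map out of the globe is determined by the image of its top
  -- cell.
  have ext {X : Glob.{v}} {p q : globe k ⟶ X} (h : p.app _ ⟨𝟙 k⟩ = q.app _ ⟨𝟙 k⟩) : p = q := by
    have hp (r : globe k ⟶ X) (n : Globeᵒᵖ) (y : n.unop ⟶ k) :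
        r.app n ⟨y⟩ = X.map y.op (r.app _ ⟨𝟙 k⟩) := by
      refine Eq.trans ?_ (ConcreteCategory.congr_hom (r.naturality y.op) ⟨𝟙 k⟩)
      exact congrArg (fun z => r.app n ⟨z⟩) (Category.comp_id y).symm
    ext n y
    exact (hp p n y.down).trans ((congrArg (X.map y.down.op) h).trans (hp q n y.down).symm)
  obtain ⟨⟨j, x⟩, hx⟩ := hk.2 (f.app _ ⟨𝟙 k⟩)
  let g : globe k ⟶ A j :=
    { app := fun n => ↾fun y => (A j).map y.down.op x
      naturality := fun m n h => by
        ext y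
        exact ConcreteCategory.congr_hom ((A j).map_comp y.down.op h) x }
  have hg : g.app _ ⟨𝟙 k⟩ = x := ConcreteCategory.congr_hom ((A j).map_id _) x
  refine ⟨⟨j, g⟩, ext ((congrArg ((c j).app _) hg).trans hx), ?_⟩
  rintro ⟨l, g'⟩ h
  have h' : (c l).app _ (g'.app _ ⟨𝟙 k⟩) = (c j).app _ x :=
    (ConcreteCategory.congr_hom (NatTrans.congr_app h _) (⟨𝟙 k⟩ : (globe k).cell k)).trans hx.symm
  obtain ⟨rfl, h1⟩ := Sigma.mk.inj (hk.1 (a₁ := ⟨l, g'.app _ ⟨𝟙 k⟩⟩) (a₂ := ⟨j, x⟩) h')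
  exact congrArg (Sigma.mk l) (ext ((eq_of_heq h1).trans hg.symm))

lemma isConnectedObj_genInf ⦃S B : Glob.{v}⦄ (i : S ⟶ B) (hi : genInf i) : IsConnectedObj B := by
  cases hi
  exact isConnectedObj_globe _

end Glob

/-! ### The infinite stage and the theorem -/

/-- At a graph, α agrees with the image of Γε up to isomorphisms on both sides, so
`Glob.rlp_fromGraph_map_iff` applies. Every globular set comes from a graph up to isomorphism. -/
lemma CorrespondsInf.isTrivialFibration_iff {A : Monad Glob.{v}} {α : A ⟶ omegaMonad}
    {E : Multitensor Glob.{v}} {ε : Multitensor.Hom E (times omegaMonad)}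
    (h : CorrespondsInf α ε) : IsTrivialFibration Glob.genInf α.toNatTrans ↔
      IsTrivialFibration (VGraph.plus Glob.genInf) ε.gammaMap := by
  obtain ⟨hE, hT, κ, θ, hθ⟩ := h
  let I := Glob.genInf.{v}.rlp
  have key (X : VGraph Glob.{v}) : I (α.app (Glob.fromGraph.obj X)) ↔
      (VGraph.plus Glob.genInf).rlp (ε.gammaMap.app X) := by
    refine Iff.trans ?_ (Glob.rlp_fromGraph_map_iff (ε.gammaMap.app X))
    have h1 := MorphismProperty.cancel_left_of_respectsIso I (θ.iso.hom.app X)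
      (α.app (Glob.fromGraph.obj X))
    have h2 := @MorphismProperty.cancel_right_of_respectsIso _ _ I _ _ _ _
      (Glob.fromGraph.map (ε.gammaMap.app X)) (κ.iso.hom.app X) (NatIso.hom_app_isIso κ.iso X)
    refine h1.symm.trans (Iff.trans ?_ h2)
    exact iff_of_eq (congrArg (fun g => I g) (hθ X))
  refine ⟨fun h X => (key X).mp (h _), fun h Z => ?_⟩
  -- Naturality of α at the isomorphism e carries the lifting property from a globular set of the
  -- form `fromGraph X` to an arbitrary Z.
  obtain ⟨X, ⟨e⟩⟩ := Glob.exists_iso_fromGraph Z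
  have h1 := (key X).mpr (h X)
  rw [← MorphismProperty.cancel_left_of_respectsIso Glob.genInf.rlp (A.map e.hom)]
  refine (congrArg (fun g : A.obj (Glob.fromGraph.obj X) ⟶ omegaMonad.obj Z => I g) (α.toNatTrans.naturality e.hom)).mpr ?_
  exact (MorphismProperty.cancel_right_of_respectsIso I _ (omegaMonad.map e.hom)).mpr h1

theorem mainTheorem7 :
    -- the proposition on lax monoidal functors
    (∀ (V : Type u) [Category.{v} V] [HasCoproducts.{v} V]
        (W : Type u') [Category.{v} W] [HasCoproducts.{v} W]
        (E : Multitensor V) (_ : E.IsDistributive) (F : Multitensor W) (_ : F.IsDistributive)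
        (H : LaxMonFunctor E F) (I : MorphismProperty W),
        IsExtensive W → PreservesCoprods H.functor →
        (∀ ⦃S B : W⦄ (i : S ⟶ B), I i → IsConnectedObj B) →
          ((∀ (n : ℕ) (X : Fin n → V), I.rlp (H.coh X)) ↔
            IsTrivialFibration (VGraph.plus I) H.gammaMap)) ∧
    -- the corollary on operads over sets, for finite `n`
    (∀ (n : ℕ) (A : Monad (NGlob.{v} (n + 1))) (α : A ⟶ strictMonad (n + 1))
        (_ : IsOperadOverSet (V := NGlob.{v} n) α)
        (E : Multitensor (NGlob.{v} n)) (ε : Multitensor.Hom E (times (strictMonad n)))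
        (_ : ε.IsCartesian) (_ : Corresponds (V := NGlob.{v} n) α ε),
        IsTrivialFibration (genLE (n + 1)) α.toNatTrans ↔
          ∀ m, IsTrivialFibration (genLE n) (ε.app m)) ∧
    -- the corollary on operads over sets, for `n = ∞`
    (∀ (A : Monad Glob.{v}) (α : A ⟶ omegaMonad) (_ : Glob.IsOperadOverSet α)
        (E : Multitensor Glob.{v}) (ε : Multitensor.Hom E (times omegaMonad))
        (_ : ε.IsCartesian) (_ : CorrespondsInf α ε),
        IsTrivialFibration Glob.genInf α.toNatTrans ↔
          ∀ m, IsTrivialFibration Glob.genInf (ε.app m)) := by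
  refine ⟨?_, ?_, ?_⟩
  · intro V _ _ W _ _ E _ F _ H I hW hH hI
    exact H.rlp_gammaMap_iff hW.hasCoprodPullbacks hH hI
  · intro n A α _ E ε _ h
    -- By definition the generators at n + 1 are `VGraph.plus` of those at n and the monad at n + 1
    -- is Γ of the multitensor at n, so the criterion for Γε applies as it stands.
    refine (Corresponds.isTrivialFibration_iff (V := NGlob.{v} n) h (genLE (n + 1))).trans ?_
    exact ε.rlp_gammaMap_iff (NGlob.hasCoprodPullbacks n) (isConnectedObj_genLE n)
  · intro A α _ E ε _ h
    exact h.isTrivialFibration_iff.trans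
      (ε.rlp_gammaMap_iff Glob.hasCoprodPullbacks Glob.isConnectedObj_genInf)
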